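/- Let $1<\alpha<2$, $0\le r\le 1$, and let $\beta\in[\alpha-1,1]$ be determined by $r=\dfrac{\sin(\pi\beta)}{\sin(\pi(\alpha-\beta))+\sin(\pi\beta)}$. Write $\omega^{(a,b)}(x)=(1-x)^a x^b$ on $(0,1)$, $(v,w)_{\omega^{(a,b)}}=\int_0^1\omega^{(a,b)}vw\,dx$, $\|v\|_{\omega^{(a,b)}}=(v,v)_{\omega^{(a,b)}}^{1/2}$. For $m\in\mathbb N_0$ let $\|v\|_{m,\omega^{(a,b)}}^2=\sum_{j=0}^m\|D^jv\|^2_{\omega^{(a+j,b+j)}}$ (weak derivatives on $(0,1)$), let $H^m_{\omega^{(a,b)}}$ be the space of functions for which this is finite, and let $\|v\|_{W^m_\infty}=\max_{j\le m}\|D^jv\|_{L^\infty(0,1)}$. Let $G^{(a,b)}_n(t)=P^{(a,b)}_n(2t-1)$ be the Jacobi polynomials shifted to $[0,1]$. Let $K$ satisfy $0<K_m\le K(x)\le K_M$ on $(0,1)$, and put $f_1(x)=\frac1{K(x)}\int_0^xf(y)\,dy$, $f_2=\frac1K$. Let $u$ be the solution of $$-\big(r\,{}_0I_x^{2-\alpha}+(1-r)\,{}_xI_1^{2-\alpha}\big)Du=f_1-Af_2\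 \text{ on }(0,1),\qquad u(0)=u(1)=0,$$ where ${}_0I_x^{\sigma}w(x)=\frac1{\Gamma(\sigma)}\int_0^x w(t)(x-t)^{\sigma-1}dt$, ${}_xI_1^{\sigma}w(x)=\frac1{\Gamma(\sigma)}\int_x^1 w(t)(t-x)^{\sigma-1}dt$, and the constant $A$ is the value at $x=0$ of the flux $K\big(r\,{}_0I_x^{2-\alpha}+(1-r)\,{}_xI_1^{2-\alpha}\big)Du$. That is: $f$ is integrable on $(0,x)$ for every $x<1$, $u$ is absolutely continuous on $[0,1]$, and the equation holds almost everywhere for some constant $A$. (This is $-D[K(r\,{}_0I_x^{2-\alpha}+(1-r)\,{}_xI_1^{2-\alpha})Du]=f$ with $u(0)=u(1)=0$, integrated once.) Let $$u_N=\omega^{(\alpha-\beta,\beta)}\sum_{i=0}^{N}c_i\,G_i^{(\alpha-\beta,\beta)},\qquad c_i=\frac{-f_{1,i+1}+A_*f_{2,i+1}}{\lambda_i},\qquad A_*=\frac{(f_1,1)_{\omega^{(\beta-1,\alpha-\beta-1)}}}{(f_2,1)_{\omega^{(\beta-1,\alpha-\beta-1)}}},$$ $$\lambda_i=\frac{\sin(\pi\alpha)}{\sin(\pi(\alpha-\beta))+\sin(\pi\beta)}\,\frac{\Gamma(i+\alpha)}{i!},\qquad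 f_{k,j}=\frac{\big(f_k,G_j^{(\beta-1,\alpha-\beta-1)}\big)_{\omega^{(\beta-1,\alpha-\beta-1)}}}{\big\|G_j^{(\beta-1,\alpha-\beta-1)}\big\|^2_{\omega^{(\beta-1,\alpha-\beta-1)}}}.$$ **Theorem.** Let $s\in\mathbb N_0$. There is a constant $C>0$, depending only on $\alpha,\beta,r,s,K_m,K_M$, and not on $K_m,K_M$ if $0<r<1$, such that whenever $f\in H^s_{\omega^{(\beta,\alpha-\beta)}}$ and $1/K\in W^{s+1}_\infty(0,1)$, the following holds for all $N\in\mathbb N_0$: $$\|u-u_N\|_{\omega^{(-(\alpha-\beta),-\beta)}}\le\frac{C\,\|1/K\|_{W^{s+1}_\infty}}{(N+1)^{\alpha+s}}\big(\|f\|_{s,\omega^{(\beta,\alpha-\beta)}}+1\big).$$ -/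

import Mathlib

open MeasureTheory Set
open scoped ENNReal ContDiff Nat

noncomputable section

namespace FracDiff

/-! ### Weights, weighted `L²` and weighted Sobolev norms on `(0,1)` -/

/-- The weight `ω^{(a,b)}(x) = (1 - x)^a x^b` on `(0,1)`. -/
def weight (a b x : ℝ) : ℝ := (1 - x) ^ a * x ^ b

/-- The measure `ω^{(a,b)}(x) dx` on `(0,1)`. -/
def weightMeasure (a b : ℝ) : Measure ℝ :=
  (volume.restrict (Ioo (0 : ℝ) 1)).withDensity fun x => ENNReal.ofReal (weight a b x)

/-- The weighted inner product `(f, g)_{ω^{(a,b)}}`. -/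
def weightInner (a b : ℝ) (f g : ℝ → ℝ) : ℝ :=
  ∫ x in Ioo (0 : ℝ) 1, weight a b x * f x * g x

/-- The weighted norm `‖v‖_{ω^{(a,b)}} = (∫₀¹ ω^{(a,b)} v²)^{1/2}`, with values in `[0, ∞]`. -/
def weightNorm (a b : ℝ) (v : ℝ → ℝ) : ℝ≥0∞ := eLpNorm v 2 (weightMeasure a b)

/-- `g` is a weak derivative of order `k` of `v` on `(0,1)`. -/
def IsWeakDeriv (k : ℕ) (v g : ℝ → ℝ) : Prop :=
  LocallyIntegrableOn v (Ioo (0 : ℝ) 1) ∧ LocallyIntegrableOn g (Ioo (0 : ℝ) 1) ∧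
    ∀ η : ℝ → ℝ, ContDiff ℝ ∞ η → HasCompactSupport η → tsupport η ⊆ Ioo (0 : ℝ) 1 →
      ∫ x in Ioo (0 : ℝ) 1, v x * iteratedDeriv k η x =
        (-1) ^ k * ∫ x in Ioo (0 : ℝ) 1, g x * η x

/-- The seminorm `|v|_{j, ω^{(a,b)}} = ‖D^j v‖_{ω^{(a+j,b+j)}}`. The weak derivative `D^j v` is unique
up to null sets, so the infimum is the value at it; it is `∞` if there is no weak derivative. -/
def weightSeminorm (j : ℕ) (a b : ℝ) (v : ℝ → ℝ) : ℝ≥0∞ :=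
  ⨅ (g : ℝ → ℝ) (_ : IsWeakDeriv j v g), weightNorm (a + j) (b + j) g

/-- The norm `‖v‖_{m, ω^{(a,b)}} = (∑_{j ≤ m} |v|²_{j, ω^{(a,b)}})^{1/2}`; the space
`H^m_{ω^{(a,b)}}` consists of the `v` for which it is finite. -/
def weightSobolevNorm (m : ℕ) (a b : ℝ) (v : ℝ → ℝ) : ℝ≥0∞ :=
  (∑ j ∈ Finset.range (m + 1), weightSeminorm j a b v ^ 2) ^ (1 / 2 : ℝ)

/-- The norm `‖v‖_{W^m_∞} = max_{j ≤ m} ‖D^j v‖_{L^∞(0,1)}`; the space `W^m_∞(0,1)` consists of the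
`v` for which it is finite. -/
def sobolevInftyNorm (m : ℕ) (v : ℝ → ℝ) : ℝ≥0∞ :=
  (Finset.range (m + 1)).sup fun j =>
    ⨅ (g : ℝ → ℝ) (_ : IsWeakDeriv j v g), eLpNorm g ∞ (volume.restrict (Ioo (0 : ℝ) 1))

/-! ### Shifted Jacobi polynomials -/

/-- The binomial coefficient `x (x - 1) ⋯ (x - k + 1) / k!` with real upper argument. -/
def realBinom (x : ℝ) (k : ℕ) : ℝ := (∏ i ∈ Finset.range k, (x - i)) / k !

/-- The Jacobi polynomial `P_n^{(a,b)}` on `[-1,1]`. -/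
def jacobiP (n : ℕ) (a b x : ℝ) : ℝ :=
  ∑ m ∈ Finset.range (n + 1),
    1 / 2 ^ n * realBinom (n + a) m * realBinom (n + b) (n - m) * (x - 1) ^ (n - m) * (x + 1) ^ m

/-- The Jacobi polynomial `G_n^{(a,b)}(t) = P_n^{(a,b)}(2t - 1)` on `[0,1]`. -/
def jacobiG (n : ℕ) (a b t : ℝ) : ℝ := jacobiP n a b (2 * t - 1)

/-! ### The fractional boundary value problem -/

/-- The left fractional integral `₀I_x^σ w (x)`. -/
def leftFracInt (σ : ℝ) (w : ℝ → ℝ) (x : ℝ) : ℝ :=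
  1 / Real.Gamma σ * ∫ s in Ioo (0 : ℝ) x, w s * (x - s) ^ (σ - 1)

/-- The right fractional integral `ₓI_1^σ w (x)`. -/
def rightFracInt (σ : ℝ) (w : ℝ → ℝ) (x : ℝ) : ℝ :=
  1 / Real.Gamma σ * ∫ s in Ioo x (1 : ℝ), w s * (s - x) ^ (σ - 1)

/-- `f₁(x) = (1 / K(x)) ∫₀ˣ f`. -/
def f₁ (K f : ℝ → ℝ) (x : ℝ) : ℝ := 1 / K x * ∫ y in Ioo (0 : ℝ) x, f y

/-- `f₂(x) = 1 / K(x)`. -/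
def f₂ (K : ℝ → ℝ) (x : ℝ) : ℝ := 1 / K x

/-- `u` solves `-(r ₀I_x^{2-α} + (1-r) ₓI_1^{2-α}) Du = f₁ - A f₂` a.e. on `(0,1)` for some constant `A`,
with `u(0) = u(1) = 0`. Here `u` is absolutely continuous on `[0,1]` with (a.e.) derivative `w = Du` in
`L¹(0,1)`, and the integral in `f₁` has to exist. Equivalently, the flux
`K (r ₀I_x^{2-α} + (1-r) ₓI_1^{2-α}) Du` has the locally absolutely continuous representative
`A - ∫₀ˣ f`, whose value at `0` is `A`, so that minus its derivative is `f`. -/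
def IsSolution (α r : ℝ) (K f u : ℝ → ℝ) : Prop :=
  (∀ x ∈ Ioo (0 : ℝ) 1, IntegrableOn f (Ioo 0 x)) ∧
  ∃ w : ℝ → ℝ, IntegrableOn w (Ioo (0 : ℝ) 1) ∧
    (∀ x ∈ Icc (0 : ℝ) 1, u x = ∫ t in Ioo (0 : ℝ) x, w t) ∧ u 0 = 0 ∧ u 1 = 0 ∧
    ∃ A : ℝ, ∀ᵐ x ∂volume.restrict (Ioo (0 : ℝ) 1),
      -(r * leftFracInt (2 - α) w x + (1 - r) * rightFracInt (2 - α) w x) =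
        f₁ K f x - A * f₂ K x

/-! ### The truncated spectral approximation -/

/-- `A = (f₁, 1)_{ω^{(β-1,α-β-1)}} / (1/K, 1)_{ω^{(β-1,α-β-1)}}`. -/
def constA (α β : ℝ) (K f : ℝ → ℝ) : ℝ :=
  weightInner (β - 1) (α - β - 1) (f₁ K f) (fun _ => 1) /
    weightInner (β - 1) (α - β - 1) (f₂ K) (fun _ => 1)

/-- The coefficient of `g` along `G_j^{(β-1,α-β-1)}` in `L²_{ω^{(β-1,α-β-1)}}`. -/
def jacobiCoeff (α β : ℝ) (g : ℝ → ℝ) (j : ℕ) : ℝ :=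
  weightInner (β - 1) (α - β - 1) g (jacobiG j (β - 1) (α - β - 1)) /
    weightInner (β - 1) (α - β - 1) (jacobiG j (β - 1) (α - β - 1))
      (jacobiG j (β - 1) (α - β - 1))

/-- `λ_n = sin(πα) / (sin(π(α-β)) + sin(πβ)) · Γ(n+α) / n!`. -/
def eigenval (α β : ℝ) (n : ℕ) : ℝ :=
  Real.sin (Real.pi * α) / (Real.sin (Real.pi * (α - β)) + Real.sin (Real.pi * β)) *
    (Real.Gamma (n + α) / n !)

/-- `c_j = (-f_{1,j+1} + A f_{2,j+1}) / λ_j`. -/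
def spectralCoeff (α β : ℝ) (K f : ℝ → ℝ) (j : ℕ) : ℝ :=
  (-jacobiCoeff α β (f₁ K f) (j + 1) + constA α β K f * jacobiCoeff α β (f₂ K) (j + 1)) /
    eigenval α β j

/-- `u_N(x) = ω^{(α-β,β)}(x) ∑_{i=0}^N c_i G_i^{(α-β,β)}(x)`. -/
def spectralApprox (α β : ℝ) (K f : ℝ → ℝ) (N : ℕ) (x : ℝ) : ℝ :=
  weight (α - β) β x *
    ∑ i ∈ Finset.range (N + 1), spectralCoeff α β K f i * jacobiG i (α - β) β x

end FracDiff

end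

noncomputable section

namespace FracDiff

/-! ### Jacobi polynomials -/

/-! Put a = β - 1, b = α - β - 1, σ = 2 - α, let L_r be the operator r ₀I^σ + (1-r) ₓI_1^σ, and
write w = Du and F = f₁ - A f₂, so that -L_r w = F. The choice of β makes weighted Jacobi
polynomials diagonalise the problem: the adjoint of L_r with respect to dx is L_{1-r}
(`FracParams.adjoint`), and L_{1-r}(ω^{(a,b)} G_n^{(a,b)}) = μ_n G_n^{(b,a)} with μ_n = `fracEigen a
b σ n` (`FracParams.fracOp_jacobi`). For the latter, the moments ∫ ω^{(a,b)} x^n L_r x^k are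
computed. For n = 0, Euler's reflection formula and the Chu–Vandermonde identity show that L_{1-r}
ω^{(a,b)} is constant. A recursion in n then shows that L_{1-r}(ω^{(a,b)} ·) acts on polynomials as
a triangular map with diagonal μ_n, and adjointness with orthogonality forces Jacobi polynomials to
go to Jacobi polynomials.

Pairing the equation with G_n^{(a,b)} gives (F, G_n^{(a,b)})_ω = -μ_n ∫ w G_n^{(b,a)}. For n = 0 the
right side is a multiple of u(1) = 0, so F has weighted mean zero, which identifies A with A_*. For
n = i + 1 one integration by parts, using u(0) = u(1) = 0, turns it into a moment of u against
G_i^{(b+1,a+1)}; hence the c_i are exactly the Jacobi coefficients of u / ω^{(α-β,β)}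
(`FracParams.integral_solution_jacobi`, `spectralCoeff_eq`). So u_N is a truncated orthogonal
expansion and the error is the ℓ² tail of its coefficients.

The rate has two sources. First, |λ_i| is at least a multiple of (i+1)^{α-1}, by log-convexity of Γ.
Second, the Jacobi coefficients of F decay like i^{-(s+1)}: s + 1 integrations by parts move
derivatives onto F while raising both weight exponents by one each time, and Bessel's inequality
sums the result (`jacobi_tail_le`). Orthogonality, norms and decay all rest on the single shift
relation `integral_weight_jacobi_succ`.

It remains to bound the derivatives of F = (1/K) H, where H = ∫f - A has derivative f. Leibniz' rule
leaves only ‖H‖ itself (`exists_source_chain`). Cauchy–Schwarz bounds the primitive of f, and A is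
an average of that primitive with positive weight ω^{(a,b)}/K. If 0 < r < 1, both a and b are
negative, the primitive is bounded, and so is A, whatever K is. If r is 0 or 1, the primitive may
blow up at an end point, and comparing averages costs a factor K_M/K_m (`exists_primitive_bound`).
-/

lemma realBinom_zero (x : ℝ) : realBinom x 0 = 1 := by simp [realBinom]

lemma realBinom_succ_mul (x : ℝ) (k : ℕ) :
    (k + 1) * realBinom x (k + 1) = (x - k) * realBinom x k := by
  have h1 : (k ! : ℝ) ≠ 0 := by positivity
  have h2 : (k + 1 : ℝ) ≠ 0 := by positivity
  simp only [realBinom, Finset.prod_range_succ, Nat.factorial_succ]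
  push_cast
  field_simp

/-- The coefficient of `(t - 1)^(n-m) t^m` in `G_n^{(a,b)}`. -/
def jacobiTerm (n : ℕ) (a b : ℝ) (m : ℕ) : ℝ := realBinom (n + a) m * realBinom (n + b) (n - m)

/-- The shifted Jacobi polynomial `G_n^{(a,b)}` as a polynomial. -/
def jacobiPoly (n : ℕ) (a b : ℝ) : Polynomial ℝ :=
  ∑ m ∈ Finset.range (n + 1),
    Polynomial.C (jacobiTerm n a b m) * ((Polynomial.X - 1) ^ (n - m) * Polynomial.X ^ m)

lemma eval_jacobiPoly (n : ℕ) (a b t : ℝ) : (jacobiPoly n a b).eval t = jacobiG n a b t := by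
  simp only [jacobiPoly, jacobiG, jacobiP, jacobiTerm, Polynomial.eval_finsetSum,
    Polynomial.eval_mul, Polynomial.eval_C, Polynomial.eval_pow, Polynomial.eval_sub,
    Polynomial.eval_X, Polynomial.eval_one]
  refine Finset.sum_congr rfl fun m hm => ?_
  have hm' : n - m + m = n := Nat.sub_add_cancel (Nat.lt_succ_iff.mp (Finset.mem_range.mp hm))
  have h2 : (2 : ℝ) ^ n = 2 ^ (n - m) * 2 ^ m := by rw [← pow_add, hm']
  rw [show (2 * t - 1 - 1 : ℝ) = 2 * (t - 1) by ring, show (2 * t - 1 + 1 : ℝ) = 2 * t by ring,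
    mul_pow, mul_pow, h2]
  field_simp

lemma jacobiPoly_zero (a b : ℝ) : jacobiPoly 0 a b = 1 := by
  simp [jacobiPoly, jacobiTerm, realBinom_zero]

/-- Absorption (`realBinom_succ_mul`) in the second binomial; `jacobiTerm_shift_right` is its
counterpart in the first. These two relations carry both the derivative formula and the raising
formula. -/
lemma jacobiTerm_shift_left (n m : ℕ) (a b : ℝ) (hm : m ≤ n) :
    (m + b + 1) * jacobiTerm n (a + 1) (b + 1) m =
      (n + 1 - m : ℝ) * jacobiTerm (n + 1) a b m := by
  obtain ⟨k, rfl⟩ := Nat.exists_eq_add_of_le hm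
  have h := realBinom_succ_mul ((m + k : ℕ) + (b + 1)) k
  simp only [jacobiTerm, Nat.add_sub_cancel_left, show m + k + 1 - m = k + 1 by omega]
  push_cast at h ⊢
  rw [show (m + k + 1 + b : ℝ) = m + k + (b + 1) by ring,
    show (m + k + 1 + a : ℝ) = m + k + (a + 1) by ring]
  linear_combination -(realBinom (m + k + (a + 1)) m) * h

lemma jacobiTerm_shift_right (n m : ℕ) (a b : ℝ) :
    (n - m + a + 1 : ℝ) * jacobiTerm n (a + 1) (b + 1) m =
      (m + 1 : ℝ) * jacobiTerm (n + 1) a b (m + 1) := by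
  have h := realBinom_succ_mul (n + (a + 1)) m
  simp only [jacobiTerm, Nat.add_sub_add_right]
  push_cast at h ⊢
  rw [show (n + 1 + b : ℝ) = n + (b + 1) by ring, show (n + 1 + a : ℝ) = n + (a + 1) by ring]
  linear_combination -(realBinom (n + (b + 1)) (n - m)) * h

/-- Evaluation of the derivative, term by term. -/
lemma eval_derivative_jacobiPoly_sum (n : ℕ) (a b t : ℝ) :
    (jacobiPoly n a b).derivative.eval t = ∑ m ∈ Finset.range (n + 1), jacobiTerm n a b m *
      (((n - m : ℕ) : ℝ) * (t - 1) ^ (n - m - 1) * t ^ m + (t - 1) ^ (n - m) * (m * t ^ (m - 1))) := by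
  simp only [jacobiPoly, Polynomial.derivative_sum, Polynomial.eval_finsetSum]
  refine Finset.sum_congr rfl fun m _ => ?_
  simp [Polynomial.derivative_pow]

/-- In the product rule, the term m of one sum and the term m + 1 of the other share the factor
(t-1)^{n-m} t^m. By the shift relations their coefficients add up to (m + b + 1) + (n - m + a + 1) =
n + a + b + 2 times the shifted one. -/
lemma derivative_jacobiPoly_succ (n : ℕ) (a b : ℝ) :
    (jacobiPoly (n + 1) a b).derivative =
      Polynomial.C (n + a + b + 2) * jacobiPoly n (a + 1) (b + 1) := by
  refine Polynomial.funext fun t => ?_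
  rw [eval_derivative_jacobiPoly_sum]
  simp only [mul_add, Finset.sum_add_distrib]
  rw [Finset.sum_range_succ, Finset.sum_range_succ' (fun m => jacobiTerm (n + 1) a b m *
    ((t - 1) ^ (n + 1 - m) * (m * t ^ (m - 1))))]
  simp only [jacobiPoly, Polynomial.eval_mul, Polynomial.eval_C, Polynomial.eval_finsetSum,
    Polynomial.eval_pow, Polynomial.eval_sub, Polynomial.eval_X, Polynomial.eval_one,
    Finset.mul_sum]
  simp only [Nat.sub_self, Nat.cast_zero, zero_mul, mul_zero, add_zero]
  rw [← Finset.sum_add_distrib]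
  refine Finset.sum_congr rfl fun m hm => ?_
  have hm' : m ≤ n := Nat.lt_succ_iff.mp (Finset.mem_range.mp hm)
  have h1 := jacobiTerm_shift_left n m a b hm'
  have h2 := jacobiTerm_shift_right n m a b
  rw [Nat.add_sub_add_right, show n + 1 - m - 1 = n - m by omega, Nat.add_sub_cancel,
    Nat.cast_sub (by omega)]
  push_cast
  linear_combination (-(t - 1) ^ (n - m) * t ^ m) * h1 - (t - 1) ^ (n - m) * t ^ m * h2

/-- The derivative of `ω^{(a+1,b+1)} G_n^{(a+1,b+1)}`, divided by `ω^{(a,b)}`. -/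
lemma jacobiPoly_raising (n : ℕ) (a b t : ℝ) :
    t * (1 - t) * (jacobiPoly n (a + 1) (b + 1)).derivative.eval t +
      ((b + 1) * (1 - t) - (a + 1) * t) * (jacobiPoly n (a + 1) (b + 1)).eval t =
      -(n + 1) * (jacobiPoly (n + 1) a b).eval t := by
  have key : ∀ m ∈ Finset.range (n + 1),
      t * (1 - t) * (jacobiTerm n (a + 1) (b + 1) m *
      (((n - m : ℕ) : ℝ) * (t - 1) ^ (n - m - 1) * t ^ m + (t - 1) ^ (n - m) * (m * t ^ (m - 1)))) +
      ((b + 1) * (1 - t) - (a + 1) * t) * (jacobiTerm n (a + 1) (b + 1) m *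
        ((t - 1) ^ (n - m) * t ^ m)) =
      -((n + 1 - m : ℝ) * (jacobiTerm (n + 1) a b m * ((t - 1) ^ (n + 1 - m) * t ^ m))) -
      (m + 1 : ℕ) * (jacobiTerm (n + 1) a b (m + 1) *
        ((t - 1) ^ (n + 1 - (m + 1)) * t ^ (m + 1))) := by
    intro m hm
    have hm' : m ≤ n := Nat.lt_succ_iff.mp (Finset.mem_range.mp hm)
    have h1 := jacobiTerm_shift_left n m a b hm'
    have h2 := jacobiTerm_shift_right n m a b
    have e1 : ((n - m : ℕ) : ℝ) * (t - 1) ^ (n - m - 1) * (t - 1) =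
        (n - m : ℝ) * (t - 1) ^ (n - m) := by
      rw [← Nat.cast_sub hm']
      rcases Nat.eq_zero_or_pos (n - m) with h | h
      · simp [h]
      · rw [mul_assoc, ← pow_succ, Nat.sub_add_cancel h]
    have e2 : (m : ℝ) * t ^ (m - 1) * t = m * t ^ m := by
      rcases Nat.eq_zero_or_pos m with h | h
      · simp [h]
      · rw [mul_assoc, ← pow_succ, Nat.sub_add_cancel h]
    rw [Nat.add_sub_add_right, show n + 1 - m = n - m + 1 by omega, pow_succ (t - 1), pow_succ t]
    push_cast
    linear_combination (-t * t ^ m * jacobiTerm n (a + 1) (b + 1) m) * e1 +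
      ((1 - t) * (t - 1) ^ (n - m) * jacobiTerm n (a + 1) (b + 1) m) * e2 +
      ((1 - t) * (t - 1) ^ (n - m) * t ^ m) * h1 - (t * (t - 1) ^ (n - m) * t ^ m) * h2
  rw [eval_derivative_jacobiPoly_sum]
  simp only [jacobiPoly, Polynomial.eval_mul, Polynomial.eval_C, Polynomial.eval_finsetSum,
    Polynomial.eval_pow, Polynomial.eval_sub, Polynomial.eval_X, Polynomial.eval_one,
    Finset.mul_sum]
  rw [← Finset.sum_add_distrib, Finset.sum_congr rfl key, Finset.sum_sub_distrib,
    Finset.sum_neg_distrib]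
  have e3 : ∑ m ∈ Finset.range (n + 1 + 1), (m : ℝ) * (jacobiTerm (n + 1) a b m *
        ((t - 1) ^ (n + 1 - m) * t ^ m)) = ∑ m ∈ Finset.range (n + 1), ((m + 1 : ℕ) : ℝ) *
        (jacobiTerm (n + 1) a b (m + 1) * ((t - 1) ^ (n + 1 - (m + 1)) * t ^ (m + 1))) := by
    rw [Finset.sum_range_succ']; simp
  have e4 : ∑ m ∈ Finset.range (n + 1 + 1), (n + 1 - m : ℝ) * (jacobiTerm (n + 1) a b m *
        ((t - 1) ^ (n + 1 - m) * t ^ m)) = ∑ m ∈ Finset.range (n + 1), (n + 1 - m : ℝ) *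
        (jacobiTerm (n + 1) a b m * ((t - 1) ^ (n + 1 - m) * t ^ m)) := by
    rw [Finset.sum_range_succ]; simp
  rw [← e3, ← e4, ← Finset.sum_neg_distrib, ← Finset.sum_sub_distrib]
  refine Finset.sum_congr rfl fun m _ => ?_
  ring

/-! ### Reflection, degree and leading coefficient of Jacobi polynomials -/

lemma jacobiG_reflect (n : ℕ) (a b t : ℝ) :
    jacobiG n a b (1 - t) = (-1) ^ n * jacobiG n b a t := by
  rw [← eval_jacobiPoly, ← eval_jacobiPoly]
  simp only [jacobiPoly, Polynomial.eval_mul, Polynomial.eval_C, Polynomial.eval_finsetSum,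
    Polynomial.eval_pow, Polynomial.eval_sub, Polynomial.eval_X, Polynomial.eval_one,
    Finset.mul_sum]
  rw [← Finset.sum_range_reflect]
  refine Finset.sum_congr rfl fun m hm => ?_
  have hm' : m ≤ n := Nat.lt_succ_iff.mp (Finset.mem_range.mp hm)
  rw [show n + 1 - 1 - m = n - m by omega]
  simp only [jacobiTerm, Nat.sub_sub_self hm']
  rw [show (1 - t - 1 : ℝ) = (-1) * t by ring, show (1 - t : ℝ) = (-1) * (t - 1) by ring,
    mul_pow, mul_pow]
  have : (-1 : ℝ) ^ n = (-1) ^ m * (-1) ^ (n - m) := by rw [← pow_add, Nat.add_sub_cancel' hm']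
  rw [this]; ring

lemma natDegree_jacobiPoly_le (n : ℕ) (a b : ℝ) : (jacobiPoly n a b).natDegree ≤ n := by
  refine Polynomial.natDegree_sum_le_of_forall_le _ _ fun m hm => ?_
  have hm' : m ≤ n := Nat.lt_succ_iff.mp (Finset.mem_range.mp hm)
  refine (Polynomial.natDegree_C_mul_le _ _).trans (Polynomial.natDegree_mul_le.trans ?_)
  have h1 : ((Polynomial.X - 1 : Polynomial ℝ) ^ (n - m)).natDegree ≤ n - m := by
    refine Polynomial.natDegree_pow_le.trans ?_
    rw [show (Polynomial.X - 1 : Polynomial ℝ) = Polynomial.X - Polynomial.C 1 by simp,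
      Polynomial.natDegree_X_sub_C, mul_one]
  rw [Polynomial.natDegree_X_pow]
  omega

lemma coeff_jacobiPoly_succ (n : ℕ) (a b : ℝ) :
    (n + 1) * (jacobiPoly (n + 1) a b).coeff (n + 1) =
      (n + a + b + 2) * (jacobiPoly n (a + 1) (b + 1)).coeff n := by
  have := congrArg (fun p => Polynomial.coeff p n) (derivative_jacobiPoly_succ n a b)
  simp only [Polynomial.coeff_derivative, Polynomial.coeff_C_mul] at this
  linarith

/-- The leading coefficient depends on `a + b` only. -/
lemma coeff_jacobiPoly_congr (n : ℕ) : ∀ a b a' b' : ℝ, a + b = a' + b' →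
    (jacobiPoly n a b).coeff n = (jacobiPoly n a' b').coeff n := by
  induction n with
  | zero => intro a b a' b' _; simp [jacobiPoly_zero]
  | succ n ih =>
    intro a b a' b' h
    have h1 := coeff_jacobiPoly_succ n a b
    have h2 := coeff_jacobiPoly_succ n a' b'
    rw [ih (a + 1) (b + 1) (a' + 1) (b' + 1) (by linarith),
      show (n + a + b + 2 : ℝ) = n + a' + b' + 2 by linarith, ← h2] at h1
    exact mul_left_cancel₀ (by positivity) h1

lemma coeff_jacobiPoly_pos (n : ℕ) : ∀ a b : ℝ, -2 < a + b → 0 < (jacobiPoly n a b).coeff n := by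
  induction n with
  | zero => intro a b _; simp [jacobiPoly_zero]
  | succ n ih =>
    intro a b h
    have h1 := coeff_jacobiPoly_succ n a b
    have h2 := ih (a + 1) (b + 1) (by linarith)
    have h3 : (0 : ℝ) ≤ n := n.cast_nonneg
    have : 0 < (n + 1 : ℝ) * (jacobiPoly (n + 1) a b).coeff (n + 1) := by
      rw [h1]; exact mul_pos (by linarith) h2
    exact pos_of_mul_pos_right this (by positivity)

/-! ### Weights -/

/-- Lebesgue measure on `(0,1)`. -/
abbrev unitMeasure : Measure ℝ := volume.restrict (Ioo (0 : ℝ) 1)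

lemma ae_unit_of_forall {p : ℝ → Prop} (h : ∀ x ∈ Ioo (0 : ℝ) 1, p x) : ∀ᵐ x ∂unitMeasure, p x :=
  ae_restrict_of_forall_mem measurableSet_Ioo h

lemma weight_pos (a b : ℝ) {x : ℝ} (hx : x ∈ Ioo (0 : ℝ) 1) : 0 < weight a b x :=
  mul_pos (Real.rpow_pos_of_pos (by linarith [hx.2]) _) (Real.rpow_pos_of_pos hx.1 _)

@[fun_prop]
lemma measurable_weight (a b : ℝ) : Measurable (weight a b) := by
  unfold weight; fun_prop

lemma weight_mul_weight (a b a' b' : ℝ) {x : ℝ} (hx : x ∈ Ioo (0 : ℝ) 1) :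
    weight a b x * weight a' b' x = weight (a + a') (b + b') x := by
  have h1 : 0 < 1 - x := by linarith [hx.2]
  simp only [weight, Real.rpow_add h1, Real.rpow_add hx.1]
  ring

lemma weight_zero_zero (x : ℝ) : weight 0 0 x = 1 := by simp [weight]

lemma weight_succ (a b : ℝ) {x : ℝ} (hx : x ∈ Ioo (0 : ℝ) 1) :
    weight (a + 1) (b + 1) x = x * (1 - x) * weight a b x := by
  rw [← weight_mul_weight a b 1 1 hx]
  simp only [weight, Real.rpow_one]
  ring

lemma weight_reflect (a b x : ℝ) : weight a b (1 - x) = weight b a x := by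
  simp only [weight, sub_sub_cancel]; ring

lemma weight_le_weight {a b a' b' : ℝ} (ha : a' ≤ a) (hb : b' ≤ b) {x : ℝ}
    (hx : x ∈ Ioo (0 : ℝ) 1) : weight a b x ≤ weight a' b' x := by
  have h1 : 0 < 1 - x := by linarith [hx.2]
  exact mul_le_mul (Real.rpow_le_rpow_of_exponent_ge h1 (by linarith [hx.1]) ha)
    (Real.rpow_le_rpow_of_exponent_ge hx.1 hx.2.le hb) (Real.rpow_nonneg hx.1.le _)
    (Real.rpow_nonneg h1.le _)

/-- Normalisation of the beta density; its first parameter belongs to the power of x, hence the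
order `b + 1`, `a + 1`. -/
lemma lintegral_weight {a b : ℝ} (ha : -1 < a) (hb : -1 < b) :
    ∫⁻ x, ENNReal.ofReal (weight a b x) ∂unitMeasure =
      ENNReal.ofReal (ProbabilityTheory.beta (b + 1) (a + 1)) := by
  have hB : 0 < ProbabilityTheory.beta (b + 1) (a + 1) :=
    ProbabilityTheory.beta_pos (by linarith) (by linarith)
  have h := ProbabilityTheory.lintegral_betaPDF_eq_one (α := b + 1) (β := a + 1)
    (by linarith) (by linarith)
  rw [ProbabilityTheory.lintegral_betaPDF] at h
  have h2 : ∀ x, ENNReal.ofReal (1 / ProbabilityTheory.beta (b + 1) (a + 1) * x ^ (b + 1 - 1) *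
      (1 - x) ^ (a + 1 - 1)) = ENNReal.ofReal (1 / ProbabilityTheory.beta (b + 1) (a + 1)) *
      ENNReal.ofReal (weight a b x) := by
    intro x
    rw [← ENNReal.ofReal_mul (by positivity)]
    simp only [add_sub_cancel_right, weight]
    congr 1; ring
  simp_rw [h2] at h
  rw [lintegral_const_mul _ (by fun_prop)] at h
  have h3 := ENNReal.eq_inv_of_mul_eq_one_left (by rwa [mul_comm] at h)
  rw [h3, ← ENNReal.ofReal_inv_of_pos (by positivity), one_div, inv_inv]

lemma integrable_weight {a b : ℝ} (ha : -1 < a) (hb : -1 < b) :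
    Integrable (weight a b) unitMeasure := by
  refine ⟨(measurable_weight a b).aestronglyMeasurable, ?_⟩
  rw [hasFiniteIntegral_iff_ofReal (ae_unit_of_forall fun x hx => (weight_pos a b hx).le),
    lintegral_weight ha hb]
  exact ENNReal.ofReal_lt_top

lemma integral_weight {a b : ℝ} (ha : -1 < a) (hb : -1 < b) :
    ∫ x in Ioo (0 : ℝ) 1, weight a b x =
      Real.Gamma (a + 1) * Real.Gamma (b + 1) / Real.Gamma (a + b + 2) := by
  rw [integral_eq_lintegral_of_nonneg_ae (ae_unit_of_forall fun x hx => (weight_pos a b hx).le)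
    (measurable_weight a b).aestronglyMeasurable, lintegral_weight ha hb, ENNReal.toReal_ofReal
    (ProbabilityTheory.beta_pos (by linarith) (by linarith)).le, ProbabilityTheory.beta,
    show b + 1 + (a + 1) = a + b + 2 by ring]
  ring

lemma integral_weight_mul_pow {a b : ℝ} (ha : -1 < a) (hb : -1 < b) (n : ℕ) :
    ∫ x in Ioo (0 : ℝ) 1, weight a b x * x ^ n =
      Real.Gamma (a + 1) * Real.Gamma (b + n + 1) / Real.Gamma (a + b + n + 2) := by
  have h := integral_weight ha (b := b + n) (by have := n.cast_nonneg (α := ℝ); linarith)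
  rw [show a + (b + n) + 2 = a + b + n + 2 by ring] at h
  rw [← h]
  refine setIntegral_congr_fun measurableSet_Ioo fun x hx => ?_
  simp only [weight, Real.rpow_add hx.1, Real.rpow_natCast]
  ring

lemma integrable_weightMeasure_iff {a b : ℝ} {f : ℝ → ℝ} :
    Integrable f (weightMeasure a b) ↔ Integrable (fun x => weight a b x * f x) unitMeasure := by
  rw [weightMeasure, integrable_withDensity_iff_integrable_smul' (by fun_prop)
    (Filter.Eventually.of_forall fun _ => ENNReal.ofReal_lt_top)]
  refine integrable_congr (ae_unit_of_forall fun x hx => ?_)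
  beta_reduce
  rw [ENNReal.toReal_ofReal (weight_pos a b hx).le, smul_eq_mul]

lemma integral_weightMeasure (a b : ℝ) (f : ℝ → ℝ) :
    ∫ x, f x ∂weightMeasure a b = ∫ x in Ioo (0 : ℝ) 1, weight a b x * f x := by
  rw [weightMeasure, integral_withDensity_eq_integral_toReal_smul (by fun_prop)
    (Filter.Eventually.of_forall fun _ => ENNReal.ofReal_lt_top)]
  refine setIntegral_congr_fun measurableSet_Ioo fun x hx => ?_
  simp only [ENNReal.toReal_ofReal (weight_pos a b hx).le, smul_eq_mul]

lemma lintegral_weightMeasure (a b : ℝ) (f : ℝ → ℝ≥0∞) :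
    ∫⁻ x, f x ∂weightMeasure a b =
      ∫⁻ x, ENNReal.ofReal (weight a b x) * f x ∂unitMeasure := by
  rw [weightMeasure, lintegral_withDensity_eq_lintegral_mul_non_measurable _ (by fun_prop)
    (Filter.Eventually.of_forall fun _ => ENNReal.ofReal_lt_top)]
  rfl

lemma ae_weightMeasure_iff {a b : ℝ} {p : ℝ → Prop} :
    (∀ᵐ x ∂weightMeasure a b, p x) ↔ ∀ᵐ x ∂unitMeasure, p x := by
  rw [weightMeasure, ae_withDensity_iff (by fun_prop)]
  refine Filter.eventually_congr (ae_unit_of_forall fun x hx => ?_)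
  simp [weight_pos a b hx]

lemma aestronglyMeasurable_weightMeasure_iff {a b : ℝ} {f : ℝ → ℝ} :
    AEStronglyMeasurable f (weightMeasure a b) ↔ AEStronglyMeasurable f unitMeasure := by
  constructor
  · intro h
    refine h.mono_ac (Measure.AbsolutelyContinuous.mk fun s _ h0 => ?_)
    rw [measure_eq_zero_iff_ae_notMem] at h0 ⊢
    exact ae_weightMeasure_iff.1 h0
  · intro h
    exact h.mono_ac (withDensity_absolutelyContinuous _ _)

lemma isFiniteMeasure_weightMeasure {a b : ℝ} (ha : -1 < a) (hb : -1 < b) :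
    IsFiniteMeasure (weightMeasure a b) := by
  refine isFiniteMeasure_withDensity ?_
  rw [lintegral_weight ha hb]
  exact ENNReal.ofReal_ne_top

lemma weightMeasure_mono {a b a' b' : ℝ} (ha : a' ≤ a) (hb : b' ≤ b) :
    weightMeasure a b ≤ weightMeasure a' b' :=
  withDensity_mono (ae_unit_of_forall fun x hx =>
    ENNReal.ofReal_le_ofReal (weight_le_weight ha hb hx))

lemma weightNorm_sq {a b : ℝ} {v : ℝ → ℝ} :
    weightNorm a b v ^ 2 = ∫⁻ x, ENNReal.ofReal (weight a b x * v x ^ 2) ∂unitMeasure := by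
  rw [weightNorm, eLpNorm_eq_lintegral_rpow_enorm_toReal (by norm_num) (by norm_num),
    ← ENNReal.rpow_natCast, ← ENNReal.rpow_mul, lintegral_weightMeasure]
  norm_num
  refine lintegral_congr_ae (ae_unit_of_forall fun x hx => ?_)
  beta_reduce
  rw [ENNReal.ofReal_mul (weight_pos a b hx).le, ← sq_abs, ENNReal.ofReal_pow (abs_nonneg _),
    ← Real.norm_eq_abs, ofReal_norm]

lemma ofReal_integral_sq {a b : ℝ} {v : ℝ → ℝ} (hv : MemLp v 2 (weightMeasure a b)) :
    ENNReal.ofReal (∫ x in Ioo (0 : ℝ) 1, weight a b x * v x ^ 2) = weightNorm a b v ^ 2 := by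
  rw [weightNorm_sq, ofReal_integral_eq_lintegral_ofReal]
  · exact integrable_weightMeasure_iff.1 hv.integrable_sq
  · exact ae_unit_of_forall fun x hx => mul_nonneg (weight_pos a b hx).le (sq_nonneg _)

/-! ### The reflection x ↦ 1 - x of the unit interval -/

lemma integral_reflect (f : ℝ → ℝ) :
    ∫ x in Ioo (0 : ℝ) 1, f (1 - x) = ∫ x in Ioo (0 : ℝ) 1, f x := by
  have := (volume : Measure ℝ).measurePreserving_sub_left 1
  have h := this.setIntegral_preimage_emb
    (MeasurableEquiv.subLeft (1 : ℝ)).measurableEmbedding f (Ioo 0 1)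
  rw [← h]
  congr 2
  ext x; simp

lemma integrable_reflect {f : ℝ → ℝ} (hf : Integrable f unitMeasure) :
    Integrable (fun x => f (1 - x)) unitMeasure := by
  have := (volume : Measure ℝ).measurePreserving_sub_left 1
  have h := (this.integrableOn_comp_preimage (f := f) (s := Ioo 0 1)
    (MeasurableEquiv.subLeft (1 : ℝ)).measurableEmbedding).2 hf
  have e : (fun x : ℝ => 1 - x) ⁻¹' Ioo 0 1 = Ioo 0 1 := by
    ext x; simp
  rw [e] at h
  exact h

/-! ### Moments determine integrable functions -/

lemma integrable_mul_continuousOn {g : ℝ → ℝ} (hg : Integrable g unitMeasure) {q : ℝ → ℝ}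
    (hq : ContinuousOn q (Icc 0 1)) : Integrable (fun x => g x * q x) unitMeasure := by
  obtain ⟨C, hC⟩ := isCompact_Icc.exists_bound_of_continuousOn hq
  refine hg.mul_bdd (c := C) ?_ (ae_unit_of_forall fun x hx => hC x ⟨hx.1.le, hx.2.le⟩)
  exact (hq.mono Ioo_subset_Icc_self).aestronglyMeasurable measurableSet_Ioo

/-- Weierstrass approximation: an integrable function orthogonal to all polynomials is orthogonal to
every function continuous on [0,1], in particular to all test functions. -/
lemma ae_eq_zero_of_moments {g : ℝ → ℝ} (hg : Integrable g unitMeasure)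
    (h : ∀ p : Polynomial ℝ, ∫ x in Ioo (0 : ℝ) 1, g x * p.eval x = 0) :
    ∀ᵐ x ∂unitMeasure, g x = 0 := by
  rw [ae_restrict_iff' measurableSet_Ioo]
  refine isOpen_Ioo.ae_eq_zero_of_integral_contDiff_smul_eq_zero
    (IntegrableOn.locallyIntegrableOn hg) fun q hq _ hsupp => ?_
  have e1 : ∫ x, q x • g x = ∫ x in Ioo (0 : ℝ) 1, g x * q x := by
    rw [setIntegral_eq_integral_of_forall_compl_eq_zero]
    · simp [mul_comm]
    · intro x hx
      rw [image_eq_zero_of_notMem_tsupport fun hx' => hx (hsupp hx'), mul_zero]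
  rw [e1]
  have hc : ContinuousOn q (Icc 0 1) := hq.continuous.continuousOn
  refine eq_of_abs_sub_le_all fun ε hε => ?_
  have hI : 0 ≤ ∫ x in Ioo (0 : ℝ) 1, |g x| := integral_nonneg fun _ => abs_nonneg _
  obtain ⟨p, hp⟩ := exists_polynomial_near_of_continuousOn 0 1 q hc
    (ε / (1 + ∫ x in Ioo (0 : ℝ) 1, |g x|)) (by positivity)
  calc |(∫ x in Ioo (0 : ℝ) 1, g x * q x) - 0|
      = |∫ x in Ioo (0 : ℝ) 1, (g x * q x - g x * p.eval x)| := by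
        rw [integral_sub (integrable_mul_continuousOn hg hc)
          (integrable_mul_continuousOn hg p.continuous.continuousOn), h p]
    _
      ≤ ∫ x in Ioo (0 : ℝ) 1, |g x| * (ε / (1 + ∫ x in Ioo (0 : ℝ) 1, |g x|)) := by
        rw [← Real.norm_eq_abs]
        refine norm_integral_le_of_norm_le (hg.abs.mul_const _) (ae_unit_of_forall fun x hx => ?_)
        rw [← mul_sub, Real.norm_eq_abs, abs_mul, abs_sub_comm]
        exact mul_le_mul_of_nonneg_left (hp x ⟨hx.1.le, hx.2.le⟩).le (abs_nonneg _)
    _ ≤ ε := by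
        rw [integral_mul_const, mul_div_assoc', div_le_iff₀ (by positivity)]
        nlinarith

/-! ### Weak derivatives in one variable -/

lemma IsWeakDeriv.congr_ae {k : ℕ} {v g v' g' : ℝ → ℝ} (h : IsWeakDeriv k v g)
    (hv : v =ᵐ[unitMeasure] v') (hg : g =ᵐ[unitMeasure] g') : IsWeakDeriv k v' g' := by
  refine ⟨h.1.congr hv, h.2.1.congr hg, fun η h1 h2 h3 => ?_⟩
  have e1 : ∫ x in Ioo (0 : ℝ) 1, v' x * iteratedDeriv k η x =
      ∫ x in Ioo (0 : ℝ) 1, v x * iteratedDeriv k η x :=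
    integral_congr_ae (hv.mono fun x hx => by simp only [hx])
  have e2 : ∫ x in Ioo (0 : ℝ) 1, g' x * η x = ∫ x in Ioo (0 : ℝ) 1, g x * η x :=
    integral_congr_ae (hg.mono fun x hx => by simp only [hx])
  rw [e1, e2, h.2.2 η h1 h2 h3]

lemma integrable_mul_test {v η : ℝ → ℝ}
    (hv : LocallyIntegrableOn v (Ioo (0 : ℝ) 1)) (hη : Continuous η) (hc : HasCompactSupport η)
    (hs : tsupport η ⊆ Ioo (0 : ℝ) 1) : Integrable (fun x => v x * η x) unitMeasure := by
  have h1 : IntegrableOn (fun x => v x * η x) (tsupport η) :=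
    (hv.integrableOn_compact_subset hs hc).mul_continuousOn hη.continuousOn hc
  have h2 : Integrable (fun x => v x * η x) := by
    refine (integrableOn_iff_integrable_of_support_subset fun x hx => ?_).1 h1
    by_contra h
    exact hx (by simp [image_eq_zero_of_notMem_tsupport h])
  exact h2.integrableOn

lemma ae_eq_of_test {g g' : ℝ → ℝ} (hg : LocallyIntegrableOn g (Ioo (0 : ℝ) 1))
    (hg' : LocallyIntegrableOn g' (Ioo (0 : ℝ) 1))
    (h : ∀ η : ℝ → ℝ, ContDiff ℝ ∞ η → HasCompactSupport η → tsupport η ⊆ Ioo (0 : ℝ) 1 →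
      ∫ x in Ioo (0 : ℝ) 1, g x * η x = ∫ x in Ioo (0 : ℝ) 1, g' x * η x) :
    g =ᵐ[unitMeasure] g' := by
  have : ∀ᵐ x, x ∈ Ioo (0 : ℝ) 1 → g x - g' x = 0 := by
    refine isOpen_Ioo.ae_eq_zero_of_integral_contDiff_smul_eq_zero (hg.sub hg')
      fun η h1 h2 h3 => ?_
    have e1 : ∫ x, η x • (g x - g' x) = ∫ x in Ioo (0 : ℝ) 1, (g x * η x - g' x * η x) := by
      rw [setIntegral_eq_integral_of_forall_compl_eq_zero]
      · exact integral_congr_ae (Filter.Eventually.of_forall fun x => by simp; ring)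
      · intro x hx
        rw [image_eq_zero_of_notMem_tsupport fun hx' => hx (h3 hx')]; ring
    rw [e1, integral_sub (integrable_mul_test hg h1.continuous h2 h3)
      (integrable_mul_test hg' h1.continuous h2 h3), h η h1 h2 h3, sub_self]
  rw [Filter.EventuallyEq, ae_restrict_iff' measurableSet_Ioo]
  exact this.mono fun x hx hx' => by linarith [hx hx']

lemma IsWeakDeriv.unique {k : ℕ} {v g g' : ℝ → ℝ} (h : IsWeakDeriv k v g)
    (h' : IsWeakDeriv k v g') : g =ᵐ[unitMeasure] g' := by
  refine ae_eq_of_test h.2.1 h'.2.1 fun η h1 h2 h3 => ?_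
  have := (h.2.2 η h1 h2 h3).symm.trans (h'.2.2 η h1 h2 h3)
  exact mul_left_cancel₀ (pow_ne_zero k (by norm_num)) this

lemma IsWeakDeriv.zero_ae_eq {v g : ℝ → ℝ} (h : IsWeakDeriv 0 v g) : g =ᵐ[unitMeasure] v := by
  refine ae_eq_of_test h.2.1 h.1 fun η h1 h2 h3 => ?_
  simpa using (h.2.2 η h1 h2 h3).symm

/-- Test functions are closed under differentiation, so η' may be used in the relation of order j.
This turns the derivatives of all orders of one function, as in the Sobolev norms, into a chain of
first-order steps. -/
lemma IsWeakDeriv.succ {j : ℕ} {v g g' : ℝ → ℝ} (h : IsWeakDeriv j v g)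
    (h' : IsWeakDeriv (j + 1) v g') : IsWeakDeriv 1 g g' := by
  refine ⟨h.2.1, h'.2.1, fun η h1 h2 h3 => ?_⟩
  have e1 := h.2.2 (deriv η) (contDiff_infty_iff_deriv.1 h1).2 h2.deriv
    (tsupport_deriv_subset.trans h3)
  have e2 := h'.2.2 η h1 h2 h3
  rw [iteratedDeriv_succ', e1, pow_succ, mul_assoc] at e2
  rw [iteratedDeriv_one]
  have := mul_left_cancel₀ (pow_ne_zero j (by norm_num)) e2
  simpa using this


lemma IsWeakDeriv.add {v g v' g' : ℝ → ℝ} (h : IsWeakDeriv 1 v g)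
    (h' : IsWeakDeriv 1 v' g') : IsWeakDeriv 1 (fun x => v x + v' x) (fun x => g x + g' x) := by
  refine ⟨h.1.add h'.1, h.2.1.add h'.2.1, fun η h1 h2 h3 => ?_⟩
  have hd : Continuous (iteratedDeriv 1 η) := by
    rw [iteratedDeriv_one]; exact (contDiff_infty_iff_deriv.1 h1).2.continuous
  have hc : HasCompactSupport (iteratedDeriv 1 η) := by rw [iteratedDeriv_one]; exact h2.deriv
  have hs : tsupport (iteratedDeriv 1 η) ⊆ Ioo 0 1 := by
    rw [iteratedDeriv_one]; exact tsupport_deriv_subset.trans h3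
  simp only [add_mul]
  rw [integral_add (integrable_mul_test h.1 hd hc hs) (integrable_mul_test h'.1 hd hc hs),
    integral_add (integrable_mul_test h.2.1 h1.continuous h2 h3)
      (integrable_mul_test h'.2.1 h1.continuous h2 h3), h.2.2 η h1 h2 h3, h'.2.2 η h1 h2 h3]
  ring

lemma IsWeakDeriv.const_mul {k : ℕ} {v g : ℝ → ℝ} (c : ℝ) (h : IsWeakDeriv k v g) :
    IsWeakDeriv k (fun x => c * v x) (fun x => c * g x) := by
  refine ⟨h.1.smul c, h.2.1.smul c, fun η h1 h2 h3 => ?_⟩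
  simp only [mul_assoc, integral_const_mul]
  rw [h.2.2 η h1 h2 h3]
  ring

lemma isWeakDeriv_zero (k : ℕ) : IsWeakDeriv k (fun _ => 0) (fun _ => 0) :=
  ⟨locallyIntegrableOn_zero, locallyIntegrableOn_zero, fun η _ _ _ => by simp⟩

lemma IsWeakDeriv.sum {ι : Type*} (s : Finset ι) {v g : ι → ℝ → ℝ}
    (h : ∀ i ∈ s, IsWeakDeriv 1 (v i) (g i)) :
    IsWeakDeriv 1 (fun x => ∑ i ∈ s, v i x) (fun x => ∑ i ∈ s, g i x) := by
  classical
  induction s using Finset.induction_on with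
  | empty => simpa using isWeakDeriv_zero 1
  | insert i s hi ih =>
    simp only [Finset.sum_insert hi]
    exact (h i (Finset.mem_insert_self _ _)).add
      (ih fun j hj => h j (Finset.mem_insert_of_mem hj))

/-! ### Primitives -/

/-- `F` is a primitive of the locally integrable function `g` on `(0,1)`. -/
def IsPrimitive (F g : ℝ → ℝ) : Prop :=
  LocallyIntegrableOn g (Ioo (0 : ℝ) 1) ∧
    ∀ x ∈ Ioo (0 : ℝ) 1, ∀ y ∈ Ioo (0 : ℝ) 1, F y - F x = ∫ t in x..y, g t

lemma intervalIntegrable_of_locallyIntegrableOn {g : ℝ → ℝ}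
    (hg : LocallyIntegrableOn g (Ioo (0 : ℝ) 1)) {x y : ℝ} (hx : x ∈ Ioo (0 : ℝ) 1)
    (hy : y ∈ Ioo (0 : ℝ) 1) : IntervalIntegrable g volume x y := by
  rw [intervalIntegrable_iff']
  exact hg.integrableOn_compact_subset (ordConnected_Ioo.uIcc_subset hx hy) isCompact_uIcc

lemma exists_Ioo_of_test {η : ℝ → ℝ} (hc : HasCompactSupport η)
    (hs : tsupport η ⊆ Ioo (0 : ℝ) 1) :
    ∃ p q : ℝ, 0 < p ∧ p < q ∧ q < 1 ∧ tsupport η ⊆ Ioo p q := by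
  -- The point 1/2 is added so that the compact set is nonempty even if the function vanishes
  -- identically.
  have hK : IsCompact (tsupport η ∪ {1 / 2}) := IsCompact.union hc isCompact_singleton
  have hne : (tsupport η ∪ {1 / 2}).Nonempty := ⟨1 / 2, Or.inr rfl⟩
  have hsub : tsupport η ∪ {1 / 2} ⊆ Ioo (0 : ℝ) 1 := by
    refine union_subset hs ?_
    rw [singleton_subset_iff]; norm_num
  obtain ⟨p, hp, hp'⟩ := hK.exists_isLeast hne
  obtain ⟨q, hq, hq'⟩ := hK.exists_isGreatest hne
  have h1 := hsub hp
  have h2 := hsub hq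
  have h3 := hp' hq
  refine ⟨p / 2, (q + 1) / 2, by linarith [h1.1], by linarith [h1.1, h2.2], by linarith [h2.2],
    fun x hx => ⟨?_, ?_⟩⟩
  · linarith [hp' (Or.inl hx), h1.1]
  · linarith [hq' (Or.inl hx), h2.2]

lemma integral_unit_eq_intervalIntegral {f : ℝ → ℝ} {p q : ℝ} (hp : 0 < p) (hpq : p < q)
    (hq : q < 1) (hf : ∀ x, x ∉ Ioo p q → f x = 0) :
    ∫ x in Ioo (0 : ℝ) 1, f x = ∫ x in p..q, f x := by
  rw [intervalIntegral.integral_of_le hpq.le, integral_Ioc_eq_integral_Ioo]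
  refine setIntegral_eq_of_subset_of_forall_sdiff_eq_zero measurableSet_Ioo
    (Ioo_subset_Ioo hp.le hq.le) fun x hx => hf x hx.2

/-- Integration by parts for absolutely continuous functions: no continuity of f' and g' is needed,
since indefinite integrals are differentiable almost everywhere with the expected derivative. -/
lemma integral_by_parts_primitive {f f' g g' : ℝ → ℝ} {p q : ℝ}
    (hf' : IntervalIntegrable f' volume p q) (hg' : IntervalIntegrable g' volume p q)
    (hf : ∀ x ∈ uIcc p q, f x = f p + ∫ t in p..x, f' t)
    (hg : ∀ x ∈ uIcc p q, g x = g p + ∫ t in p..x, g' t) :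
    ∫ x in p..q, (f' x * g x + f x * g' x) = f q * g q - f p * g p := by
  have ac : ∀ {u : ℝ → ℝ} (c : ℝ), IntervalIntegrable u volume p q →
      AbsolutelyContinuousOnInterval (fun x => c + ∫ t in p..x, u t) p q := fun c hu =>
    (LipschitzOnWith.absolutelyContinuousOnInterval (K := 0)
      (LipschitzWith.const c).lipschitzOnWith).add
      (hu.absolutelyContinuousOnInterval_intervalIntegral left_mem_uIcc)
  have h := (ac (f p) hf').integral_deriv_mul_eq_sub (ac (g p) hg')
  rw [← hf q right_mem_uIcc, ← hf p left_mem_uIcc, ← hg q right_mem_uIcc,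
    ← hg p left_mem_uIcc] at h
  rw [← h]
  refine intervalIntegral.integral_congr_ae ?_
  filter_upwards [hf'.ae_hasDerivAt_integral, hg'.ae_hasDerivAt_integral] with x h1 h2 hx
  have hx' := uIoc_subset_uIcc hx
  rw [((h1 hx' p left_mem_uIcc).const_add _).deriv, ((h2 hx' p left_mem_uIcc).const_add _).deriv,
    ← hf x hx', ← hg x hx']

lemma IsPrimitive.eq_add {F g : ℝ → ℝ} (h : IsPrimitive F g) {p q : ℝ}
    (hp : p ∈ Ioo (0 : ℝ) 1) (hq : q ∈ Ioo (0 : ℝ) 1) :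
    ∀ x ∈ uIcc p q, F x = F p + ∫ t in p..x, g t := fun x hx => by
  rw [← h.2 p hp x (ordConnected_Ioo.uIcc_subset hp hq hx)]; ring

lemma IsPrimitive.continuousOn {F g : ℝ → ℝ} (h : IsPrimitive F g) :
    ContinuousOn F (Ioo (0 : ℝ) 1) := by
  intro x hx
  obtain ⟨p, hp0, hpx⟩ := exists_between hx.1
  obtain ⟨q, hxq, hq1⟩ := exists_between hx.2
  have hp : p ∈ Ioo (0 : ℝ) 1 := ⟨hp0, hpx.trans hx.2⟩
  have hq : q ∈ Ioo (0 : ℝ) 1 := ⟨hx.1.trans hxq, hq1⟩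
  have hc : ContinuousOn (fun x => F p + ∫ t in p..x, g t) (uIcc p q) :=
    continuousOn_const.add ((intervalIntegrable_of_locallyIntegrableOn h.1 hp
      hq).absolutelyContinuousOnInterval_intervalIntegral left_mem_uIcc).continuousOn
  refine ContinuousAt.continuousWithinAt ?_
  refine (hc.congr (h.eq_add hp hq)).continuousAt ?_
  rw [uIcc_of_le (hpx.trans hxq).le]
  exact Icc_mem_nhds hpx hxq

lemma IsPrimitive.isWeakDeriv {F g : ℝ → ℝ} (h : IsPrimitive F g) : IsWeakDeriv 1 F g := by
  refine ⟨h.continuousOn.locallyIntegrableOn measurableSet_Ioo, h.1, fun η h1 h2 h3 => ?_⟩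
  obtain ⟨p, q, hp, hpq, hq, hsub⟩ := exists_Ioo_of_test h2 h3
  have hp' : p ∈ Ioo (0 : ℝ) 1 := ⟨hp, hpq.trans hq⟩
  have hq' : q ∈ Ioo (0 : ℝ) 1 := ⟨hp.trans hpq, hq⟩
  have hη0 : ∀ x, x ∉ Ioo p q → η x = 0 := fun x hx =>
    image_eq_zero_of_notMem_tsupport fun h => hx (hsub h)
  have hη1 : ∀ x, x ∉ Ioo p q → deriv η x = 0 := fun x hx =>
    image_eq_zero_of_notMem_tsupport fun h => hx (hsub (tsupport_deriv_subset h))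
  have hdc : Continuous (deriv η) := (contDiff_infty_iff_deriv.1 h1).2.continuous
  have hd : Differentiable ℝ η := (contDiff_infty_iff_deriv.1 h1).1
  rw [iteratedDeriv_one, integral_unit_eq_intervalIntegral hp hpq hq
    (fun x hx => by rw [hη1 x hx, mul_zero]), integral_unit_eq_intervalIntegral hp hpq hq
    (fun x hx => by rw [hη0 x hx, mul_zero])]
  have hgi := intervalIntegrable_of_locallyIntegrableOn h.1 hp' hq'
  have e := integral_by_parts_primitive hgi (hdc.intervalIntegrable p q) (h.eq_add hp' hq')
    (g := η) (fun x _ => by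
      rw [intervalIntegral.integral_deriv_eq_sub (fun y _ => hd y) (hdc.intervalIntegrable p x)]
      ring)
  have hFc : ContinuousOn F (uIcc p q) :=
    h.continuousOn.mono (ordConnected_Ioo.uIcc_subset hp' hq')
  rw [intervalIntegral.integral_add (hgi.mul_continuousOn hd.continuous.continuousOn)
    ((hdc.intervalIntegrable p q).continuousOn_mul hFc), hη0 p (by simp), hη0 q (by simp)] at e
  linarith

lemma IsPrimitive.mul {F f G g : ℝ → ℝ} (hF : IsPrimitive F f) (hG : IsPrimitive G g) :
    IsPrimitive (fun x => F x * G x) (fun x => f x * G x + F x * g x) := by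
  refine ⟨(hF.1.mul_continuousOn hG.continuousOn isOpen_Ioo.isLocallyClosed).add
    (hG.1.continuousOn_mul hF.continuousOn isOpen_Ioo.isLocallyClosed), fun x hx y hy => ?_⟩
  exact (integral_by_parts_primitive (intervalIntegrable_of_locallyIntegrableOn hF.1 hx hy)
    (intervalIntegrable_of_locallyIntegrableOn hG.1 hx hy) (hF.eq_add hx hy) (hG.eq_add hx hy)).symm

lemma isPrimitive_integral {g : ℝ → ℝ} (hg : LocallyIntegrableOn g (Ioo (0 : ℝ) 1)) {c : ℝ}
    (hc : c ∈ Ioo (0 : ℝ) 1) (A : ℝ) : IsPrimitive (fun x => (∫ t in c..x, g t) + A) g := by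
  refine ⟨hg, fun x hx y hy => ?_⟩
  have := intervalIntegral.integral_add_adjacent_intervals (intervalIntegrable_of_locallyIntegrableOn hg hc hx)
    (intervalIntegrable_of_locallyIntegrableOn hg hx hy)
  linarith

lemma exists_test_integral_one : ∃ η : ℝ → ℝ, ContDiff ℝ ∞ η ∧ HasCompactSupport η ∧
    tsupport η ⊆ Ioo (0 : ℝ) 1 ∧ ∫ x in Ioo (0 : ℝ) 1, η x = 1 := by
  let b : ContDiffBump (1 / 2 : ℝ) := ⟨1 / 8, 1 / 4, by norm_num, by norm_num⟩
  have hs : tsupport (b.normed volume) ⊆ Ioo (0 : ℝ) 1 := by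
    rw [b.tsupport_normed_eq, Real.closedBall_eq_Icc]
    intro x hx
    simp only [b, mem_Icc, mem_Ioo] at hx ⊢
    constructor <;> linarith [hx.1, hx.2]
  refine ⟨b.normed volume, b.contDiff_normed, b.hasCompactSupport_normed, hs, ?_⟩
  rw [setIntegral_eq_integral_of_forall_compl_eq_zero, b.integral_normed]
  exact fun x hx => image_eq_zero_of_notMem_tsupport fun h => hx (hs h)

/-- Functions with vanishing weak derivative are constant. -/
lemma IsWeakDeriv.ae_eq_const {w : ℝ → ℝ} (h : IsWeakDeriv 1 w (fun _ => 0)) :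
    ∃ c : ℝ, w =ᵐ[unitMeasure] fun _ => c := by
  obtain ⟨η₀, h01, h02, h03, h04⟩ := exists_test_integral_one
  refine ⟨∫ x in Ioo (0 : ℝ) 1, w x * η₀ x, ?_⟩
  refine ae_eq_of_test h.1 (locallyIntegrableOn_const _) fun ψ h1 h2 h3 => ?_
  set I := ∫ x in Ioo (0 : ℝ) 1, ψ x with hI
  -- Subtracting I η₀ makes the integral zero, and a test function of integral zero is the
  -- derivative of a test function, against which w vanishes.
  let θ : ℝ → ℝ := fun x => ψ x - I * η₀ x
  have hθ : ContDiff ℝ ∞ θ := h1.sub (contDiff_const.mul h01)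
  have hθs : tsupport θ ⊆ tsupport ψ ∪ tsupport η₀ := by
    refine closure_minimal (fun x hx => ?_) ((isClosed_tsupport _).union (isClosed_tsupport _))
    by_contra hn
    simp only [mem_union, not_or] at hn
    exact hx (by simp [θ, image_eq_zero_of_notMem_tsupport hn.1,
      image_eq_zero_of_notMem_tsupport hn.2])
  have hθc : HasCompactSupport θ := (IsCompact.union h2 h02).of_isClosed_subset
    (isClosed_tsupport _) hθs
  have hθJ : tsupport θ ⊆ Ioo (0 : ℝ) 1 := hθs.trans (union_subset h3 h03)
  obtain ⟨p, q, hp, hpq, hq, hsub⟩ := exists_Ioo_of_test hθc hθJ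
  have hθ0 : ∀ x, x ∉ Ioo p q → θ x = 0 := fun x hx =>
    image_eq_zero_of_notMem_tsupport fun h => hx (hsub h)
  have hψi : Integrable ψ unitMeasure := h1.continuous.integrable_of_hasCompactSupport h2 |>.integrableOn
  have hηi : Integrable η₀ unitMeasure :=
    h01.continuous.integrable_of_hasCompactSupport h02 |>.integrableOn
  have hθI : ∫ x in p..q, θ x = 0 := by
    rw [← integral_unit_eq_intervalIntegral hp hpq hq hθ0, integral_sub hψi (hηi.const_mul I),
      integral_const_mul, h04, ← hI]
    ring
  have hii : ∀ x y, IntervalIntegrable θ volume x y := fun x y => hθ.continuous.intervalIntegrable x y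
  let η : ℝ → ℝ := fun x => ∫ t in p..x, θ t
  have hder : deriv η = θ := funext fun x => hθ.continuous.deriv_integral θ p x
  have hdiff : Differentiable ℝ η := fun x =>
    (intervalIntegral.integral_hasDerivAt_right (hii p x)
      (hθ.continuous.stronglyMeasurableAtFilter _ _) hθ.continuous.continuousAt).differentiableAt
  have hη : ContDiff ℝ ∞ η := contDiff_infty_iff_deriv.2 ⟨hdiff, hder ▸ hθ⟩
  have hzero : ∀ {x y : ℝ}, (∀ t ∈ uIcc x y, t ∉ Ioo p q) → ∫ t in x..y, θ t = 0 := by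
    intro x y hxy
    rw [intervalIntegral.integral_congr (g := fun _ => 0) fun t ht => hθ0 t (hxy t ht)]
    simp
  -- To the right of q the primitive equals the full integral of θ, which is zero; this is where the
  -- normalisation of θ is used.
  have hηs : tsupport η ⊆ Icc p q := by
    refine closure_minimal (fun x hx => ?_) isClosed_Icc
    by_contra hn
    refine hx ?_
    rcases lt_or_ge x p with hxp | hxp
    · refine hzero fun t ht hn => ?_
      rw [uIcc_of_ge hxp.le] at ht
      linarith [ht.2, hn.1]
    · have hqx : q < x := by
        by_contra h'
        exact hn ⟨hxp, not_lt.1 h'⟩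
      have : η x = (∫ t in p..q, θ t) + ∫ t in q..x, θ t :=
        (intervalIntegral.integral_add_adjacent_intervals (hii p q) (hii q x)).symm
      rw [this, hθI, zero_add]
      refine hzero fun t ht hn => ?_
      rw [uIcc_of_le hqx.le] at ht
      linarith [ht.1, hn.2]
  have hfin := h.2.2 η hη (isCompact_Icc.of_isClosed_subset (isClosed_tsupport _) hηs)
    (hηs.trans (Icc_subset_Ioo hp hq))
  rw [iteratedDeriv_one, hder] at hfin
  have e1 : ∫ x in Ioo (0 : ℝ) 1, w x * θ x =
      (∫ x in Ioo (0 : ℝ) 1, w x * ψ x) - I * ∫ x in Ioo (0 : ℝ) 1, w x * η₀ x := by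
    rw [← integral_const_mul, ← integral_sub (integrable_mul_test h.1 h1.continuous h2 h3)
      ((integrable_mul_test h.1 h01.continuous h02 h03).const_mul I)]
    exact integral_congr_ae (Filter.Eventually.of_forall fun x => by simp only [θ]; ring)
  rw [e1] at hfin
  rw [integral_const_mul, ← hI]
  simp at hfin
  linarith

/-- The difference between v and any primitive of g has weak derivative zero, hence is constant.
Weak differentiability is thereby reduced to local absolute continuity, from which the product rule
follows. -/
lemma IsWeakDeriv.exists_primitive {v g : ℝ → ℝ} (h : IsWeakDeriv 1 v g) :
    ∃ F : ℝ → ℝ, IsPrimitive F g ∧ v =ᵐ[unitMeasure] F := by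
  have hc : (1 / 2 : ℝ) ∈ Ioo (0 : ℝ) 1 := by norm_num
  have hF := isPrimitive_integral h.2.1 hc 0
  have hw := h.add (hF.isWeakDeriv.const_mul (-1))
  obtain ⟨A, hA⟩ := IsWeakDeriv.ae_eq_const (hw.congr_ae (Filter.EventuallyEq.refl _ _)
    (Filter.Eventually.of_forall fun x => by simp))
  refine ⟨_, isPrimitive_integral h.2.1 hc A, hA.mono fun x hx => ?_⟩
  simp only at hx ⊢
  linarith

lemma IsWeakDeriv.mul {v v' h h' : ℝ → ℝ} (hv : IsWeakDeriv 1 v v') (hh : IsWeakDeriv 1 h h') :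
    IsWeakDeriv 1 (fun x => v x * h x) (fun x => v' x * h x + v x * h' x) := by
  obtain ⟨V, hV, hvV⟩ := hv.exists_primitive
  obtain ⟨H, hH, hhH⟩ := hh.exists_primitive
  refine (hV.mul hH).isWeakDeriv.congr_ae ?_ ?_ <;>
  filter_upwards [hvV, hhH] with x h1 h2 <;> rw [h1, h2]

/-- The Leibniz expression `∑ (k choose i) V_i H_{k-i}`. -/
def leibniz (V H : ℕ → ℝ → ℝ) (k : ℕ) (x : ℝ) : ℝ :=
  ∑ ij ∈ Finset.HasAntidiagonal.antidiagonal k, (k.choose ij.1 : ℝ) * (V ij.1 x * H ij.2 x)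

lemma isWeakDeriv_leibniz {V H : ℕ → ℝ → ℝ} {m : ℕ}
    (hV : ∀ i < m, IsWeakDeriv 1 (V i) (V (i + 1))) (hH : ∀ i < m, IsWeakDeriv 1 (H i) (H (i + 1)))
    {k : ℕ} (hk : k < m) : IsWeakDeriv 1 (leibniz V H k) (leibniz V H (k + 1)) := by
  have e : leibniz V H (k + 1) = fun x => ∑ ij ∈ Finset.HasAntidiagonal.antidiagonal k,
      (k.choose ij.1 : ℝ) * (V (ij.1 + 1) x * H ij.2 x + V ij.1 x * H (ij.2 + 1) x) := by
    funext x
    rw [leibniz, Finset.sum_antidiagonal_choose_succ_mul (fun i j => V i x * H j x),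
      ← Finset.sum_add_distrib]
    refine Finset.sum_congr rfl fun ij hij => ?_
    rw [← Nat.choose_symm_of_eq_add (Finset.HasAntidiagonal.mem_antidiagonal.1 hij).symm]
    ring
  rw [e]
  refine IsWeakDeriv.sum _ fun ij hij => IsWeakDeriv.const_mul _ ?_
  have := Finset.HasAntidiagonal.mem_antidiagonal.1 hij
  exact (hV _ (by omega)).mul (hH _ (by omega))

lemma isPrimitive_polynomial (p : Polynomial ℝ) :
    IsPrimitive (fun x => p.eval x) (fun x => p.derivative.eval x) := by
  refine ⟨p.derivative.continuous.continuousOn.locallyIntegrableOn measurableSet_Ioo,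
    fun x _ y _ => ?_⟩
  rw [intervalIntegral.integral_eq_sub_of_hasDerivAt (fun t _ => p.hasDerivAt t)
    (p.derivative.continuous.intervalIntegrable x y)]

/-! ### Cutoff functions and integration by parts against Jacobi weights -/

/-- With y = n x - 1 the factor y + 1 is n x, so this bounds x times the derivative of the rescaled
transition uniformly in n. -/
lemma smoothTransition_deriv_bound :
    ∃ D : ℝ, ∀ y : ℝ, |(y + 1) * deriv Real.smoothTransition y| ≤ D := by
  have hc : Continuous (deriv Real.smoothTransition) :=
    (Real.smoothTransition.contDiff (n := 1)).continuous_deriv (by norm_num)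
  obtain ⟨D, hD⟩ := isCompact_Icc.exists_bound_of_continuousOn (s := Icc (0 : ℝ) 1)
    (f := fun y => (y + 1) * deriv Real.smoothTransition y) (by fun_prop)
  refine ⟨D, fun y => ?_⟩
  have hD0 : 0 ≤ D := (norm_nonneg _).trans (hD 0 (by simp))
  rcases lt_or_ge y 0 with h | h
  · have : Real.smoothTransition =ᶠ[nhds y] fun _ => 0 := by
      filter_upwards [Iio_mem_nhds h] with z hz using Real.smoothTransition.zero_of_nonpos hz.le
    simp [this.deriv_eq, hD0]
  rcases lt_or_ge 1 y with h' | h'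
  · have : Real.smoothTransition =ᶠ[nhds y] fun _ => 1 := by
      filter_upwards [Ioi_mem_nhds h'] with z hz using Real.smoothTransition.one_of_one_le hz.le
    simp [this.deriv_eq, hD0]
  · exact hD y ⟨h, h'⟩

/-- A smooth cutoff that vanishes outside `(1/n, 1-1/n)` and tends to `1` on `(0,1)`. -/
def cutoff (n : ℕ) (x : ℝ) : ℝ :=
  Real.smoothTransition (n * x - 1) * Real.smoothTransition (n * (1 - x) - 1)

lemma contDiff_cutoff (n : ℕ) : ContDiff ℝ ∞ (cutoff n) := by
  unfold cutoff
  exact (Real.smoothTransition.contDiff.comp (by fun_prop)).mul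
    (Real.smoothTransition.contDiff.comp (by fun_prop))

lemma tsupport_cutoff {n : ℕ} (hn : 0 < n) :
    tsupport (cutoff n) ⊆ Icc (1 / n : ℝ) (1 - 1 / n) := by
  have hn' : (0 : ℝ) < n := by exact_mod_cast hn
  refine closure_minimal (fun x hx => ?_) isClosed_Icc
  rw [Function.mem_support, cutoff, mul_ne_zero_iff] at hx
  have h1 : 0 < n * x - 1 := by
    by_contra h; exact hx.1 (Real.smoothTransition.zero_of_nonpos (not_lt.1 h))
  have h2 : 0 < n * (1 - x) - 1 := by
    by_contra h; exact hx.2 (Real.smoothTransition.zero_of_nonpos (not_lt.1 h))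
  constructor
  · rw [div_le_iff₀ hn']; linarith
  · rw [le_sub_iff_add_le, ← le_sub_iff_add_le', div_le_iff₀ hn']; linarith

lemma abs_cutoff_le (n : ℕ) (x : ℝ) : |cutoff n x| ≤ 1 := by
  rw [cutoff, abs_mul, abs_of_nonneg (Real.smoothTransition.nonneg _),
    abs_of_nonneg (Real.smoothTransition.nonneg _)]
  exact mul_le_one₀ (Real.smoothTransition.le_one _) (Real.smoothTransition.nonneg _)
    (Real.smoothTransition.le_one _)

lemma eventually_cutoff_eq_one {x : ℝ} (hx : x ∈ Ioo (0 : ℝ) 1) :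
    ∀ᶠ n : ℕ in Filter.atTop, cutoff n =ᶠ[nhds x] fun _ => 1 := by
  have t1 : Filter.Tendsto (fun n : ℕ => (n : ℝ) * x) Filter.atTop Filter.atTop :=
    tendsto_natCast_atTop_atTop.atTop_mul_const hx.1
  have t2 : Filter.Tendsto (fun n : ℕ => (n : ℝ) * (1 - x)) Filter.atTop Filter.atTop :=
    tendsto_natCast_atTop_atTop.atTop_mul_const (by linarith [hx.2])
  filter_upwards [t1.eventually_gt_atTop 2, t2.eventually_gt_atTop 2] with n h1 h2
  have c1 : ∀ᶠ y : ℝ in nhds x, 2 < n * y :=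
    (by fun_prop : Continuous fun y : ℝ => (n : ℝ) * y).continuousAt.eventually_const_lt h1
  have c2 : ∀ᶠ y : ℝ in nhds x, 2 < n * (1 - y) :=
    (by fun_prop : Continuous fun y : ℝ => (n : ℝ) * (1 - y)).continuousAt.eventually_const_lt h2
  filter_upwards [c1, c2] with y h1 h2
  rw [cutoff, Real.smoothTransition.one_of_one_le (by linarith),
    Real.smoothTransition.one_of_one_le (by linarith), mul_one]

/-- The derivative of the cutoff has size n but lives at distance of order 1/n from the end points,
where x(1-x) compensates. The uniform bound dominates the boundary terms when integrating by parts.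
-/
lemma exists_deriv_cutoff_bound :
    ∃ D : ℝ, ∀ (n : ℕ), ∀ x ∈ Ioo (0 : ℝ) 1, |x * (1 - x) * deriv (cutoff n) x| ≤ D := by
  obtain ⟨D, hD⟩ := smoothTransition_deriv_bound
  refine ⟨D + D, fun n x hx => ?_⟩
  have hS : Differentiable ℝ Real.smoothTransition :=
    (Real.smoothTransition.contDiff (n := 1)).differentiable (by norm_num)
  have h1 : HasDerivAt (fun x : ℝ => n * x - 1) n x := by
    simpa using ((hasDerivAt_id x).const_mul (n : ℝ)).sub_const 1
  have h2 : HasDerivAt (fun x : ℝ => n * (1 - x) - 1) (-n) x := by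
    simpa using (((hasDerivAt_id x).const_sub 1).const_mul (n : ℝ)).sub_const 1
  have h3 := ((hS (n * x - 1)).hasDerivAt.comp x h1).mul
    ((hS (n * (1 - x) - 1)).hasDerivAt.comp x h2)
  have e : deriv (cutoff n) x = deriv Real.smoothTransition (n * x - 1) * n *
      Real.smoothTransition (n * (1 - x) - 1) + Real.smoothTransition (n * x - 1) *
      (deriv Real.smoothTransition (n * (1 - x) - 1) * -n) := h3.deriv
  have e2 : x * (1 - x) * deriv (cutoff n) x =
      (((n * x - 1 + 1) * deriv Real.smoothTransition (n * x - 1)) *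
        ((1 - x) * Real.smoothTransition (n * (1 - x) - 1))) -
      (((n * (1 - x) - 1 + 1) * deriv Real.smoothTransition (n * (1 - x) - 1)) *
        (x * Real.smoothTransition (n * x - 1))) := by rw [e]; ring
  have key : ∀ {A z y : ℝ}, |A| ≤ D → z ∈ Ioo (0 : ℝ) 1 →
      |A * (z * Real.smoothTransition y)| ≤ D := by
    intro A z y hA hz
    rw [abs_mul, abs_mul, abs_of_pos hz.1, abs_of_nonneg (Real.smoothTransition.nonneg _)]
    refine (mul_le_of_le_one_right (abs_nonneg _) ?_).trans hA
    exact mul_le_one₀ hz.2.le (Real.smoothTransition.nonneg _) (Real.smoothTransition.le_one _)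
  rw [e2]
  exact (abs_sub _ _).trans (add_le_add (key (hD _) ⟨by linarith [hx.2], by linarith [hx.1]⟩)
    (key (hD _) hx))

lemma contDiff_mul_of_tsupport {χ ψ : ℝ → ℝ} (hχ : ContDiff ℝ ∞ χ)
    (hs : tsupport χ ⊆ Ioo (0 : ℝ) 1) (hψ : ContDiffOn ℝ ∞ ψ (Ioo 0 1)) :
    ContDiff ℝ ∞ (fun x => χ x * ψ x) := by
  rw [contDiff_iff_contDiffAt]
  intro x
  by_cases hx : x ∈ Ioo (0 : ℝ) 1
  · exact hχ.contDiffAt.mul (hψ.contDiffAt (isOpen_Ioo.mem_nhds hx))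
  · have : χ =ᶠ[nhds x] 0 := notMem_tsupport_iff_eventuallyEq.1 fun h => hx (hs h)
    refine (contDiffAt_const (c := (0 : ℝ))).congr_of_eventuallyEq ?_
    filter_upwards [this] with y hy
    simp [hy]

lemma contDiffOn_weight (a b : ℝ) : ContDiffOn ℝ ∞ (weight a b) (Ioo 0 1) := by
  intro x hx
  refine ContDiffAt.contDiffWithinAt ?_
  exact ((contDiffAt_const.sub contDiffAt_id).rpow_const_of_ne (by simp; linarith [hx.2])).mul
    (contDiffAt_id.rpow_const_of_ne hx.1.ne')

lemma hasDerivAt_weight_succ (a b : ℝ) {x : ℝ} (hx : x ∈ Ioo (0 : ℝ) 1) :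
    HasDerivAt (weight (a + 1) (b + 1)) (weight a b x * ((b + 1) * (1 - x) - (a + 1) * x)) x := by
  have hx1 : 0 < 1 - x := by linarith [hx.2]
  have h1 : HasDerivAt (fun x : ℝ => (1 - x) ^ (a + 1)) (-1 * (a + 1) * (1 - x) ^ (a + 1 - 1)) x :=
    HasDerivAt.rpow_const (by simpa using (hasDerivAt_id x).const_sub 1) (Or.inl hx1.ne')
  have h2 : HasDerivAt (fun x : ℝ => x ^ (b + 1)) (1 * (b + 1) * x ^ (b + 1 - 1)) x :=
    HasDerivAt.rpow_const (hasDerivAt_id x) (Or.inl hx.1.ne')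
  refine (h1.mul h2).congr_deriv ?_
  simp only [weight, add_sub_cancel_right, Real.rpow_add hx1, Real.rpow_add hx.1, Real.rpow_one]
  ring

/-- Integration by parts: the boundary terms vanish because of the weight. -/
lemma integral_weight_by_parts {a b : ℝ} {F F' : ℝ → ℝ} (hF : IsWeakDeriv 1 F F')
    (h0 : Integrable (fun x => weight a b x * F x) unitMeasure)
    (h1 : Integrable (fun x => weight (a + 1) (b + 1) x * F' x) unitMeasure) (p : Polynomial ℝ) :
    ∫ x in Ioo (0 : ℝ) 1, weight a b x * F x *
      (x * (1 - x) * p.derivative.eval x + ((b + 1) * (1 - x) - (a + 1) * x) * p.eval x) =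
    -∫ x in Ioo (0 : ℝ) 1, weight (a + 1) (b + 1) x * F' x * p.eval x := by
  set q : ℝ → ℝ := fun x =>
    x * (1 - x) * p.derivative.eval x + ((b + 1) * (1 - x) - (a + 1) * x) * p.eval x with hq
  have hqc : Continuous q := by
    have := p.continuous
    have := p.derivative.continuous
    fun_prop
  obtain ⟨D, hD⟩ := exists_deriv_cutoff_bound
  obtain ⟨P, hP⟩ := isCompact_Icc.exists_bound_of_continuousOn (s := Icc (0 : ℝ) 1)
    p.continuous.continuousOn
  obtain ⟨Q, hQ⟩ := isCompact_Icc.exists_bound_of_continuousOn (s := Icc (0 : ℝ) 1)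
    hqc.continuousOn
  have hD0 : 0 ≤ D := (abs_nonneg _).trans (hD 0 (1 / 2) (by norm_num))
  have hP0 : 0 ≤ P := (norm_nonneg _).trans (hP 0 (by simp))
  have hQ0 : 0 ≤ Q := (norm_nonneg _).trans (hQ 0 (by simp))
  -- The weight times p is smooth only inside (0,1); the cutoff makes it an admissible test
  -- function. Since (ω^{(a+1,b+1)} p)' = ω^{(a,b)} q, the claim is the limit n → ∞ of the weak
  -- derivative relation, by dominated convergence.
  let η : ℕ → ℝ → ℝ := fun n x => cutoff n x * (weight (a + 1) (b + 1) x * p.eval x)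
  have hlim1 : Filter.Tendsto (fun n : ℕ => ∫ x in Ioo (0 : ℝ) 1, weight a b x * F x *
      (x * (1 - x) * deriv (cutoff n) x * p.eval x + cutoff n x * q x)) Filter.atTop
      (nhds (∫ x in Ioo (0 : ℝ) 1, weight a b x * F x * q x)) := by
    refine tendsto_integral_of_dominated_convergence
      (fun x => |weight a b x * F x| * (D * P + 1 * Q)) (fun n => ?_) (h0.abs.mul_const _)
      (fun n => ae_unit_of_forall fun x hx => ?_) (ae_unit_of_forall fun x hx => ?_)
    · refine h0.aestronglyMeasurable.mul (Continuous.aestronglyMeasurable ?_)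
      have := p.continuous
      have := (contDiff_cutoff n).continuous
      have := (contDiff_infty_iff_deriv.1 (contDiff_cutoff n)).2.continuous
      fun_prop
    · have hx' : x ∈ Icc (0 : ℝ) 1 := ⟨hx.1.le, hx.2.le⟩
      rw [Real.norm_eq_abs, abs_mul]
      refine mul_le_mul_of_nonneg_left ((abs_add_le _ _).trans (add_le_add ?_ ?_)) (abs_nonneg _)
      · rw [abs_mul]
        exact mul_le_mul (hD n x hx) (hP x hx') (abs_nonneg _) hD0
      · rw [abs_mul]
        exact mul_le_mul (abs_cutoff_le n x) (hQ x hx') (abs_nonneg _) zero_le_one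
    · refine tendsto_const_nhds.congr' ?_
      filter_upwards [eventually_cutoff_eq_one hx] with n hn
      rw [hn.deriv_eq, hn.eq_of_nhds]
      simp
  have hlim2 : Filter.Tendsto (fun n : ℕ => ∫ x in Ioo (0 : ℝ) 1, weight (a + 1) (b + 1) x *
      F' x * (cutoff n x * p.eval x)) Filter.atTop
      (nhds (∫ x in Ioo (0 : ℝ) 1, weight (a + 1) (b + 1) x * F' x * p.eval x)) := by
    refine tendsto_integral_of_dominated_convergence
      (fun x => |weight (a + 1) (b + 1) x * F' x| * (1 * P)) (fun n => ?_) (h1.abs.mul_const _)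
      (fun n => ae_unit_of_forall fun x hx => ?_) (ae_unit_of_forall fun x hx => ?_)
    · refine h1.aestronglyMeasurable.mul (Continuous.aestronglyMeasurable ?_)
      have := p.continuous
      have := (contDiff_cutoff n).continuous
      fun_prop
    · have hx' : x ∈ Icc (0 : ℝ) 1 := ⟨hx.1.le, hx.2.le⟩
      rw [Real.norm_eq_abs, abs_mul]
      refine mul_le_mul_of_nonneg_left ?_ (abs_nonneg _)
      rw [abs_mul]
      exact mul_le_mul (abs_cutoff_le n x) (hP x hx') (abs_nonneg _) zero_le_one
    · refine tendsto_const_nhds.congr' ?_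
      filter_upwards [eventually_cutoff_eq_one hx] with n hn
      rw [hn.eq_of_nhds]
      simp
  refine tendsto_nhds_unique hlim1 (hlim2.neg.congr' ?_)
  filter_upwards [Filter.eventually_gt_atTop 0] with n hn
  have hn' : (0 : ℝ) < n := by exact_mod_cast hn
  have hsub : tsupport (cutoff n) ⊆ Ioo (0 : ℝ) 1 :=
    (tsupport_cutoff hn).trans (Icc_subset_Ioo (by positivity) (by simpa using hn'))
  have hηs : tsupport (η n) ⊆ tsupport (cutoff n) :=
    tsupport_mul_subset_left
  have hη : ContDiff ℝ ∞ (η n) := contDiff_mul_of_tsupport (contDiff_cutoff n) hsub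
    ((contDiffOn_weight _ _).mul (by have := p.contDiff_aeval (𝕜 := ℝ) (n := ∞); simpa using this.contDiffOn))
  have hηc : HasCompactSupport (η n) :=
    isCompact_Icc.of_isClosed_subset (isClosed_tsupport _) (hηs.trans (tsupport_cutoff hn))
  have h := hF.2.2 (η n) hη hηc (hηs.trans hsub)
  rw [iteratedDeriv_one] at h
  have e1 : ∫ x in Ioo (0 : ℝ) 1, F x * deriv (η n) x = ∫ x in Ioo (0 : ℝ) 1, weight a b x * F x *
      (x * (1 - x) * deriv (cutoff n) x * p.eval x + cutoff n x * q x) := by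
    refine setIntegral_congr_fun measurableSet_Ioo fun x hx => ?_
    have hc : HasDerivAt (cutoff n) (deriv (cutoff n) x) x :=
      ((contDiff_infty_iff_deriv.1 (contDiff_cutoff n)).1 x).hasDerivAt
    have hd := hc.mul ((hasDerivAt_weight_succ a b hx).mul (p.hasDerivAt x))
    have hd' : deriv (η n) x = _ := hd.deriv
    simp only [hd', Pi.mul_apply, weight_succ a b hx, hq]
    ring
  have e2 : ∫ x in Ioo (0 : ℝ) 1, F' x * η n x = ∫ x in Ioo (0 : ℝ) 1, weight (a + 1) (b + 1) x *
      F' x * (cutoff n x * p.eval x) :=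
    setIntegral_congr_fun measurableSet_Ioo fun x _ => by simp only [η]; ring
  rw [e1, e2] at h
  linarith

/-- The shift relation between moments against consecutive Jacobi families. -/
lemma integral_weight_jacobi_succ {a b : ℝ} {F F' : ℝ → ℝ} (hF : IsWeakDeriv 1 F F')
    (h0 : Integrable (fun x => weight a b x * F x) unitMeasure)
    (h1 : Integrable (fun x => weight (a + 1) (b + 1) x * F' x) unitMeasure) (n : ℕ) :
    (n + 1) * weightInner a b F (jacobiG (n + 1) a b) =
      weightInner (a + 1) (b + 1) F' (jacobiG n (a + 1) (b + 1)) := by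
  have h := integral_weight_by_parts hF h0 h1 (jacobiPoly n (a + 1) (b + 1))
  simp only [jacobiPoly_raising] at h
  simp only [eval_jacobiPoly] at h
  rw [weightInner, weightInner, ← integral_const_mul, ← neg_inj, ← h, ← integral_neg]
  exact integral_congr_ae (Filter.Eventually.of_forall fun x => by simp only; ring)

/-! ### Orthogonality -/

lemma integrable_weight_mul_continuousOn {a b : ℝ} (ha : -1 < a) (hb : -1 < b) {q : ℝ → ℝ}
    (hq : ContinuousOn q (Icc 0 1)) : Integrable (fun x => weight a b x * q x) unitMeasure :=
  integrable_mul_continuousOn (integrable_weight ha hb) hq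

lemma weightInner_jacobi_polynomial_succ {a b : ℝ} (ha : -1 < a) (hb : -1 < b) (n : ℕ)
    (p : Polynomial ℝ) :
    (n + 1) * weightInner a b (fun x => p.eval x) (jacobiG (n + 1) a b) =
      weightInner (a + 1) (b + 1) (fun x => p.derivative.eval x) (jacobiG n (a + 1) (b + 1)) :=
  integral_weight_jacobi_succ (isPrimitive_polynomial p).isWeakDeriv
    (integrable_weight_mul_continuousOn ha hb p.continuous.continuousOn)
    (integrable_weight_mul_continuousOn (by linarith) (by linarith)
      p.derivative.continuous.continuousOn) n

/-- The shift relation trades p for p' and n for n - 1 while raising both exponents by one, so after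
finitely many steps nothing of p is left. -/
lemma weightInner_jacobi_eq_zero (n : ℕ) : ∀ {a b : ℝ}, -1 < a → -1 < b → ∀ p : Polynomial ℝ,
    p.degree < n → weightInner a b (fun x => p.eval x) (jacobiG n a b) = 0 := by
  induction n with
  | zero =>
    intro a b _ _ p hp
    have : p = 0 := by simpa using hp
    simp [this, weightInner]
  | succ n ih =>
    intro a b ha hb p hp
    have h := weightInner_jacobi_polynomial_succ ha hb n p
    rw [ih (by linarith) (by linarith) p.derivative] at h
    · have : (n + 1 : ℝ) ≠ 0 := by positivity
      simpa [this] using h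
    · by_cases h0 : p = 0
      · simp [h0]
      · have h1 := Polynomial.degree_derivative_lt h0
        have h2 : p.degree ≤ n := by
          rw [Polynomial.degree_eq_natDegree h0] at hp ⊢
          exact_mod_cast Nat.lt_succ_iff.1 (by exact_mod_cast hp)
        exact h1.trans_le h2

/-- `‖G_n^{(a,b)}‖²` in the weighted `L²` space. -/
def jacobiNormSq (n : ℕ) (a b : ℝ) : ℝ := weightInner a b (jacobiG n a b) (jacobiG n a b)

lemma weightInner_comm (a b : ℝ) (f g : ℝ → ℝ) : weightInner a b f g = weightInner a b g f := by
  simp only [weightInner, mul_right_comm _ (f _)]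

lemma jacobiG_eq_eval (n : ℕ) (a b : ℝ) : jacobiG n a b = fun x => (jacobiPoly n a b).eval x :=
  funext fun x => (eval_jacobiPoly n a b x).symm

lemma continuous_jacobiG (n : ℕ) (a b : ℝ) : Continuous (jacobiG n a b) := by
  rw [jacobiG_eq_eval]; exact Polynomial.continuous _

lemma weightInner_jacobi_of_lt {a b : ℝ} (ha : -1 < a) (hb : -1 < b) {m n : ℕ} (h : m < n) :
    weightInner a b (jacobiG m a b) (jacobiG n a b) = 0 := by
  rw [jacobiG_eq_eval m]
  refine weightInner_jacobi_eq_zero n ha hb _ ?_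
  refine Polynomial.degree_le_natDegree.trans_lt ?_
  exact_mod_cast (natDegree_jacobiPoly_le m a b).trans_lt h

lemma weightInner_jacobi_of_ne {a b : ℝ} (ha : -1 < a) (hb : -1 < b) {m n : ℕ} (h : m ≠ n) :
    weightInner a b (jacobiG m a b) (jacobiG n a b) = 0 := by
  rcases lt_or_gt_of_ne h with h | h
  · exact weightInner_jacobi_of_lt ha hb h
  · rw [weightInner_comm]; exact weightInner_jacobi_of_lt ha hb h

/-- The shift relation applied to G_{n+1} itself. This recurrence replaces an explicit formula for
the norms throughout. -/
lemma jacobiNormSq_succ {a b : ℝ} (ha : -1 < a) (hb : -1 < b) (n : ℕ) :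
    (n + 1) * jacobiNormSq (n + 1) a b = (n + a + b + 2) * jacobiNormSq n (a + 1) (b + 1) := by
  have h := weightInner_jacobi_polynomial_succ ha hb n (jacobiPoly (n + 1) a b)
  rw [← jacobiG_eq_eval] at h
  rw [jacobiNormSq, h, jacobiNormSq, derivative_jacobiPoly_succ, weightInner, weightInner,
    ← integral_const_mul]
  refine integral_congr_ae (Filter.Eventually.of_forall fun x => ?_)
  simp only [Polynomial.eval_mul, Polynomial.eval_C, eval_jacobiPoly]
  ring

lemma jacobiNormSq_pos (n : ℕ) : ∀ {a b : ℝ}, -1 < a → -1 < b → 0 < jacobiNormSq n a b := by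
  induction n with
  | zero =>
    intro a b ha hb
    have e : jacobiG 0 a b = fun _ => 1 := by rw [jacobiG_eq_eval, jacobiPoly_zero]; simp
    have h := integral_weight ha hb
    simp only [jacobiNormSq, weightInner, e, mul_one, h]
    have h1 := Real.Gamma_pos_of_pos (show 0 < a + 1 by linarith)
    have h2 := Real.Gamma_pos_of_pos (show 0 < b + 1 by linarith)
    have h3 := Real.Gamma_pos_of_pos (show 0 < a + b + 2 by linarith)
    positivity
  | succ n ih =>
    intro a b ha hb
    have h1 := jacobiNormSq_succ ha hb n
    have h2 := ih (show -1 < a + 1 by linarith) (show -1 < b + 1 by linarith)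
    have h3 : (0 : ℝ) ≤ n := n.cast_nonneg
    have : 0 < (n + 1 : ℝ) * jacobiNormSq (n + 1) a b := by
      rw [h1]; exact mul_pos (by linarith) h2
    exact pos_of_mul_pos_right this (by positivity)

lemma jacobiNormSq_swap (n : ℕ) (a b : ℝ) : jacobiNormSq n b a = jacobiNormSq n a b := by
  rw [jacobiNormSq, jacobiNormSq, weightInner, weightInner, ← integral_reflect]
  refine integral_congr_ae (Filter.Eventually.of_forall fun x => ?_)
  simp only [jacobiG_reflect, weight_reflect]
  have : ((-1 : ℝ) ^ n) * (-1) ^ n = 1 := by rw [← mul_pow]; simp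
  linear_combination (weight a b x * jacobiG n a b x ^ 2) * this

/-! ### The two-sided fractional integral and its adjoint -/

/-- The kernel of the left fractional integral, up to the factor `1 / Γ(σ)`. -/
def fracKer (σ x t : ℝ) : ℝ := if t < x then (x - t) ^ (σ - 1) else 0

lemma measurable_fracKer (σ : ℝ) : Measurable (fun z : ℝ × ℝ => fracKer σ z.1 z.2) :=
  Measurable.ite (measurableSet_lt measurable_snd measurable_fst) (by fun_prop) measurable_const

lemma fracKer_nonneg (σ x t : ℝ) : 0 ≤ fracKer σ x t := by
  unfold fracKer
  split_ifs with h
  · exact Real.rpow_nonneg (by linarith) _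
  · exact le_rfl

lemma leftFracInt_eq (σ : ℝ) (w : ℝ → ℝ) {x : ℝ} (hx : x ∈ Ioo (0 : ℝ) 1) :
    leftFracInt σ w x = 1 / Real.Gamma σ * ∫ t in Ioo (0 : ℝ) 1, w t * fracKer σ x t := by
  rw [leftFracInt, setIntegral_eq_of_subset_of_forall_sdiff_eq_zero (s := Ioo 0 x)
    measurableSet_Ioo (Ioo_subset_Ioo_right hx.2.le)]
  · congr 1
    refine setIntegral_congr_fun measurableSet_Ioo fun t ht => ?_
    simp [fracKer, ht.2]
  · rintro t ⟨ht, ht'⟩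
    have : ¬ t < x := fun h => ht' ⟨ht.1, h⟩
    simp [fracKer, this]

lemma rightFracInt_eq (σ : ℝ) (w : ℝ → ℝ) {x : ℝ} (hx : x ∈ Ioo (0 : ℝ) 1) :
    rightFracInt σ w x = 1 / Real.Gamma σ * ∫ t in Ioo (0 : ℝ) 1, w t * fracKer σ t x := by
  rw [rightFracInt, setIntegral_eq_of_subset_of_forall_sdiff_eq_zero (s := Ioo x 1)
    measurableSet_Ioo (Ioo_subset_Ioo_left hx.1.le)]
  · congr 1
    refine setIntegral_congr_fun measurableSet_Ioo fun t ht => ?_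
    simp [fracKer, ht.1]
  · rintro t ⟨ht, ht'⟩
    have : ¬ x < t := fun h => ht' ⟨h, ht.2⟩
    simp [fracKer, this]

lemma rightFracInt_reflect (σ : ℝ) (w : ℝ → ℝ) {x : ℝ} (hx : x ∈ Ioo (0 : ℝ) 1) :
    rightFracInt σ w x = leftFracInt σ (fun t => w (1 - t)) (1 - x) := by
  rw [rightFracInt_eq σ w hx, leftFracInt_eq σ _ ⟨by linarith [hx.2], by linarith [hx.1]⟩,
    ← integral_reflect]
  congr 2
  funext t
  simp only [fracKer]
  by_cases h : x < 1 - t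
  · rw [if_pos h, if_pos (by linarith)]; congr 2; ring
  · rw [if_neg h, if_neg (by linarith)]

/-- Tonelli: w is only integrable, so it suffices that the kernel integrated against |q| in the
other variable is bounded uniformly in t. -/
lemma integrable_kernel {κ : ℝ → ℝ → ℝ} (hκ : Measurable (fun z : ℝ × ℝ => κ z.1 z.2))
    (hκ0 : ∀ x t, 0 ≤ κ x t) {w q : ℝ → ℝ} (hw : Integrable w unitMeasure)
    (hq : AEStronglyMeasurable q unitMeasure) {B : ℝ≥0∞} (hB : B ≠ ⊤)
    (hb : ∀ t ∈ Ioo (0 : ℝ) 1, ∫⁻ x, ENNReal.ofReal (κ x t) * ‖q x‖ₑ ∂unitMeasure ≤ B) :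
    Integrable (fun z : ℝ × ℝ => w z.2 * κ z.1 z.2 * q z.1) (unitMeasure.prod unitMeasure) := by
  have hm : AEStronglyMeasurable (fun z : ℝ × ℝ => w z.2 * κ z.1 z.2 * q z.1)
      (unitMeasure.prod unitMeasure) :=
    (hw.1.comp_snd.mul hκ.aestronglyMeasurable).mul hq.comp_fst
  refine ⟨hm, ?_⟩
  rw [hasFiniteIntegral_iff_enorm, lintegral_prod_symm _ hm.enorm]
  calc ∫⁻ t, ∫⁻ x, ‖w t * κ x t * q x‖ₑ ∂unitMeasure ∂unitMeasure
      ≤ ∫⁻ t, ‖w t‖ₑ * B ∂unitMeasure := by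
        refine lintegral_mono_ae (ae_unit_of_forall fun t ht => ?_)
        have e : ∀ x, ‖w t * κ x t * q x‖ₑ = ‖w t‖ₑ * (ENNReal.ofReal (κ x t) * ‖q x‖ₑ) := by
          intro x
          rw [enorm_mul, enorm_mul, mul_assoc, Real.enorm_of_nonneg (hκ0 x t)]
        simp only [e]
        rw [lintegral_const_mul' _ _ enorm_ne_top]
        gcongr
        exact hb t ht
    _ < ⊤ := by
        rw [lintegral_mul_const' _ _ hB]
        exact ENNReal.mul_lt_top hw.2 hB.lt_top

lemma integral_kernel_swap {κ : ℝ → ℝ → ℝ} {w q : ℝ → ℝ}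
    (h : Integrable (fun z : ℝ × ℝ => w z.2 * κ z.1 z.2 * q z.1)
      (unitMeasure.prod unitMeasure)) :
    Integrable (fun x => (∫ t in Ioo (0 : ℝ) 1, w t * κ x t) * q x) unitMeasure ∧
    Integrable (fun t => w t * ∫ x in Ioo (0 : ℝ) 1, q x * κ x t) unitMeasure ∧
    ∫ x in Ioo (0 : ℝ) 1, (∫ t in Ioo (0 : ℝ) 1, w t * κ x t) * q x =
      ∫ t in Ioo (0 : ℝ) 1, w t * ∫ x in Ioo (0 : ℝ) 1, q x * κ x t := by
  have e1 : ∀ x, (∫ t in Ioo (0 : ℝ) 1, w t * κ x t) * q x =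
      ∫ t in Ioo (0 : ℝ) 1, w t * κ x t * q x := fun x => (integral_mul_const _ _).symm
  have e2 : ∀ t, w t * (∫ x in Ioo (0 : ℝ) 1, q x * κ x t) =
      ∫ x in Ioo (0 : ℝ) 1, w t * κ x t * q x := fun t => by
    rw [← integral_const_mul]
    exact integral_congr_ae (Filter.Eventually.of_forall fun x => by simp only; ring)
  simp only [e1, e2]
  exact ⟨h.integral_prod_left, h.integral_prod_right, integral_integral_swap h⟩

/-- Affine change of variables from `(0,1)` to `(t,1)`. -/
lemma image_affine {t : ℝ} (ht : t < 1) :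
    (fun s : ℝ => t + (1 - t) * s) '' Ioo 0 1 = Ioo t 1 := by
  have h1 : 0 < 1 - t := by linarith
  ext y
  constructor
  · rintro ⟨s, hs, rfl⟩
    constructor
    · simp only; nlinarith [hs.1]
    · simp only; nlinarith [hs.2]
  · intro hy
    refine ⟨(y - t) / (1 - t), ⟨div_pos (by linarith [hy.1]) h1, ?_⟩, ?_⟩
    · rw [div_lt_one h1]; linarith [hy.2]
    · simp only; field_simp; ring

lemma lintegral_comp_affine {t : ℝ} (ht : t < 1) (g : ℝ → ℝ≥0∞) :
    ∫⁻ x in Ioo t 1, g x = ∫⁻ s in Ioo (0 : ℝ) 1, ENNReal.ofReal (1 - t) * g (t + (1 - t) * s) := by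
  rw [← image_affine ht, lintegral_image_eq_lintegral_abs_deriv_mul measurableSet_Ioo
    (f' := fun _ => 1 - t) (fun s _ => by
      simpa using (((hasDerivAt_id s).const_mul (1 - t)).const_add t).hasDerivWithinAt)
    (fun s _ s' _ h => by
      have : 1 - t ≠ 0 := by linarith
      simpa [this] using h)]
  rw [abs_of_pos (by linarith)]

lemma integral_comp_affine {t : ℝ} (ht : t < 1) (g : ℝ → ℝ) :
    ∫ x in Ioo t 1, g x = ∫ s in Ioo (0 : ℝ) 1, (1 - t) * g (t + (1 - t) * s) := by
  rw [← image_affine ht, integral_image_eq_integral_abs_deriv_smul measurableSet_Ioo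
    (f' := fun _ => 1 - t) (fun s _ => by
      simpa using (((hasDerivAt_id s).const_mul (1 - t)).const_add t).hasDerivWithinAt)
    (fun s _ s' _ h => by
      have : 1 - t ≠ 0 := by linarith
      simpa [this] using h)]
  rw [abs_of_pos (by linarith)]
  simp only [smul_eq_mul]

/-- The parameters of the two-sided fractional integral and its pair of weights. -/
structure FracParams (r a b σ : ℝ) : Prop where
  ha : -1 < a
  ha0 : a ≤ 0
  hb : -1 < b
  hb0 : b ≤ 0
  sum : a + b = -σ
  pos : 0 < σ
  lt_one : σ < 1
  sin_ne : Real.sin (Real.pi * a) + Real.sin (Real.pi * b) ≠ 0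
  hr : r = Real.sin (Real.pi * a) / (Real.sin (Real.pi * a) + Real.sin (Real.pi * b))

lemma FracParams.one_sub {r a b σ : ℝ} (h : FracParams r a b σ) :
    1 - r = Real.sin (Real.pi * b) / (Real.sin (Real.pi * a) + Real.sin (Real.pi * b)) := by
  have := h.sin_ne
  rw [h.hr]; field_simp; ring

lemma FracParams.swap {r a b σ : ℝ} (h : FracParams r a b σ) : FracParams (1 - r) b a σ where
  ha := h.hb
  ha0 := h.hb0
  hb := h.ha
  hb0 := h.ha0
  sum := by rw [add_comm]; exact h.sum
  pos := h.pos
  lt_one := h.lt_one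
  sin_ne := by rw [add_comm]; exact h.sin_ne
  hr := by rw [h.one_sub, add_comm]

/-- If a = 0 then sin(πa) = 0 and r vanishes. So whenever the left-sided integral is really present,
a is strictly negative, which is what its kernel estimate requires. -/
lemma FracParams.neg_of_ne_zero {r a b σ : ℝ} (h : FracParams r a b σ) (hr : r ≠ 0) : a < 0 := by
  refine lt_of_le_of_ne h.ha0 fun h0 => hr ?_
  rw [h.hr, h0]; simp

/-- The operator `r ₀I_x^σ + (1-r) ₓI_1^σ`. -/
def fracOp (r σ : ℝ) (w : ℝ → ℝ) (x : ℝ) : ℝ :=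
  r * leftFracInt σ w x + (1 - r) * rightFracInt σ w x

/-- As b ≤ 0 and x ≥ x - t, the factor x^b is at most (x-t)^b, and the exponents combine to σ - 1 +
b = -a - 1. Under x = t + (1-t)s all powers of 1 - t cancel, leaving a beta integral independent of
t, which is finite for -1 < a < 0. -/
lemma lintegral_fracKer_weight_le {a b σ : ℝ} (hb0 : b ≤ 0)
    (hs : a + b = -σ) {t : ℝ} (ht : t ∈ Ioo (0 : ℝ) 1) :
    ∫⁻ x, ENNReal.ofReal (fracKer σ x t) * ENNReal.ofReal (weight a b x) ∂unitMeasure ≤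
      ∫⁻ s, ENNReal.ofReal (weight a (-a - 1) s) ∂unitMeasure := by
  have h1 : 0 < 1 - t := by linarith [ht.2]
  calc ∫⁻ x, ENNReal.ofReal (fracKer σ x t) * ENNReal.ofReal (weight a b x) ∂unitMeasure
      ≤ ∫⁻ x, (Ioo t 1).indicator (fun x => ENNReal.ofReal ((x - t) ^ (-a - 1) * (1 - x) ^ a)) x
          ∂unitMeasure := by
        refine lintegral_mono_ae (ae_unit_of_forall fun x hx => ?_)
        have hx1 : 0 < 1 - x := by linarith [hx.2]
        by_cases h : t < x
        · rw [indicator_of_mem (show x ∈ Ioo t 1 from ⟨h, hx.2⟩), fracKer, if_pos h,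
            ← ENNReal.ofReal_mul (Real.rpow_nonneg (by linarith) _)]
          refine ENNReal.ofReal_le_ofReal ?_
          have hxt : 0 < x - t := by linarith
          have h2 : x ^ b ≤ (x - t) ^ b :=
            Real.rpow_le_rpow_of_nonpos hxt (by linarith [ht.1]) hb0
          rw [show -a - 1 = (σ - 1) + b by linarith, Real.rpow_add hxt, weight]
          have h3 : 0 ≤ (x - t) ^ (σ - 1) * (1 - x) ^ a :=
            mul_nonneg (Real.rpow_nonneg hxt.le _) (Real.rpow_nonneg hx1.le _)
          nlinarith [mul_le_mul_of_nonneg_left h2 h3]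
        · simp [fracKer, h]
    _ = ∫⁻ x in Ioo t 1, ENNReal.ofReal ((x - t) ^ (-a - 1) * (1 - x) ^ a) := by
        rw [lintegral_indicator measurableSet_Ioo, Measure.restrict_restrict measurableSet_Ioo,
          inter_eq_self_of_subset_left (Ioo_subset_Ioo_left ht.1.le)]
    _ = ∫⁻ s, ENNReal.ofReal (weight a (-a - 1) s) ∂unitMeasure := by
        rw [lintegral_comp_affine ht.2]
        refine setLIntegral_congr_fun measurableSet_Ioo fun s hs => ?_
        have hs1 : 0 < 1 - s := by linarith [hs.2]
        rw [← ENNReal.ofReal_mul h1.le, show t + (1 - t) * s - t = (1 - t) * s by ring,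
          show 1 - (t + (1 - t) * s) = (1 - t) * (1 - s) by ring, Real.mul_rpow h1.le hs.1.le,
          Real.mul_rpow h1.le hs1.le, weight]
        congr 1
        have e : (1 - t) * ((1 - t) ^ (-a - 1) * (1 - t) ^ a) = 1 := by
          rw [← Real.rpow_add h1]
          nth_rewrite 1 [← Real.rpow_one (1 - t)]
          rw [← Real.rpow_add h1, show 1 + (-a - 1 + a) = 0 by ring, Real.rpow_zero]
        linear_combination (s ^ (-a - 1) * (1 - s) ^ a) * e

lemma integrable_fracKer {a b σ : ℝ} (ha : -1 < a) (ha0 : a < 0) (hb0 : b ≤ 0)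
    (hs : a + b = -σ) {w q : ℝ → ℝ} (hw : Integrable w unitMeasure)
    (hq : ContinuousOn q (Icc 0 1)) :
    Integrable (fun z : ℝ × ℝ => w z.2 * fracKer σ z.1 z.2 * (weight a b z.1 * q z.1))
      (unitMeasure.prod unitMeasure) := by
  obtain ⟨Q, hQ⟩ := isCompact_Icc.exists_bound_of_continuousOn hq
  refine integrable_kernel (κ := fracKer σ) (q := fun x => weight a b x * q x)
    (measurable_fracKer σ) (fracKer_nonneg σ) hw ?_
    (B := (∫⁻ s, ENNReal.ofReal (weight a (-a - 1) s) ∂unitMeasure) * ENNReal.ofReal Q) ?_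
    fun t ht => ?_
  · exact (measurable_weight a b).aestronglyMeasurable.mul
      ((hq.mono Ioo_subset_Icc_self).aestronglyMeasurable measurableSet_Ioo)
  · rw [lintegral_weight ha (by linarith)]
    exact ENNReal.mul_ne_top ENNReal.ofReal_ne_top ENNReal.ofReal_ne_top
  · refine le_trans ?_ (mul_le_mul_left (lintegral_fracKer_weight_le hb0 hs ht) _)
    rw [← lintegral_mul_const' _ _ ENNReal.ofReal_ne_top]
    refine lintegral_mono_ae (ae_unit_of_forall fun x hx => ?_)
    rw [enorm_mul, ← mul_assoc, Real.enorm_of_nonneg (weight_pos a b hx).le]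
    gcongr
    rw [← ofReal_norm]
    exact ENNReal.ofReal_le_ofReal (hQ x ⟨hx.1.le, hx.2.le⟩)

lemma integrable_fracKer_swap {a b σ : ℝ} (hb : -1 < b) (hb0 : b < 0) (ha0 : a ≤ 0)
    (hs : a + b = -σ) {w q : ℝ → ℝ} (hw : Integrable w unitMeasure)
    (hq : ContinuousOn q (Icc 0 1)) :
    Integrable (fun z : ℝ × ℝ => w z.2 * fracKer σ z.2 z.1 * (weight a b z.1 * q z.1))
      (unitMeasure.prod unitMeasure) := by
  have hq' : ContinuousOn (fun x => q (1 - x)) (Icc 0 1) :=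
    hq.comp (by fun_prop) fun x hx => ⟨by linarith [hx.2], by linarith [hx.1]⟩
  have h := integrable_fracKer (σ := σ) (b := a) (a := b) hb hb0 ha0 (by linarith)
    (integrable_reflect hw) hq'
  have hmp : MeasurePreserving (fun x : ℝ => 1 - x) unitMeasure unitMeasure := by
    have h2 := ((volume : Measure ℝ).measurePreserving_sub_left 1).restrict_preimage_emb
      (MeasurableEquiv.subLeft (1 : ℝ)).measurableEmbedding (Ioo 0 1)
    have e : (fun x : ℝ => 1 - x) ⁻¹' Ioo 0 1 = Ioo 0 1 := by ext x; simp
    rwa [e] at h2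
  have h3 := (hmp.prod hmp).integrable_comp_of_integrable h
  refine h3.congr (Filter.Eventually.of_forall fun z => ?_)
  simp only [Function.comp, Prod.map, sub_sub_cancel, weight_reflect]
  have e : fracKer σ (1 - z.1) (1 - z.2) = fracKer σ z.2 z.1 := by
    simp only [fracKer]
    by_cases h : z.1 < z.2
    · rw [if_pos h, if_pos (by linarith)]; congr 1; ring
    · rw [if_neg h, if_neg (by linarith)]
  rw [e]

/-- The adjoint relation for the two-sided fractional integral. -/
lemma FracParams.adjoint {r a b σ : ℝ} (h : FracParams r a b σ) {w q : ℝ → ℝ}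
    (hw : Integrable w unitMeasure) (hq : ContinuousOn q (Icc 0 1)) :
    Integrable (fun x => fracOp r σ w x * (weight a b x * q x)) unitMeasure ∧
    Integrable (fun x => w x * fracOp (1 - r) σ (fun t => weight a b t * q t) x) unitMeasure ∧
    ∫ x in Ioo (0 : ℝ) 1, fracOp r σ w x * (weight a b x * q x) =
      ∫ x in Ioo (0 : ℝ) 1, w x * fracOp (1 - r) σ (fun t => weight a b t * q t) x := by
  set u : ℝ → ℝ := fun t => weight a b t * q t with hu
  have hL : Integrable (fun x => r * (leftFracInt σ w x * u x)) unitMeasure ∧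
      Integrable (fun x => r * (w x * rightFracInt σ u x)) unitMeasure ∧
      ∫ x in Ioo (0 : ℝ) 1, r * (leftFracInt σ w x * u x) =
        ∫ x in Ioo (0 : ℝ) 1, r * (w x * rightFracInt σ u x) := by
    -- For r = 0 the term is absent, which matters because then a = 0 and the kernel bound would be
    -- infinite.
    by_cases hr : r = 0
    · simp [hr]
    obtain ⟨h1, h2, h3⟩ := integral_kernel_swap (κ := fracKer σ) (w := w) (q := u)
      (integrable_fracKer h.ha (h.neg_of_ne_zero hr) h.hb0 h.sum hw hq)
    have e1 : (fun x => leftFracInt σ w x * u x) =ᵐ[unitMeasure] fun x => 1 / Real.Gamma σ *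
        ((∫ t in Ioo (0 : ℝ) 1, w t * fracKer σ x t) * u x) :=
      ae_unit_of_forall fun x hx => by simp only; rw [leftFracInt_eq σ w hx]; ring
    have e2 : (fun x => w x * rightFracInt σ u x) =ᵐ[unitMeasure] fun x => 1 / Real.Gamma σ *
        (w x * ∫ t in Ioo (0 : ℝ) 1, u t * fracKer σ t x) :=
      ae_unit_of_forall fun x hx => by simp only; rw [rightFracInt_eq σ u hx]; ring
    refine ⟨((h1.const_mul _).congr e1.symm).const_mul r,
      ((h2.const_mul _).congr e2.symm).const_mul r, ?_⟩
    rw [integral_const_mul, integral_const_mul, integral_congr_ae e1, integral_congr_ae e2,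
      integral_const_mul, integral_const_mul, h3]
  have hR : Integrable (fun x => (1 - r) * (rightFracInt σ w x * u x)) unitMeasure ∧
      Integrable (fun x => (1 - r) * (w x * leftFracInt σ u x)) unitMeasure ∧
      ∫ x in Ioo (0 : ℝ) 1, (1 - r) * (rightFracInt σ w x * u x) =
        ∫ x in Ioo (0 : ℝ) 1, (1 - r) * (w x * leftFracInt σ u x) := by
    by_cases hr : 1 - r = 0
    · simp [hr]
    obtain ⟨h1, h2, h3⟩ := integral_kernel_swap (κ := fun x t => fracKer σ t x)
      (w := w) (q := u)
      (integrable_fracKer_swap h.hb (h.swap.neg_of_ne_zero hr) h.ha0 h.sum hw hq)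
    have e1 : (fun x => rightFracInt σ w x * u x) =ᵐ[unitMeasure] fun x => 1 / Real.Gamma σ *
        ((∫ t in Ioo (0 : ℝ) 1, w t * fracKer σ t x) * u x) :=
      ae_unit_of_forall fun x hx => by simp only; rw [rightFracInt_eq σ w hx]; ring
    have e2 : (fun x => w x * leftFracInt σ u x) =ᵐ[unitMeasure] fun x => 1 / Real.Gamma σ *
        (w x * ∫ t in Ioo (0 : ℝ) 1, u t * fracKer σ x t) :=
      ae_unit_of_forall fun x hx => by simp only; rw [leftFracInt_eq σ u hx]; ring
    refine ⟨((h1.const_mul _).congr e1.symm).const_mul _,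
      ((h2.const_mul _).congr e2.symm).const_mul _, ?_⟩
    rw [integral_const_mul, integral_const_mul, integral_congr_ae e1, integral_congr_ae e2,
      integral_const_mul, integral_const_mul, h3]
  have s1 : (fun x => fracOp r σ w x * u x) = fun x =>
      r * (leftFracInt σ w x * u x) + (1 - r) * (rightFracInt σ w x * u x) := by
    funext x; simp only [fracOp]; ring
  have s2 : (fun x => w x * fracOp (1 - r) σ u x) = fun x =>
      r * (w x * rightFracInt σ u x) + (1 - r) * (w x * leftFracInt σ u x) := by
    funext x; simp only [fracOp]; ring
  rw [s1, s2]
  refine ⟨hL.1.add hR.1, hL.2.1.add hR.2.1, ?_⟩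
  rw [integral_add hL.1 hR.1, integral_add hL.2.1 hR.2.1, hL.2.2, hR.2.2]

/-! ### The Chu–Vandermonde identity -/

/-- The rising factorial `x (x + 1) ⋯ (x + n - 1)`. -/
def poch (x : ℝ) (n : ℕ) : ℝ := ∏ i ∈ Finset.range n, (x + i)

lemma poch_zero (x : ℝ) : poch x 0 = 1 := by simp [poch]

lemma poch_succ (x : ℝ) (n : ℕ) : poch x (n + 1) = poch x n * (x + n) := by
  simp [poch, Finset.prod_range_succ]

lemma poch_succ' (x : ℝ) (n : ℕ) : poch x (n + 1) = x * poch (x + 1) n := by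
  simp only [poch, Finset.prod_range_succ']
  push_cast
  rw [add_zero, mul_comm]
  congr 1
  exact Finset.prod_congr rfl fun i _ => by ring

lemma poch_pos {x : ℝ} (hx : 0 < x) (n : ℕ) : 0 < poch x n :=
  Finset.prod_pos fun i _ => by positivity

lemma Gamma_add_nat {x : ℝ} (hx : 0 < x) (n : ℕ) :
    Real.Gamma (x + n) = poch x n * Real.Gamma x := by
  induction n with
  | zero => simp [poch_zero]
  | succ n ih =>
    push_cast
    rw [← add_assoc, Real.Gamma_add_one (by positivity), ih, poch_succ]
    ring

lemma alternating_choose_succ (n : ℕ) (f : ℕ → ℝ) :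
    ∑ i ∈ Finset.range (n + 1 + 1), (-1) ^ i * ((n + 1).choose i : ℝ) * f i =
      ∑ i ∈ Finset.range (n + 1), (-1) ^ i * (n.choose i : ℝ) * f i -
      ∑ i ∈ Finset.range (n + 1), (-1) ^ i * (n.choose i : ℝ) * f (i + 1) := by
  have e : ∑ i ∈ Finset.range (n + 1), (-1) ^ i * (n.choose i : ℝ) * f i =
      ∑ i ∈ Finset.range (n + 1 + 1), (-1) ^ i * (n.choose i : ℝ) * f i := by
    rw [Finset.sum_range_succ _ (n + 1)]; simp
  rw [e, Finset.sum_range_succ', Finset.sum_range_succ' (fun i => (-1) ^ i * (n.choose i : ℝ) * f i),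
    add_sub_right_comm, ← Finset.sum_sub_distrib]
  congr 1
  · refine Finset.sum_congr rfl fun i _ => ?_
    rw [Nat.choose_succ_succ]
    push_cast
    ring
  · simp

/-- Pascal's rule splits the sum into the one for n and the shifted one, which is again of the same
kind with p, q replaced by p + 1, q + 1; the difference q - p is unchanged. -/
lemma chu_vandermonde (n : ℕ) : ∀ {p q : ℝ}, 0 < q →
    ∑ i ∈ Finset.range (n + 1), (-1) ^ i * (n.choose i : ℝ) * (poch p i / poch q i) =
      poch (q - p) n / poch q n := by
  induction n with
  | zero => intro p q _; simp [poch_zero]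
  | succ n ih =>
    intro p q hq
    have hq' := poch_pos hq n
    have hq1 := poch_pos (show 0 < q + 1 by linarith) n
    have e : ∑ i ∈ Finset.range (n + 1), (-1) ^ i * (n.choose i : ℝ) *
        (poch p (i + 1) / poch q (i + 1)) = p / q * (poch (q - p) n / poch (q + 1) n) := by
      have := ih (p := p + 1) (q := q + 1) (by linarith)
      rw [show q + 1 - (p + 1) = q - p by ring] at this
      rw [← this, Finset.mul_sum]
      refine Finset.sum_congr rfl fun i _ => ?_
      have := poch_pos (show 0 < q + 1 by linarith) i
      rw [poch_succ', poch_succ']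
      field_simp
    have e2 : poch q n * (q + n) = q * poch (q + 1) n := by rw [← poch_succ, poch_succ']
    have hqn : 0 < q + n := by positivity
    have e3 : poch (q + 1) n = poch q n * (q + n) / q := by rw [e2]; field_simp
    rw [alternating_choose_succ, e, ih hq, poch_succ, poch_succ, e3]
    field_simp
    ring

/-! ### Fractional integrals of powers -/

lemma leftFracInt_pow {σ : ℝ} (hσ : 0 < σ) (k : ℕ) {x : ℝ} (hx : x ∈ Ioo (0 : ℝ) 1) :
    leftFracInt σ (fun t => t ^ k) x =
      Real.Gamma (k + 1) / Real.Gamma (k + 1 + σ) * x ^ (k + σ) := by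
  have hΓ := Real.Gamma_pos_of_pos hσ
  have himg : (fun s : ℝ => x * s) '' Ioo 0 1 = Ioo 0 x := by
    rw [image_mul_left_Ioo hx.1]; simp
  have e : ∫ s in Ioo (0 : ℝ) x, s ^ k * (x - s) ^ (σ - 1) =
      x ^ (k + σ) * ∫ s in Ioo (0 : ℝ) 1, weight (σ - 1) k s := by
    rw [← himg, integral_image_eq_integral_abs_deriv_smul measurableSet_Ioo
      (f' := fun _ => x) (fun s _ => by
        simpa using ((hasDerivAt_id s).const_mul x).hasDerivWithinAt)
      (fun s _ s' _ h => by simpa [hx.1.ne'] using h), ← integral_const_mul]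
    refine setIntegral_congr_fun measurableSet_Ioo fun s hs => ?_
    simp only [smul_eq_mul, abs_of_pos hx.1, weight, Real.rpow_natCast]
    rw [show x - x * s = x * (1 - s) by ring, Real.mul_rpow hx.1.le (by linarith [hs.2]),
      show (k + σ : ℝ) = k + (1 + (σ - 1)) by ring, Real.rpow_add hx.1, Real.rpow_add hx.1,
      Real.rpow_natCast, Real.rpow_one]
    ring
  rw [leftFracInt, e, integral_weight (by linarith) (by have := k.cast_nonneg (α := ℝ); linarith),
    show σ - 1 + k + 2 = k + 1 + σ by ring, sub_add_cancel]
  field_simp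

lemma rightFracInt_one_sub_pow {σ : ℝ} (hσ : 0 < σ) (k : ℕ) {x : ℝ} (hx : x ∈ Ioo (0 : ℝ) 1) :
    rightFracInt σ (fun t => (1 - t) ^ k) x =
      Real.Gamma (k + 1) / Real.Gamma (k + 1 + σ) * (1 - x) ^ (k + σ) := by
  rw [rightFracInt_reflect σ _ hx]
  simp only [sub_sub_cancel]
  exact leftFracInt_pow hσ k ⟨by linarith [hx.2], by linarith [hx.1]⟩

lemma rightFracInt_affine (σ : ℝ) (w : ℝ → ℝ) {x : ℝ} (hx : x ∈ Ioo (0 : ℝ) 1) :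
    rightFracInt σ w x = 1 / Real.Gamma σ * ((1 - x) ^ σ *
      ∫ s in Ioo (0 : ℝ) 1, w (x + (1 - x) * s) * s ^ (σ - 1)) := by
  have h1 : 0 < 1 - x := by linarith [hx.2]
  rw [rightFracInt, integral_comp_affine hx.2, ← integral_const_mul ((1 - x) ^ σ)]
  congr 1
  refine setIntegral_congr_fun measurableSet_Ioo fun s hs => ?_
  rw [show x + (1 - x) * s - x = (1 - x) * s by ring, Real.mul_rpow h1.le hs.1.le,
    show (1 - x) ^ σ = (1 - x) ^ (1 + (σ - 1)) by congr 1; ring, Real.rpow_add h1, Real.rpow_one]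
  ring

lemma integrable_rpow_unit {σ : ℝ} (hσ : 0 < σ) :
    Integrable (fun s : ℝ => s ^ (σ - 1)) unitMeasure := by
  refine (integrable_weight (a := 0) (b := σ - 1) (by norm_num) (by linarith)).congr
    (Filter.Eventually.of_forall fun s => ?_)
  simp [weight]

/-- Integrate the derivative of (x + (1-x)s)^{k+1} s^σ over (0,1), rewriting (1-x)s as (x + (1-x)s)
- x. The boundary value is 1 at s = 1 and 0 at s = 0. -/
lemma integral_affine_pow_rec {σ : ℝ} (hσ : 0 < σ) (k : ℕ) (x : ℝ) :
    (k + 1 + σ) * ∫ s in Ioo (0 : ℝ) 1, (x + (1 - x) * s) ^ (k + 1) * s ^ (σ - 1) =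
      (k + 1) * x * (∫ s in Ioo (0 : ℝ) 1, (x + (1 - x) * s) ^ k * s ^ (σ - 1)) + 1 := by
  have hint : ∀ j : ℕ, Integrable (fun s : ℝ => (x + (1 - x) * s) ^ j * s ^ (σ - 1)) unitMeasure := by
    intro j
    have := integrable_mul_continuousOn (integrable_rpow_unit hσ)
      (q := fun s : ℝ => (x + (1 - x) * s) ^ j) (by fun_prop)
    exact this.congr (Filter.Eventually.of_forall fun s => by simp only; ring)
  have hI : Integrable (fun s : ℝ => (k + 1 + σ) * ((x + (1 - x) * s) ^ (k + 1) * s ^ (σ - 1)) -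
      (k + 1) * x * ((x + (1 - x) * s) ^ k * s ^ (σ - 1))) unitMeasure :=
    ((hint (k + 1)).const_mul _).sub ((hint k).const_mul _)
  have h := intervalIntegral.integral_eq_sub_of_hasDerivAt_of_le (a := 0) (b := 1)
    (f := fun s : ℝ => (x + (1 - x) * s) ^ (k + 1) * s ^ σ)
    (f' := fun s : ℝ => (k + 1 + σ) * ((x + (1 - x) * s) ^ (k + 1) * s ^ (σ - 1)) -
      (k + 1) * x * ((x + (1 - x) * s) ^ k * s ^ (σ - 1))) zero_le_one ?_ ?_ ?_
  · rw [intervalIntegral.integral_of_le zero_le_one, integral_Ioc_eq_integral_Ioo,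
      integral_sub ((hint (k + 1)).const_mul _) ((hint k).const_mul _), integral_const_mul,
      integral_const_mul] at h
    simp only [Real.one_rpow, Real.zero_rpow hσ.ne'] at h
    rw [show x + (1 - x) * 1 = 1 by ring, one_pow] at h
    linarith
  · exact (Continuous.continuousOn (by fun_prop)).mul
      (continuousOn_id.rpow_const fun s _ => Or.inr hσ.le)
  · intro s hs
    have h1 : HasDerivAt (fun s : ℝ => (x + (1 - x) * s) ^ (k + 1))
        (((k + 1 : ℕ) : ℝ) * (x + (1 - x) * s) ^ k * (1 - x)) s := by
      have : HasDerivAt (fun s : ℝ => x + (1 - x) * s) (1 - x) s := by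
        simpa using ((hasDerivAt_id s).const_mul (1 - x)).const_add x
      simpa using this.fun_pow (k + 1)
    have h2 := Real.hasDerivAt_rpow_const (x := s) (p := σ) (Or.inl hs.1.ne')
    refine (h1.mul h2).congr_deriv ?_
    rw [show s ^ σ = s ^ (1 + (σ - 1)) by congr 1; ring, Real.rpow_add hs.1, Real.rpow_one]
    push_cast
    ring
  · rw [intervalIntegrable_iff_integrableOn_Ioo_of_le zero_le_one]
    exact hI

/-- The left integral satisfies the recursion exactly; the right one leaves a boundary term that
does not depend on k. That independence keeps the image of a weighted polynomial polynomial: the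
boundary term affects only its constant coefficient. -/
lemma fracOp_pow_rec {r σ : ℝ} (hσ : 0 < σ) (k : ℕ) {x : ℝ} (hx : x ∈ Ioo (0 : ℝ) 1) :
    (k + 1) * (x * fracOp r σ (fun t => t ^ k) x) =
      (k + 1 + σ) * fracOp r σ (fun t => t ^ (k + 1)) x -
        (1 - r) / Real.Gamma σ * (1 - x) ^ σ := by
  have hΓ := Real.Gamma_pos_of_pos hσ
  have hk : (0 : ℝ) < k + 1 + σ := by positivity
  have hrec := integral_affine_pow_rec hσ k x
  have hL : (k + 1) * (x * leftFracInt σ (fun t => t ^ k) x) =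
      (k + 1 + σ) * leftFracInt σ (fun t => t ^ (k + 1)) x := by
    rw [leftFracInt_pow hσ k hx, leftFracInt_pow hσ (k + 1) hx]
    push_cast
    rw [show (k + 1 + 1 + σ : ℝ) = k + 1 + σ + 1 by ring, Real.Gamma_add_one hk.ne',
      Real.Gamma_add_one (s := (k : ℝ) + 1) (by positivity), show (k + 1 + σ : ℝ) = 1 + (k + σ) by ring,
      Real.rpow_add hx.1 1, Real.rpow_one]
    have h1 := Real.Gamma_pos_of_pos (show (0 : ℝ) < 1 + (k + σ) by positivity)
    have h2 : (0 : ℝ) < 1 + (k + σ) := by positivity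
    field_simp
  have hR : (k + 1) * (x * rightFracInt σ (fun t => t ^ k) x) =
      (k + 1 + σ) * rightFracInt σ (fun t => t ^ (k + 1)) x - 1 / Real.Gamma σ * (1 - x) ^ σ := by
    rw [rightFracInt_affine σ _ hx, rightFracInt_affine σ _ hx]
    linear_combination (-(1 / Real.Gamma σ * (1 - x) ^ σ)) * hrec
  simp only [fracOp]
  linear_combination r * hL + (1 - r) * hR

/-! ### Moments of the image of weighted powers -/

/-- `∫ ω^{(a,b)} x^n (L x^k)` for the two-sided fractional integral `L`. -/
def fracMoment (r a b σ : ℝ) (n k : ℕ) : ℝ :=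
  ∫ x in Ioo (0 : ℝ) 1, fracOp r σ (fun t => t ^ k) x * (weight a b x * x ^ n)

lemma integrable_pow_unit (k : ℕ) : Integrable (fun x : ℝ => x ^ k) unitMeasure := by
  have := integrable_weight_mul_continuousOn (a := 0) (b := 0) (by norm_num) (by norm_num)
    (q := fun x : ℝ => x ^ k) (by fun_prop)
  simpa [weight_zero_zero] using this

lemma FracParams.integrable_fracMoment {r a b σ : ℝ} (h : FracParams r a b σ) (n k : ℕ) :
    Integrable (fun x => fracOp r σ (fun t => t ^ k) x * (weight a b x * x ^ n)) unitMeasure :=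
  (h.adjoint (integrable_pow_unit k) (q := fun x => x ^ n) (by fun_prop)).1

lemma FracParams.exists_fracMoment_succ {r a b σ : ℝ} (h : FracParams r a b σ) (n : ℕ) :
    ∃ d : ℝ, ∀ k : ℕ, (k + 1) * fracMoment r a b σ (n + 1) k =
      (k + 1 + σ) * fracMoment r a b σ n (k + 1) - d := by
  refine ⟨(1 - r) / Real.Gamma σ * ∫ x in Ioo (0 : ℝ) 1, weight (a + σ) b x * x ^ n, fun k => ?_⟩
  have hi : Integrable (fun x => weight (a + σ) b x * x ^ n) unitMeasure :=
    integrable_weight_mul_continuousOn (by linarith [h.ha, h.pos]) h.hb (by fun_prop)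
  simp only [fracMoment]
  rw [← integral_const_mul, ← integral_const_mul, ← integral_const_mul, ← integral_sub
    ((h.integrable_fracMoment n (k + 1)).const_mul _) (hi.const_mul _)]
  refine setIntegral_congr_fun measurableSet_Ioo fun x hx => ?_
  have hrec := fracOp_pow_rec (r := r) h.pos k hx
  have hw : weight (a + σ) b x = (1 - x) ^ σ * weight a b x := by
    simp only [weight, Real.rpow_add (show 0 < 1 - x by linarith [hx.2])]; ring
  simp only [hw]
  linear_combination (weight a b x * x ^ n) * hrec

lemma integral_weight_leftFracInt_pow {a b σ : ℝ} (ha : -1 < a) (ha0 : a ≤ 0)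
    (hs : a + b = -σ) (hσ : 0 < σ) (k : ℕ) :
    ∫ x in Ioo (0 : ℝ) 1, weight a b x * leftFracInt σ (fun t => t ^ k) x =
      Real.Gamma (1 + a) * Real.Gamma (1 - a) / Real.Gamma (1 + σ) *
        (poch (1 - a) k / poch (1 + σ) k) / (k + 1) := by
  have e : ∫ x in Ioo (0 : ℝ) 1, weight a b x * leftFracInt σ (fun t => t ^ k) x =
      ∫ x in Ioo (0 : ℝ) 1, Real.Gamma (k + 1) / Real.Gamma (k + 1 + σ) *
        (weight a (-a) x * x ^ k) := by
    refine setIntegral_congr_fun measurableSet_Ioo fun x hx => ?_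
    simp only [leftFracInt_pow hσ k hx, weight]
    rw [show -a = b + σ by linarith, Real.rpow_add hx.1, Real.rpow_add hx.1, Real.rpow_natCast]
    ring
  rw [e, integral_const_mul, integral_weight_mul_pow ha (by linarith),
    show (k + 1 + σ : ℝ) = 1 + σ + k by ring, show (-a + k + 1 : ℝ) = 1 - a + k by ring,
    show (a + -a + k + 2 : ℝ) = k + 1 + 1 by ring, Real.Gamma_add_one (s := (k : ℝ) + 1)
    (by positivity), Gamma_add_nat (by linarith), Gamma_add_nat (by linarith), add_comm a 1]
  have h1 := Real.Gamma_pos_of_pos (show (0 : ℝ) < k + 1 by positivity)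
  have h2 := Real.Gamma_pos_of_pos (show 0 < 1 + σ by linarith)
  have h3 := poch_pos (show 0 < 1 + σ by linarith) k
  field_simp

/-- Euler's reflection formula. Multiplying by r keeps it valid at a = 0, where both sides vanish.
-/
lemma Gamma_one_add_mul_Gamma_one_sub {r a S : ℝ} (ha : -1 < a) (ha0 : a ≤ 0)
    (hr : r = Real.sin (Real.pi * a) / S) :
    r * (Real.Gamma (1 + a) * Real.Gamma (1 - a)) = Real.pi * a / S := by
  rcases eq_or_lt_of_le ha0 with h | h
  · simp [hr, h]
  have h1 := Real.Gamma_mul_Gamma_one_sub a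
  have h2 : Real.sin (Real.pi * a) ≠ 0 := by
    have := Real.sin_neg_of_neg_of_neg_pi_lt (x := Real.pi * a)
      (mul_neg_of_pos_of_neg Real.pi_pos h) (by nlinarith [Real.pi_pos])
    exact this.ne
  rw [add_comm, Real.Gamma_add_one h.ne, mul_assoc, h1, hr]
  rw [div_mul_eq_mul_div]
  congr 1
  field_simp

/-- In view of the adjoint relation this says that ω^{(a,b)} is mapped to a constant: the right side
is that constant times ∫ x^k. The relation between r and the exponents is what makes the
non-constant parts cancel. -/
lemma FracParams.fracMoment_zero {r a b σ : ℝ} (h : FracParams r a b σ) (k : ℕ) :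
    fracMoment r a b σ 0 k = -Real.pi /
      ((Real.sin (Real.pi * a) + Real.sin (Real.pi * b)) * Real.Gamma σ) / (k + 1) := by
  set S := Real.sin (Real.pi * a) + Real.sin (Real.pi * b) with hS
  have hσ := h.pos
  have hab := h.sum
  have hS0 : S ≠ 0 := h.sin_ne
  have hΓ := Real.Gamma_pos_of_pos hσ
  have hk : (0 : ℝ) < k + 1 := by positivity
  have hra := Gamma_one_add_mul_Gamma_one_sub h.ha h.ha0 h.hr
  have hrb := Gamma_one_add_mul_Gamma_one_sub h.hb h.hb0 h.one_sub
  rw [← hS] at hra hrb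
  have hL : ∀ x ∈ Ioo (0 : ℝ) 1, weight a b x * leftFracInt σ (fun t => t ^ k) x =
      Real.Gamma (k + 1) / Real.Gamma (k + 1 + σ) * (weight a (b + σ) x * x ^ k) := by
    intro x hx
    simp only [leftFracInt_pow hσ k hx, weight]
    rw [Real.rpow_add hx.1, Real.rpow_add hx.1, Real.rpow_natCast]
    ring
  have hR : ∀ j : ℕ, ∀ x ∈ Ioo (0 : ℝ) 1, weight a b x * rightFracInt σ (fun t => (1 - t) ^ j) x =
      Real.Gamma (j + 1) / Real.Gamma (j + 1 + σ) * (weight (a + σ) b x * (1 - x) ^ j) := by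
    intro j x hx
    have hx1 : 0 < 1 - x := by linarith [hx.2]
    simp only [rightFracInt_one_sub_pow hσ j hx, weight]
    rw [Real.rpow_add hx1, Real.rpow_add hx1, Real.rpow_natCast]
    ring
  have iL : Integrable (fun x => weight a b x * leftFracInt σ (fun t => t ^ k) x) unitMeasure :=
    ((integrable_weight_mul_continuousOn h.ha (by linarith [h.hb]) (q := fun x => x ^ k)
      (by fun_prop)).const_mul _).congr (ae_unit_of_forall fun x hx => (hL x hx).symm)
  have iR : ∀ j : ℕ, Integrable (fun x => weight a b x * rightFracInt σ (fun t => (1 - t) ^ j) x)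
      unitMeasure := fun j =>
    ((integrable_weight_mul_continuousOn (by linarith [h.ha]) h.hb (q := fun x => (1 - x) ^ j)
      (by fun_prop)).const_mul _).congr (ae_unit_of_forall fun x hx => (hR j x hx).symm)
  have vR : ∀ j : ℕ, ∫ x in Ioo (0 : ℝ) 1, weight a b x * rightFracInt σ (fun t => (1 - t) ^ j) x =
      Real.Gamma (1 + b) * Real.Gamma (1 - b) / Real.Gamma (1 + σ) *
        (poch (1 - b) j / poch (1 + σ) j) / (j + 1) := by
    intro j
    rw [← integral_weight_leftFracInt_pow (b := a) h.hb h.hb0 (by linarith) hσ j, ← integral_reflect]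
    refine setIntegral_congr_fun measurableSet_Ioo fun x hx => ?_
    simp only [weight_reflect]
    rw [rightFracInt_reflect σ _ ⟨by linarith [hx.2], by linarith [hx.1]⟩]
    simp only [sub_sub_cancel]
  -- Right-sided integrals are explicit for powers of 1 - t, so t^k is expanded in these; the
  -- alternating binomial signs are what Chu–Vandermonde needs.
  have hexp : ∀ x ∈ Ioo (0 : ℝ) 1, rightFracInt σ (fun t => t ^ k) x =
      ∑ j ∈ Finset.range (k + 1), (-1) ^ j * (k.choose j : ℝ) *
        rightFracInt σ (fun t => (1 - t) ^ j) x := by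
    intro x hx
    simp only [rightFracInt_affine σ _ hx]
    have hI : ∀ j : ℕ, Integrable (fun s : ℝ => (1 - (x + (1 - x) * s)) ^ j * s ^ (σ - 1))
        unitMeasure := fun j => by
      have := integrable_mul_continuousOn (integrable_rpow_unit hσ)
        (q := fun s : ℝ => (1 - (x + (1 - x) * s)) ^ j) (by fun_prop)
      exact this.congr (Filter.Eventually.of_forall fun s => by simp only; ring)
    have e : ∀ s : ℝ, (x + (1 - x) * s) ^ k * s ^ (σ - 1) = ∑ j ∈ Finset.range (k + 1),
        (-1) ^ j * (k.choose j : ℝ) * ((1 - (x + (1 - x) * s)) ^ j * s ^ (σ - 1)) := by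
      intro s
      have := add_pow (-(1 - (x + (1 - x) * s))) 1 k
      rw [show -(1 - (x + (1 - x) * s)) + 1 = x + (1 - x) * s by ring] at this
      rw [this, Finset.sum_mul]
      refine Finset.sum_congr rfl fun j _ => ?_
      rw [neg_pow, one_pow]
      ring
    simp only [e]
    rw [integral_finsetSum _ fun j _ => (hI j).const_mul _, Finset.mul_sum, Finset.mul_sum]
    refine Finset.sum_congr rfl fun j _ => ?_
    rw [integral_const_mul]
    ring
  have e1 : fracMoment r a b σ 0 k =
      r * (∫ x in Ioo (0 : ℝ) 1, weight a b x * leftFracInt σ (fun t => t ^ k) x) +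
      (1 - r) * ∑ j ∈ Finset.range (k + 1), (-1) ^ j * (k.choose j : ℝ) *
        ∫ x in Ioo (0 : ℝ) 1, weight a b x * rightFracInt σ (fun t => (1 - t) ^ j) x := by
    rw [← integral_const_mul]
    simp only [← integral_const_mul ((-1 : ℝ) ^ _ * _)]
    rw [← integral_finsetSum _ fun j _ => (iR j).const_mul _, ← integral_const_mul,
      ← integral_add (iL.const_mul _)
        ((integrable_finsetSum _ fun j _ => (iR j).const_mul _).const_mul _), fracMoment]
    refine setIntegral_congr_fun measurableSet_Ioo fun x hx => ?_
    simp only [fracOp, hexp x hx, pow_zero, mul_one, Finset.mul_sum, Finset.sum_mul, add_mul]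
    congr 1
    · ring
    · exact Finset.sum_congr rfl fun j _ => by ring
  have hσ1 : 0 < 1 + σ := by linarith
  have hΓ1 := Real.Gamma_pos_of_pos hσ1
  -- Chu–Vandermonde of order k + 1 with p = -b, q = σ, where q - p = -a. Its term i = 0 is the 1 on
  -- the right, and the others are shifted down by one index.
  have hch : (k + 1) * ∑ j ∈ Finset.range (k + 1), (-1) ^ j * (k.choose j : ℝ) *
      (poch (1 - b) j / poch (1 + σ) j / (j + 1)) * b =
      σ * (poch (-a) (k + 1) / poch σ (k + 1) - 1) := by
    have hcv := chu_vandermonde (k + 1) (p := -b) hσ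
    rw [show σ - -b = -a by linarith, Finset.sum_range_succ'] at hcv
    simp only [poch_zero, pow_zero, Nat.choose_zero_right, Nat.cast_one, mul_one, div_one] at hcv
    rw [← hcv, add_sub_cancel_right, Finset.mul_sum, Finset.mul_sum]
    refine Finset.sum_congr rfl fun j _ => ?_
    have hj : ((j : ℝ) + 1) * ((k + 1).choose (j + 1) : ℝ) = (k + 1) * (k.choose j : ℝ) := by
      have := Nat.add_one_mul_choose_eq k j
      rw [mul_comm (_ + 1 : ℝ)]
      exact_mod_cast this.symm
    have hp := poch_pos hσ1 j
    have hj0 : (0 : ℝ) < j + 1 := by positivity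
    rw [poch_succ', poch_succ', show -b + 1 = 1 - b by ring, add_comm σ 1, pow_succ]
    field_simp
    linear_combination (-(b * poch (1 - b) j)) * hj
  have ea : poch (-a) (k + 1) / poch σ (k + 1) = -a / σ * (poch (1 - a) k / poch (1 + σ) k) := by
    rw [poch_succ', poch_succ', show -a + 1 = 1 - a by ring, add_comm σ 1]
    have hp := poch_pos hσ1 k
    field_simp
  rw [ea] at hch
  rw [e1, integral_weight_leftFracInt_pow h.ha h.ha0 hab hσ]
  simp only [vR]
  have hΓσ : Real.Gamma (1 + σ) = σ * Real.Gamma σ := by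
    rw [add_comm, Real.Gamma_add_one hσ.ne']
  set X := poch (1 - a) k / poch (1 + σ) k with hX
  have e3 : ∑ j ∈ Finset.range (k + 1), (-1) ^ j * (k.choose j : ℝ) *
      (Real.Gamma (1 + b) * Real.Gamma (1 - b) / Real.Gamma (1 + σ) *
        (poch (1 - b) j / poch (1 + σ) j) / (j + 1)) =
      Real.Gamma (1 + b) * Real.Gamma (1 - b) / Real.Gamma (1 + σ) *
      ∑ j ∈ Finset.range (k + 1), (-1) ^ j * (k.choose j : ℝ) *
        (poch (1 - b) j / poch (1 + σ) j / (j + 1)) := by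
    rw [Finset.mul_sum]
    exact Finset.sum_congr rfl fun j _ => by ring
  rw [e3]
  rw [← Finset.sum_mul] at hch
  set Y := ∑ j ∈ Finset.range (k + 1), (-1) ^ j * (k.choose j : ℝ) *
        (poch (1 - b) j / poch (1 + σ) j / (j + 1)) with hY
  rw [hΓσ]
  have e4 : r * (Real.Gamma (1 + a) * Real.Gamma (1 - a) / (σ * Real.Gamma σ) * X / (k + 1)) +
      (1 - r) * (Real.Gamma (1 + b) * Real.Gamma (1 - b) / (σ * Real.Gamma σ) * Y) =
      ((r * (Real.Gamma (1 + a) * Real.Gamma (1 - a))) * X / (k + 1) +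
      ((1 - r) * (Real.Gamma (1 + b) * Real.Gamma (1 - b))) * Y) / (σ * Real.Gamma σ) := by ring
  rw [e4, hra, hrb]
  -- The k-dependent quotient X from the left integral now cancels against the same quotient in Y.
  have e5 : (k + 1) * (Y * b) = -a * X - σ := by rw [hch]; field_simp
  field_simp
  linear_combination e5

/-! ### The eigenvalue relation -/

/-- The eigenvalues of the two-sided fractional integral on weighted Jacobi polynomials. -/
def fracEigen (a b σ : ℝ) (n : ℕ) : ℝ :=
  -Real.pi / ((Real.sin (Real.pi * a) + Real.sin (Real.pi * b)) * Real.Gamma σ) *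
    (poch (1 - σ) n / n !)

lemma fracEigen_succ (a b σ : ℝ) (n : ℕ) :
    fracEigen a b σ (n + 1) = fracEigen a b σ n * ((n + 1 - σ) / (n + 1)) := by
  have h1 : (n ! : ℝ) ≠ 0 := by positivity
  have h2 : (n + 1 : ℝ) ≠ 0 := by positivity
  simp only [fracEigen, poch_succ, Nat.factorial_succ]
  push_cast
  field_simp
  ring

/-- The sums on the right are the moments of the polynomial Σ c_i x^i. In the inductive step the
factor k + 1 + σ is split by partial fractions in k. -/
lemma FracParams.exists_fracMoment_eq {r a b σ : ℝ} (h : FracParams r a b σ) (n : ℕ) :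
    ∃ c : ℕ → ℝ, c n = fracEigen a b σ n ∧ ∀ k : ℕ, fracMoment r a b σ n k =
      ∑ i ∈ Finset.range (n + 1), c i / (k + i + 1) := by
  induction n with
  | zero =>
    refine ⟨fun _ => fracEigen a b σ 0, rfl, fun k => ?_⟩
    rw [h.fracMoment_zero k]
    simp [fracEigen, poch_zero]
  | succ n ih =>
    obtain ⟨c, hc, hm⟩ := ih
    obtain ⟨d, hd⟩ := h.exists_fracMoment_succ n
    -- From (k+1+σ)/(k+i+2) = (k+1)(i+1-σ)/((i+1)(k+i+2)) + σ/(i+1): the first part moves c_i to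
    -- index i + 1 with the ratio of consecutive eigenvalues, and the second joins -d in the
    -- constant coefficient.
    refine ⟨fun i => if i = 0 then σ * (∑ i ∈ Finset.range (n + 1), c i / (i + 1)) - d else
      c (i - 1) * ((i - σ) / i), ?_, fun k => ?_⟩
    · simp [fracEigen_succ, hc]
    · have hk : (0 : ℝ) < k + 1 := by positivity
      refine mul_left_cancel₀ hk.ne' ?_
      rw [hd k, hm (k + 1), Finset.sum_range_succ' _ (n + 1)]
      simp only [Nat.succ_ne_zero, if_false, if_true, Nat.add_sub_cancel]
      have e : (k + 1 : ℝ) * ((σ * (∑ i ∈ Finset.range (n + 1), c i / (i + 1)) - d) /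
          (k + (0 : ℕ) + 1)) = σ * (∑ i ∈ Finset.range (n + 1), c i / (i + 1)) - d := by
        push_cast
        field_simp
        ring
      rw [mul_add, e, Finset.mul_sum, Finset.mul_sum, Finset.mul_sum, ← add_sub_assoc,
        ← Finset.sum_add_distrib]
      congr 1
      refine Finset.sum_congr rfl fun i _ => ?_
      push_cast
      have h1 : (0 : ℝ) < k + 1 + i + 1 := by positivity
      have h2 : (0 : ℝ) < k + (i + 1) + 1 := by positivity
      have h3 : (0 : ℝ) < i + 1 := by positivity
      field_simp
      ring

lemma ae_eq_of_moments_pow {g g' : ℝ → ℝ} (hg : Integrable g unitMeasure)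
    (hg' : Integrable g' unitMeasure)
    (h : ∀ k : ℕ, ∫ x in Ioo (0 : ℝ) 1, x ^ k * g x = ∫ x in Ioo (0 : ℝ) 1, x ^ k * g' x) :
    g =ᵐ[unitMeasure] g' := by
  have hpow : ∀ {u : ℝ → ℝ}, Integrable u unitMeasure → ∀ k : ℕ,
      Integrable (fun x => x ^ k * u x) unitMeasure := fun hu k =>
    (integrable_mul_continuousOn hu (q := fun x => x ^ k) (by fun_prop)).congr
      (Filter.Eventually.of_forall fun x => by simp only; ring)
  have : ∀ᵐ x ∂unitMeasure, g x - g' x = 0 := by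
    refine ae_eq_zero_of_moments (hg.sub hg') fun p => ?_
    have e : ∀ x, (g x - g' x) * p.eval x = ∑ i ∈ Finset.range (p.natDegree + 1),
        (p.coeff i * (x ^ i * g x) - p.coeff i * (x ^ i * g' x)) := by
      intro x
      rw [Polynomial.eval_eq_sum_range, Finset.mul_sum]
      exact Finset.sum_congr rfl fun i _ => by ring
    simp only [e]
    have hi : ∀ i ∈ Finset.range (p.natDegree + 1), Integrable (fun x =>
        p.coeff i * (x ^ i * g x) - p.coeff i * (x ^ i * g' x)) unitMeasure := fun i _ =>
      ((hpow hg i).const_mul _).sub ((hpow hg' i).const_mul _)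
    rw [integral_finsetSum _ hi]
    refine Finset.sum_eq_zero fun i _ => ?_
    rw [integral_sub ((hpow hg i).const_mul _) ((hpow hg' i).const_mul _), integral_const_mul,
      integral_const_mul, h i, sub_self]
  exact this.mono fun x hx => by linarith

lemma integral_pow_unit (n : ℕ) : ∫ x in Ioo (0 : ℝ) 1, x ^ n = 1 / (n + 1) := by
  rw [← integral_Ioc_eq_integral_Ioo, ← intervalIntegral.integral_of_le zero_le_one, integral_pow]
  simp

/-- The image and the polynomial have the same moments, hence agree almost everywhere. The map is
triangular in the degree, with `fracEigen` on the diagonal. -/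
lemma FracParams.exists_polynomial_image {r a b σ : ℝ} (h : FracParams r a b σ) {n : ℕ}
    {q : Polynomial ℝ} (hq : q.natDegree ≤ n) :
    ∃ p : Polynomial ℝ, p.natDegree ≤ n ∧ p.coeff n = fracEigen a b σ n * q.coeff n ∧
      ∀ᵐ x ∂unitMeasure, fracOp (1 - r) σ (fun t => weight a b t * q.eval t) x = p.eval x := by
  choose c hc hm using fun n => h.exists_fracMoment_eq n
  let P : ℕ → Polynomial ℝ := fun i => ∑ l ∈ Finset.range (i + 1), Polynomial.monomial l (c i l)
  have hPdeg : ∀ i, (P i).natDegree ≤ i := fun i =>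
    Polynomial.natDegree_sum_le_of_forall_le _ _ fun l hl =>
      (Polynomial.natDegree_monomial_le _).trans (Nat.lt_succ_iff.1 (Finset.mem_range.1 hl))
  have hPc : ∀ i, (P i).coeff i = fracEigen a b σ i := by
    intro i
    rw [← hc i]
    simp [P, Polynomial.finsetSum_coeff, Polynomial.coeff_monomial]
  refine ⟨∑ i ∈ Finset.range (n + 1), Polynomial.C (q.coeff i) * P i,
    Polynomial.natDegree_sum_le_of_forall_le _ _ fun i hi =>
      (Polynomial.natDegree_C_mul_le _ _).trans
        ((hPdeg i).trans (Nat.lt_succ_iff.1 (Finset.mem_range.1 hi))), ?_, ?_⟩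
  · rw [Polynomial.finsetSum_coeff, Finset.sum_eq_single n]
    · rw [Polynomial.coeff_C_mul, hPc]; ring
    · intro i hi hin
      have hlt : i < n := lt_of_le_of_ne (Nat.lt_succ_iff.1 (Finset.mem_range.1 hi)) hin
      rw [Polynomial.coeff_C_mul, Polynomial.coeff_eq_zero_of_natDegree_lt
        ((hPdeg i).trans_lt hlt), mul_zero]
    · simp
  · have hadj := fun k : ℕ => h.adjoint (integrable_pow_unit k) (q := fun x => q.eval x)
      q.continuous.continuousOn
    have hpol : ∀ p : Polynomial ℝ, Integrable (fun x => p.eval x) unitMeasure := fun p => by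
      simpa [weight_zero_zero] using integrable_weight_mul_continuousOn (a := 0) (b := 0)
        (by norm_num) (by norm_num) (q := fun x => p.eval x) p.continuous.continuousOn
    refine ae_eq_of_moments_pow (by simpa using (hadj 0).2.1) (hpol _) fun k => ?_
    rw [← (hadj k).2.2]
    have e1 : ∀ x, fracOp r σ (fun t => t ^ k) x * (weight a b x * q.eval x) =
        ∑ i ∈ Finset.range (n + 1), q.coeff i *
          (fracOp r σ (fun t => t ^ k) x * (weight a b x * x ^ i)) := by
      intro x
      rw [Polynomial.eval_eq_sum_range' (Nat.lt_succ_iff.2 hq), Finset.mul_sum, Finset.mul_sum]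
      exact Finset.sum_congr rfl fun i _ => by ring
    have e2 : ∀ x : ℝ, x ^ k * (∑ i ∈ Finset.range (n + 1),
        Polynomial.C (q.coeff i) * P i).eval x = ∑ i ∈ Finset.range (n + 1), q.coeff i *
          ∑ l ∈ Finset.range (i + 1), c i l * x ^ (k + l) := by
      intro x
      simp only [P, Polynomial.eval_finsetSum, Polynomial.eval_mul, Polynomial.eval_C,
        Polynomial.eval_monomial, Finset.mul_sum]
      exact Finset.sum_congr rfl fun i _ => Finset.sum_congr rfl fun l _ => by rw [pow_add]; ring
    simp only [e1, e2]
    rw [integral_finsetSum _ fun i _ => (h.integrable_fracMoment i k).const_mul _,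
      integral_finsetSum _ fun i _ => (integrable_finsetSum _ fun l _ =>
        (integrable_pow_unit (k + l)).const_mul _).const_mul _]
    refine Finset.sum_congr rfl fun i _ => ?_
    rw [integral_const_mul, integral_const_mul, integral_finsetSum _ fun l _ =>
        (integrable_pow_unit (k + l)).const_mul _]
    congr 1
    rw [← fracMoment, hm i k]
    refine Finset.sum_congr rfl fun l _ => ?_
    rw [integral_const_mul, integral_pow_unit]
    push_cast
    ring

lemma ae_eq_zero_of_orthogonal {a b : ℝ} (ha : -1 < a) (hb : -1 < b) {p : Polynomial ℝ}
    (h : ∫ x in Ioo (0 : ℝ) 1, weight a b x * (p.eval x * p.eval x) = 0) :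
    ∀ᵐ x ∂unitMeasure, p.eval x = 0 := by
  rw [integral_eq_zero_iff_of_nonneg_ae] at h
  · filter_upwards [h, ae_unit_of_forall fun x hx => weight_pos a b hx] with x hx hw
    simpa [hw.ne'] using hx
  · exact ae_unit_of_forall fun x hx => mul_nonneg (weight_pos a b hx).le (mul_self_nonneg _)
  · exact integrable_weight_mul_continuousOn ha hb (q := fun x => p.eval x * p.eval x)
      (p.continuous.mul p.continuous).continuousOn

/-- The two-sided fractional integral maps weighted Jacobi polynomials to Jacobi polynomials. -/
lemma FracParams.fracOp_jacobi {r a b σ : ℝ} (h : FracParams r a b σ) (n : ℕ) :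
    ∀ᵐ x ∂unitMeasure, fracOp (1 - r) σ (fun t => weight a b t * jacobiG n a b t) x =
      fracEigen a b σ n * jacobiG n b a x := by
  obtain ⟨p, hpd, hpc, hp⟩ := h.exists_polynomial_image (natDegree_jacobiPoly_le n a b)
  simp only [eval_jacobiPoly] at hp
  -- The leading terms cancel because the leading coefficient of a Jacobi polynomial is symmetric in
  -- a and b; the rest of the proof shows that D is orthogonal to itself in the weight ω^{(b,a)}.
  set D : Polynomial ℝ := p - Polynomial.C (fracEigen a b σ n) * jacobiPoly n b a with hD
  have hDdeg : D.degree < n := by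
    rw [Polynomial.degree_lt_iff_coeff_zero]
    intro m hm
    rcases eq_or_lt_of_le hm with rfl | hm
    · rw [hD, Polynomial.coeff_sub, Polynomial.coeff_C_mul, hpc,
        coeff_jacobiPoly_congr n b a a b (add_comm b a), sub_self]
    · refine Polynomial.coeff_eq_zero_of_natDegree_lt (lt_of_le_of_lt ?_ hm)
      exact (Polynomial.natDegree_sub_le _ _).trans (max_le hpd
        ((Polynomial.natDegree_C_mul_le _ _).trans (natDegree_jacobiPoly_le n b a)))
  have hG : ∫ x in Ioo (0 : ℝ) 1, weight b a x * D.eval x * jacobiG n b a x = 0 :=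
    weightInner_jacobi_eq_zero n h.hb h.ha D hDdeg
  have hw : Integrable (fun x => weight a b x * jacobiG n a b x) unitMeasure :=
    integrable_weight_mul_continuousOn h.ha h.hb (continuous_jacobiG n a b).continuousOn
  -- Adjointness moves the operator from ω^{(a,b)} G_n onto ω^{(b,a)} D. The image of the latter is
  -- a polynomial of degree below n, to which G_n is orthogonal.
  have hP : ∫ x in Ioo (0 : ℝ) 1, p.eval x * (weight b a x * D.eval x) = 0 := by
    have hadj := (h.swap.adjoint hw (q := fun x => D.eval x) D.continuous.continuousOn).2.2
    rw [integral_congr_ae (hp.mono fun x hx => by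
      show p.eval x * (weight b a x * D.eval x) =
        fracOp (1 - r) σ (fun t => weight a b t * jacobiG n a b t) x * (weight b a x * D.eval x)
      rw [hx]), hadj]
    by_cases hD0 : D = 0
    · simp [hD0, fracOp, leftFracInt, rightFracInt]
    · have hn : D.natDegree < n := (Polynomial.natDegree_lt_iff_degree_lt hD0).2 hDdeg
      obtain ⟨p', hp'd, -, hp'⟩ := h.swap.exists_polynomial_image (le_refl D.natDegree)
      rw [integral_congr_ae (hp'.mono fun x hx => by
        show _ = weight a b x * p'.eval x * jacobiG n a b x
        simp only [hx]
        ring)]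
      refine weightInner_jacobi_eq_zero n h.ha h.hb p' ?_
      refine Polynomial.degree_le_natDegree.trans_lt ?_
      exact_mod_cast hp'd.trans_lt hn
  have hDD : ∫ x in Ioo (0 : ℝ) 1, weight b a x * (D.eval x * D.eval x) = 0 := by
    have e : ∀ x, weight b a x * (D.eval x * D.eval x) = p.eval x * (weight b a x * D.eval x) -
        fracEigen a b σ n * (weight b a x * D.eval x * jacobiG n b a x) := by
      intro x
      have : D.eval x = p.eval x - fracEigen a b σ n * jacobiG n b a x := by
        simp [hD, eval_jacobiPoly]
      linear_combination (weight b a x * D.eval x) * this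
    simp only [e]
    rw [integral_sub, integral_const_mul, hP, hG]
    · simp
    · exact (integrable_weight_mul_continuousOn h.hb h.ha (q := fun x => p.eval x * D.eval x)
        (p.continuous.mul D.continuous).continuousOn).congr
        (Filter.Eventually.of_forall fun x => by simp only; ring)
    · exact ((integrable_weight_mul_continuousOn h.hb h.ha
        (q := fun x => D.eval x * jacobiG n b a x)
        (D.continuous.mul (continuous_jacobiG n b a)).continuousOn).congr
        (Filter.Eventually.of_forall fun x => by simp only; ring)).const_mul _
  filter_upwards [hp, ae_eq_zero_of_orthogonal h.hb h.ha hDD] with x h1 h2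
  rw [h1]
  have : D.eval x = p.eval x - fracEigen a b σ n * jacobiG n b a x := by
    simp [hD, eval_jacobiPoly]
  linarith

/-! ### Jacobi expansions in weighted `L²` -/

lemma memLp_weightMeasure_continuousOn {a b : ℝ} (ha : -1 < a) (hb : -1 < b) {q : ℝ → ℝ}
    (hq : ContinuousOn q (Icc 0 1)) : MemLp q 2 (weightMeasure a b) := by
  have := isFiniteMeasure_weightMeasure ha hb
  obtain ⟨Q, hQ⟩ := isCompact_Icc.exists_bound_of_continuousOn hq
  refine MemLp.of_bound (aestronglyMeasurable_weightMeasure_iff.2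
    ((hq.mono Ioo_subset_Icc_self).aestronglyMeasurable measurableSet_Ioo)) Q ?_
  exact ae_weightMeasure_iff.2 (ae_unit_of_forall fun x hx => hQ x ⟨hx.1.le, hx.2.le⟩)

lemma inner_toLp {a b : ℝ} {f g : ℝ → ℝ} (hf : MemLp f 2 (weightMeasure a b))
    (hg : MemLp g 2 (weightMeasure a b)) :
    inner ℝ (hf.toLp f) (hg.toLp g) = weightInner a b f g := by
  rw [L2.inner_def]
  rw [integral_congr_ae (g := fun x => f x * g x)]
  · rw [integral_weightMeasure, weightInner]
    simp only [mul_assoc]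
  · filter_upwards [hf.coeFn_toLp, hg.coeFn_toLp] with x h1 h2
    rw [h1, h2]
    simp [mul_comm]

/-- The normalized Jacobi polynomials in the weighted `L²` space. -/
def jacobiLp {a b : ℝ} (ha : -1 < a) (hb : -1 < b) (n : ℕ) : Lp ℝ 2 (weightMeasure a b) :=
  (memLp_weightMeasure_continuousOn ha hb
    (((continuous_jacobiG n a b).const_smul (Real.sqrt (jacobiNormSq n a b))⁻¹).continuousOn)).toLp _

lemma inner_jacobiLp {a b : ℝ} (ha : -1 < a) (hb : -1 < b) (n : ℕ) {f : ℝ → ℝ}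
    (hf : MemLp f 2 (weightMeasure a b)) :
    inner ℝ (jacobiLp ha hb n) (hf.toLp f) =
      (Real.sqrt (jacobiNormSq n a b))⁻¹ * weightInner a b f (jacobiG n a b) := by
  rw [jacobiLp, inner_toLp, weightInner, weightInner, ← integral_const_mul]
  refine integral_congr_ae (Filter.Eventually.of_forall fun x => ?_)
  simp only [Pi.smul_apply, smul_eq_mul]
  ring

lemma orthonormal_jacobiLp {a b : ℝ} (ha : -1 < a) (hb : -1 < b) :
    Orthonormal ℝ (jacobiLp ha hb) := by
  rw [orthonormal_iff_ite]
  intro m n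
  have e : inner ℝ (jacobiLp ha hb m) (jacobiLp ha hb n) = (Real.sqrt (jacobiNormSq m a b))⁻¹ *
      ((Real.sqrt (jacobiNormSq n a b))⁻¹ * weightInner a b (jacobiG n a b) (jacobiG m a b)) := by
    rw [show jacobiLp ha hb n = MemLp.toLp _ _ from rfl, inner_jacobiLp]
    congr 1
    rw [weightInner, weightInner, ← integral_const_mul]
    refine integral_congr_ae (Filter.Eventually.of_forall fun x => ?_)
    simp only [Pi.smul_apply, smul_eq_mul]
    ring
  rw [e]
  split_ifs with h
  · subst h
    have hp := jacobiNormSq_pos m ha hb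
    change _ * (_ * jacobiNormSq m a b) = 1
    rw [← mul_assoc, ← mul_inv, Real.mul_self_sqrt hp.le, inv_mul_cancel₀ hp.ne']
  · rw [weightInner_jacobi_of_ne ha hb (Ne.symm h)]; simp

lemma norm_toLp_sq {a b : ℝ} {f : ℝ → ℝ} (hf : MemLp f 2 (weightMeasure a b)) :
    ‖hf.toLp f‖ ^ 2 = (weightNorm a b f).toReal ^ 2 := by
  rw [Lp.norm_toLp, weightNorm]

/-- Bessel's inequality for Jacobi polynomials. -/
lemma jacobi_bessel {a b : ℝ} (ha : -1 < a) (hb : -1 < b) {f : ℝ → ℝ}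
    (hf : MemLp f 2 (weightMeasure a b)) (s : Finset ℕ) :
    ∑ n ∈ s, weightInner a b f (jacobiG n a b) ^ 2 / jacobiNormSq n a b ≤
      (weightNorm a b f).toReal ^ 2 := by
  have h := (orthonormal_jacobiLp ha hb).sum_inner_products_le (hf.toLp f) (s := s)
  rw [norm_toLp_sq] at h
  refine le_trans (le_of_eq (Finset.sum_congr rfl fun n _ => ?_)) h
  have hp := jacobiNormSq_pos n ha hb
  rw [inner_jacobiLp, Real.norm_eq_abs, sq_abs, mul_pow, inv_pow, Real.sq_sqrt hp.le]
  field_simp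

/-- Riesz–Fischer for Jacobi expansions, with a bound for the tails. -/
lemma exists_jacobi_expansion {a b : ℝ} (ha : -1 < a) (hb : -1 < b) (c : ℕ → ℝ) {B : ℝ}
    (hB : ∀ s : Finset ℕ, ∑ n ∈ s, c n ^ 2 * jacobiNormSq n a b ≤ B) :
    ∃ v : ℝ → ℝ, MemLp v 2 (weightMeasure a b) ∧
      (∀ n, weightInner a b v (jacobiG n a b) = c n * jacobiNormSq n a b) ∧
      ∀ (N : ℕ) (T : ℝ), (∀ s : Finset ℕ, (∀ n ∈ s, N ≤ n) →
          ∑ n ∈ s, c n ^ 2 * jacobiNormSq n a b ≤ T) →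
        (weightNorm a b (fun x => v x - ∑ n ∈ Finset.range N, c n * jacobiG n a b x)).toReal ^ 2
          ≤ T := by
  have ho := orthonormal_jacobiLp ha hb
  let l : ℕ → ℝ := fun n => c n * Real.sqrt (jacobiNormSq n a b)
  have hl : ∀ n, l n ^ 2 = c n ^ 2 * jacobiNormSq n a b := fun n => by
    simp only [l]; rw [mul_pow, Real.sq_sqrt (jacobiNormSq_pos n ha hb).le]
  have hsum : Summable fun n => l n • jacobiLp ha hb n := by
    have := (ho.orthogonalFamily.summable_iff_norm_sq_summable l).2 ?_
    · simpa using this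
    · refine summable_of_sum_le (c := B) (fun _ => by positivity) fun s => ?_
      simpa [hl] using hB s
  obtain ⟨v, hv⟩ := hsum
  have hvm : MemLp v 2 (weightMeasure a b) := Lp.memLp v
  have hvv : hvm.toLp v = v := Lp.toLp_coeFn v hvm
  refine ⟨v, hvm, fun n => ?_, fun N T hT => ?_⟩
  · have h1 : HasSum (fun m => inner ℝ (jacobiLp ha hb n) (l m • jacobiLp ha hb m))
        (inner ℝ (jacobiLp ha hb n) v) := hv.mapL (innerSL ℝ (jacobiLp ha hb n))
    have h2 : HasSum (fun m => inner ℝ (jacobiLp ha hb n) (l m • jacobiLp ha hb m)) (l n) := by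
      have h3 : ∀ m, m ≠ n → inner ℝ (jacobiLp ha hb n) (l m • jacobiLp ha hb m) = (0 : ℝ) := by
        intro m hm
        rw [inner_smul_right, ho.2 (Ne.symm hm), mul_zero]
      have := hasSum_single n h3
      rwa [inner_smul_right, real_inner_self_eq_norm_sq, ho.1 n, one_pow, mul_one] at this
    have h4 := h1.unique h2
    rw [← hvv, inner_jacobiLp] at h4
    have hp := jacobiNormSq_pos n ha hb
    have hs := Real.sqrt_pos.2 hp
    rw [inv_mul_eq_iff_eq_mul₀ hs.ne'] at h4
    rw [h4]
    simp only [l]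
    rw [mul_comm (c n), ← mul_assoc, Real.mul_self_sqrt hp.le, mul_comm]
  · have hcont : ContinuousOn (fun x => ∑ n ∈ Finset.range N, c n * jacobiG n a b x) (Icc 0 1) := by
      have := fun n => continuous_jacobiG n a b
      fun_prop
    have hm := memLp_weightMeasure_continuousOn ha hb hcont
    have e : (hvm.sub hm).toLp _ = v - ∑ n ∈ Finset.range N, l n • jacobiLp ha hb n := by
      rw [MemLp.toLp_sub hvm hm, hvv]
      congr 1
      have e2 : ∀ n, l n • jacobiLp ha hb n = (memLp_weightMeasure_continuousOn ha hb
          ((continuous_jacobiG n a b).const_smul (c n)).continuousOn).toLp _ := by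
        intro n
        rw [jacobiLp, ← MemLp.toLp_const_smul]
        congr 1
        funext x
        have hs := Real.sqrt_pos.2 (jacobiNormSq_pos n ha hb)
        simp only [l, Pi.smul_apply, smul_eq_mul]
        field_simp
      simp only [e2]
      refine Lp.ext ?_
      refine hm.coeFn_toLp.trans ?_
      refine Filter.EventuallyEq.trans ?_ (Lp.coeFn_finsetSum _ _).symm
      have h5 : ∀ᵐ x ∂weightMeasure a b, ∀ n, (memLp_weightMeasure_continuousOn ha hb
          ((continuous_jacobiG n a b).const_smul (c n)).continuousOn).toLp _ x =
          c n • jacobiG n a b x := ae_all_iff.2 fun n => MemLp.coeFn_toLp _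
      filter_upwards [h5] with x hx
      simp [hx]
    have h6 : ‖(hvm.sub hm).toLp _‖ ^ 2 = _ := norm_toLp_sq (hvm.sub hm)
    change (weightNorm a b (v - fun x => ∑ n ∈ Finset.range N, c n * jacobiG n a b x)).toReal ^ 2 ≤ T
    rw [← h6, e]
    -- The tail norm is the limit of norms of finite blocks, each equal by orthonormality to a sum
    -- over `Ico N M` and hence bounded by T.
    have hlim : Filter.Tendsto (fun M => ‖∑ n ∈ Finset.range M, l n • jacobiLp ha hb n -
        ∑ n ∈ Finset.range N, l n • jacobiLp ha hb n‖ ^ 2) Filter.atTop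
        (nhds (‖v - ∑ n ∈ Finset.range N, l n • jacobiLp ha hb n‖ ^ 2)) :=
      (((hv.tendsto_sum_nat).sub_const _).norm).pow 2
    refine le_of_tendsto hlim ?_
    filter_upwards [Filter.eventually_ge_atTop N] with M hM
    rw [← Finset.sum_Ico_eq_sub _ hM, ← real_inner_self_eq_norm_sq, ho.inner_sum]
    refine le_trans (le_of_eq (Finset.sum_congr rfl fun n _ => ?_))
      (hT (Finset.Ico N M) fun n hn => (Finset.mem_Ico.1 hn).1)
    rw [← hl]; simp [sq]

/-! ### Coefficient decay -/

/-- Each step of the norm recurrence has ratio (n + a + b + 2)/(n + 1), which is at least 1 because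
a + b + 1 ≥ 0. -/
lemma jacobiNormSq_shift_le (m : ℕ) : ∀ {a b : ℝ}, -1 < a → -1 < b → 0 ≤ a + b + 1 → ∀ n : ℕ,
    jacobiNormSq n (a + m) (b + m) ≤ jacobiNormSq (n + m) a b := by
  induction m with
  | zero => intro a b _ _ _ n; simp
  | succ m ih =>
    intro a b ha hb hab n
    have h1 := ih (a := a + 1) (b := b + 1) (by linarith) (by linarith) (by linarith) n
    have h2 := jacobiNormSq_succ ha hb (n + m)
    have h3 := jacobiNormSq_pos (n + m) (show -1 < a + 1 by linarith) (show -1 < b + 1 by linarith)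
    push_cast at h2 ⊢
    rw [show a + (m + 1 : ℝ) = a + 1 + m by ring, show b + (m + 1 : ℝ) = b + 1 + m by ring,
      ← add_assoc]
    refine h1.trans ?_
    have h4 : (0 : ℝ) < n + m + 1 := by positivity
    refine le_of_mul_le_mul_left ?_ h4
    rw [h2]
    exact mul_le_mul_of_nonneg_right (by linarith) h3.le

/-- The shift relation iterated m times; the factors n + 1, …, n + m accumulate to the falling
factorial, the source of the decay in n. -/
lemma weightInner_jacobi_descFactorial {a b : ℝ} {F : ℕ → ℝ → ℝ} {m : ℕ}
    (hF : ∀ k < m, IsWeakDeriv 1 (F k) (F (k + 1)))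
    (hi : ∀ k ≤ m, Integrable (fun x => weight (a + k) (b + k) x * F k x) unitMeasure) (n : ℕ) :
    ((n + m).descFactorial m : ℝ) * weightInner a b (F 0) (jacobiG (n + m) a b) =
      weightInner (a + m) (b + m) (F m) (jacobiG n (a + m) (b + m)) := by
  induction m generalizing n with
  | zero => simp
  | succ m ih =>
    have h1 := ih (fun k hk => hF k (by omega)) (fun k hk => hi k (by omega)) (n + 1)
    have hi1 := hi (m + 1) le_rfl
    push_cast at hi1 ⊢
    rw [← add_assoc, ← add_assoc] at hi1
    have h2 := integral_weight_jacobi_succ (hF m (by omega)) (hi m (by omega)) hi1 n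
    rw [← h1, add_assoc a, add_assoc b] at h2
    rw [← h2, show n + (m + 1) = n + 1 + m by ring, Nat.descFactorial_succ,
      show n + 1 + m - m = n + 1 by omega]
    push_cast
    ring

/-- The smallest of the m factors is i + 2 - m, and it is still at least (N + 1)/(m + 1), even when
m is close to i + 1. -/
lemma descFactorial_lower {i m N : ℕ} (hi : N + 1 ≤ i) (hm : m ≤ i + 1) :
    ((N : ℝ) + 1) ^ m ≤ (m + 1) ^ m * ((i + 1).descFactorial m : ℝ) := by
  have h1 : (i + 1 + 1 - m) ^ m ≤ (i + 1).descFactorial m := Nat.pow_sub_le_descFactorial _ _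
  have h2 : N + 1 ≤ (m + 1) * (i + 1 + 1 - m) := by
    obtain ⟨k, hk⟩ := Nat.exists_eq_add_of_le hm
    rw [show i + 1 + 1 - m = k + 1 by omega]
    nlinarith
  have h3 : (N + 1) ^ m ≤ (m + 1) ^ m * (i + 1).descFactorial m :=
    (Nat.pow_le_pow_left h2 m).trans (by rw [mul_pow]; exact Nat.mul_le_mul_left _ h1)
  exact_mod_cast h3

/-- The tail of the coefficient sequence, in terms of the `m`-th derivative. -/
lemma jacobi_tail_le {a b : ℝ} (ha : -1 < a) (hb : -1 < b) (hab : 0 ≤ a + b + 1)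
    {F : ℕ → ℝ → ℝ} {m : ℕ} (hF : ∀ k < m, IsWeakDeriv 1 (F k) (F (k + 1)))
    (hi : ∀ k ≤ m, Integrable (fun x => weight (a + k) (b + k) x * F k x) unitMeasure)
    (hm : MemLp (F m) 2 (weightMeasure (a + m) (b + m))) {lam : ℕ → ℝ} {N : ℕ} {Λ : ℝ}
    (hΛ : 0 < Λ) (hlam : ∀ i, N + 1 ≤ i → Λ ≤ |lam i|) (hN : m ≤ N + 2) (s : Finset ℕ)
    (hs : ∀ i ∈ s, N + 1 ≤ i) :
    ∑ i ∈ s, (weightInner a b (F 0) (jacobiG (i + 1) a b) / jacobiNormSq (i + 1) a b / lam i) ^ 2 *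
        jacobiNormSq i (a + 1) (b + 1) ≤
      ((m + 1) ^ m / (Λ * (N + 1) ^ m) * (weightNorm (a + m) (b + m) (F m)).toReal) ^ 2 := by
  have ha' : -1 < a + m := by have := m.cast_nonneg (α := ℝ); linarith
  have hb' : -1 < b + m := by have := m.cast_nonneg (α := ℝ); linarith
  -- Since m ≤ N + 2 ≤ i + 1, the natural-number subtraction does not truncate.
  have hinj : InjOn (fun i => i + 1 - m) (s : Set ℕ) := by
    intro i hi j hj hij
    have h1 := hs i hi
    have h2 := hs j hj
    simp only at hij
    omega
  have hbes := jacobi_bessel ha' hb' hm (s.image fun i => i + 1 - m)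
  rw [Finset.sum_image hinj] at hbes
  rw [mul_pow]
  refine le_trans ?_ (mul_le_mul_of_nonneg_left hbes (sq_nonneg _))
  rw [Finset.mul_sum]
  refine Finset.sum_le_sum fun i his => ?_
  have hi1 := hs i his
  obtain ⟨n, hn⟩ : ∃ n, i + 1 = n + m := ⟨i + 1 - m, by omega⟩
  have e1 := weightInner_jacobi_descFactorial hF hi n
  have e2 := jacobiNormSq_shift_le m ha hb hab n
  have e3 := jacobiNormSq_shift_le 1 ha hb hab i
  have e4 := descFactorial_lower hi1 (show m ≤ i + 1 by omega)
  have e5 := hlam i hi1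
  rw [← hn] at e1 e2
  rw [show i + 1 - m = n by omega]
  push_cast at e3
  rw [← e1]
  set W := weightInner a b (F 0) (jacobiG (i + 1) a b)
  set h := jacobiNormSq (i + 1) a b with hh
  have hhp : 0 < h := jacobiNormSq_pos _ ha hb
  set h' := jacobiNormSq i (a + 1) (b + 1)
  have hp2 : 0 < jacobiNormSq n (a + m) (b + m) := jacobiNormSq_pos _ ha' hb'
  set h2 := jacobiNormSq n (a + m) (b + m)
  set d : ℝ := ((i + 1).descFactorial m : ℝ)
  have hN0 : (0 : ℝ) < (N + 1) ^ m := by positivity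
  have hl0 : 0 < |lam i| := hΛ.trans_le e5
  -- The target norm `h'` is bounded by h and the eigenvalue by Λ; afterwards h is replaced by the
  -- smaller `h2`, which is the norm that occurs in Bessel's inequality for the m-th derivative.
  have s1 : (W / h / lam i) ^ 2 * h' ≤ W ^ 2 / h / Λ ^ 2 := by
    have t1 : (W / h / lam i) ^ 2 * h' ≤ (W / h / lam i) ^ 2 * h :=
      mul_le_mul_of_nonneg_left e3 (sq_nonneg _)
    have t2 : (W / h / lam i) ^ 2 * h = W ^ 2 / h / |lam i| ^ 2 := by
      rw [sq_abs, div_pow, div_pow]; field_simp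
    rw [t2] at t1
    refine t1.trans ?_
    gcongr
  refine s1.trans ?_
  have t3 : W ^ 2 / h / Λ ^ 2 ≤ W ^ 2 / h2 / Λ ^ 2 := by gcongr
  refine t3.trans ?_
  have t4 : ((m + 1 : ℝ) ^ m / (Λ * (N + 1) ^ m)) ^ 2 * ((d * W) ^ 2 / h2) =
      ((m + 1) ^ m * d / (N + 1) ^ m) ^ 2 * (W ^ 2 / h2 / Λ ^ 2) := by
    field_simp
  rw [t4]
  have t5 : 1 ≤ (m + 1) ^ m * d / ((N : ℝ) + 1) ^ m := by rwa [one_le_div hN0]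
  exact le_mul_of_one_le_left (by positivity) (one_le_pow₀ t5)

/-! ### Attaining the Sobolev norms -/

lemma isWeakDeriv_self {v : ℝ → ℝ} (hv : LocallyIntegrableOn v (Ioo (0 : ℝ) 1)) :
    IsWeakDeriv 0 v v := ⟨hv, hv, fun η _ _ _ => by simp⟩

/-- Weak derivatives are unique up to null sets and L does not see null sets, so the infimum is
attained; B < ⊤ excludes the empty infimum. At order 0 the function v itself is chosen, so that
later equations hold pointwise. -/
lemma exists_chain_of_iInf_le {v : ℝ → ℝ} {m : ℕ} {B : ℝ≥0∞} (hB : B < ⊤)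
    (L : ℕ → (ℝ → ℝ) → ℝ≥0∞)
    (hL : ∀ j (g g' : ℝ → ℝ), g =ᵐ[unitMeasure] g' → L j g = L j g')
    (h : ∀ j ≤ m, ⨅ (g : ℝ → ℝ) (_ : IsWeakDeriv j v g), L j g ≤ B) :
    ∃ g : ℕ → ℝ → ℝ, g 0 = v ∧ (∀ j ≤ m, IsWeakDeriv j v (g j)) ∧ ∀ j ≤ m, L j (g j) ≤ B := by
  have h1 : ∀ j ≤ m, ∃ g, IsWeakDeriv j v g ∧ L j g ≤ B := by
    intro j hj
    have h2 := (h j hj).trans_lt hB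
    rw [iInf_lt_iff] at h2
    obtain ⟨g, hg⟩ := h2
    rw [iInf_lt_iff] at hg
    obtain ⟨hg, -⟩ := hg
    refine ⟨g, hg, le_trans ?_ (h j hj)⟩
    exact le_iInf₂ fun g' hg' => (hL j g g' (hg.unique hg')).le
  obtain ⟨g₀, h0, h0'⟩ := h1 0 (Nat.zero_le _)
  choose! G hG hG' using h1
  refine ⟨fun j => if j = 0 then v else G j, by simp, fun j hj => ?_, fun j hj => ?_⟩ <;>
    by_cases hj0 : j = 0
  · subst hj0; simpa using isWeakDeriv_self h0.1
  · simpa [hj0] using hG j hj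
  · subst hj0; simpa [hL 0 _ _ h0.zero_ae_eq] using h0'
  · simpa [hj0] using hG' j hj

lemma exists_chain_of_weightSobolevNorm {m : ℕ} {a b : ℝ} {v : ℝ → ℝ}
    (h : weightSobolevNorm m a b v < ⊤) :
    ∃ g : ℕ → ℝ → ℝ, g 0 = v ∧ (∀ j ≤ m, IsWeakDeriv j v (g j)) ∧
      ∀ j ≤ m, weightNorm (a + j) (b + j) (g j) ≤ weightSobolevNorm m a b v := by
  refine exists_chain_of_iInf_le h (fun j g => weightNorm (a + j) (b + j) g)
    (fun j g g' hg => eLpNorm_congr_ae (ae_weightMeasure_iff.2 hg)) fun j hj => ?_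
  change weightSeminorm j a b v ≤ _
  have h1 : weightSeminorm j a b v ^ 2 ≤
      ∑ j ∈ Finset.range (m + 1), weightSeminorm j a b v ^ 2 :=
    Finset.single_le_sum (f := fun j => weightSeminorm j a b v ^ 2) (fun _ _ => zero_le)
      (Finset.mem_range.2 (by omega))
  have h2 := ENNReal.rpow_le_rpow h1 (show (0 : ℝ) ≤ 1 / 2 by norm_num)
  rwa [← ENNReal.rpow_natCast, ← ENNReal.rpow_mul, show ((2 : ℕ) : ℝ) * (1 / 2) = 1 by norm_num,
    ENNReal.rpow_one] at h2

lemma exists_chain_of_sobolevInftyNorm {m : ℕ} {v : ℝ → ℝ}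
    (h : sobolevInftyNorm m v < ⊤) :
    ∃ g : ℕ → ℝ → ℝ, g 0 = v ∧ (∀ j ≤ m, IsWeakDeriv j v (g j)) ∧
      ∀ j ≤ m, eLpNorm (g j) ∞ unitMeasure ≤ sobolevInftyNorm m v := by
  refine exists_chain_of_iInf_le h (fun j g => eLpNorm g ∞ unitMeasure)
    (fun j g g' hg => eLpNorm_congr_ae hg) fun j hj => ?_
  exact Finset.le_sup (f := fun j => ⨅ (g : ℝ → ℝ) (_ : IsWeakDeriv j v g),
    eLpNorm g ∞ (volume.restrict (Ioo (0 : ℝ) 1))) (Finset.mem_range.2 (by omega))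

/-! ### The norm of a Leibniz expression -/

lemma weightNorm_mul_le {a b : ℝ} {v h : ℝ → ℝ} (hh : AEStronglyMeasurable h unitMeasure) :
    weightNorm a b (fun x => v x * h x) ≤ eLpNorm v ∞ unitMeasure * weightNorm a b h := by
  refine (eLpNorm_smul_le_eLpNorm_top_mul_eLpNorm 2
    (aestronglyMeasurable_weightMeasure_iff.2 hh) v).trans ?_
  refine mul_le_mul_left ?_ _
  rw [eLpNorm_exponent_top, eLpNorm_exponent_top]
  exact eLpNormEssSup_mono_measure v (withDensity_absolutelyContinuous _ _)

lemma weightNorm_mono {a b a' b' : ℝ} (ha : a' ≤ a) (hb : b' ≤ b) (v : ℝ → ℝ) :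
    weightNorm a b v ≤ weightNorm a' b' v :=
  eLpNorm_mono_measure v (weightMeasure_mono ha hb)

/-- The factor H_j comes with the weight of exponents a + j, b + j, which on (0,1) dominates that of
a + k, b + k for j ≤ k. The binomial coefficients sum to 2^k. -/
lemma weightNorm_leibniz_le {a b : ℝ} {V H : ℕ → ℝ → ℝ} {k : ℕ} {B M : ℝ≥0∞}
    (hVm : ∀ i ≤ k, AEStronglyMeasurable (V i) unitMeasure)
    (hHm : ∀ i ≤ k, AEStronglyMeasurable (H i) unitMeasure)
    (hV : ∀ i ≤ k, eLpNorm (V i) ∞ unitMeasure ≤ B)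
    (hH : ∀ i ≤ k, weightNorm (a + i) (b + i) (H i) ≤ M) :
    weightNorm (a + k) (b + k) (leibniz V H k) ≤ 2 ^ k * (B * M) := by
  have hle : ∀ ij ∈ Finset.HasAntidiagonal.antidiagonal k, ij.1 ≤ k ∧ ij.2 ≤ k := fun ij hij => by
    have := Finset.HasAntidiagonal.mem_antidiagonal.1 hij; omega
  have e : leibniz V H k = ∑ ij ∈ Finset.HasAntidiagonal.antidiagonal k,
      fun x => (k.choose ij.1 : ℝ) * (V ij.1 x * H ij.2 x) := by
    funext x; simp [leibniz]
  have hm : ∀ ij ∈ Finset.HasAntidiagonal.antidiagonal k, AEStronglyMeasurable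
      (fun x => (k.choose ij.1 : ℝ) * (V ij.1 x * H ij.2 x)) (weightMeasure (a + k) (b + k)) :=
    fun ij hij => aestronglyMeasurable_weightMeasure_iff.2
      (((hVm _ (hle ij hij).1).mul (hHm _ (hle ij hij).2)).const_mul _)
  rw [weightNorm, e]
  refine (eLpNorm_sum_le hm (by norm_num)).trans ?_
  have hb : ∀ ij ∈ Finset.HasAntidiagonal.antidiagonal k,
      eLpNorm (fun x => (k.choose ij.1 : ℝ) * (V ij.1 x * H ij.2 x)) 2
        (weightMeasure (a + k) (b + k)) ≤ (k.choose ij.1 : ℝ≥0∞) * (B * M) := by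
    intro ij hij
    obtain ⟨h1, h2⟩ := hle ij hij
    have h3 := eLpNorm_const_smul (k.choose ij.1 : ℝ) (fun x => V ij.1 x * H ij.2 x) 2
      (weightMeasure (a + k) (b + k))
    change eLpNorm (fun x => (k.choose ij.1 : ℝ) * (V ij.1 x * H ij.2 x)) 2 _ = _ at h3
    rw [h3, Real.enorm_natCast]
    refine mul_le_mul_right ?_ _
    refine (weightNorm_mul_le (hHm _ h2)).trans (mul_le_mul' (hV _ h1) ?_)
    have h4 : (ij.2 : ℝ) ≤ k := by exact_mod_cast h2
    exact (weightNorm_mono (by linarith) (by linarith) _).trans (hH _ h2)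
  refine (Finset.sum_le_sum hb).trans (le_of_eq ?_)
  rw [← Finset.sum_mul, Finset.Nat.sum_antidiagonal_eq_sum_range_succ_mk]
  have := Nat.sum_range_choose k
  rw [← Nat.cast_sum]
  simp only [this]
  push_cast; rfl

/-! ### Bounds for the primitive of the source -/

/-- Cauchy–Schwarz with f split off against the reciprocal weight. That weight need not be
integrable up to the end points, so it is compared with c q only between 1/2 and x, where c may grow
with x. -/
lemma abs_integral_le_weightNorm {a b c : ℝ} {f q : ℝ → ℝ}
    (hf : MemLp f 2 (weightMeasure a b)) (hq : Integrable q unitMeasure)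
    (hq0 : ∀ t ∈ Ioo (0 : ℝ) 1, 0 ≤ q t) {x : ℝ} (hx : x ∈ Ioo (0 : ℝ) 1)
    (hc : 0 ≤ c) (h : ∀ t ∈ uIoc (1 / 2) x, weight (-a) (-b) t ≤ c * q t) :
    |∫ t in (1 / 2)..x, f t| ≤
      Real.sqrt (c * ∫ t in Ioo (0 : ℝ) 1, q t) * (weightNorm a b f).toReal := by
  set S := uIoc (1 / 2) x with hS
  have hSm : MeasurableSet S := measurableSet_uIoc
  have hsub : S ⊆ Ioo 0 1 := uIoc_subset_uIcc.trans
    (ordConnected_Ioo.uIcc_subset (by norm_num) hx)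
  have hle : volume.restrict S ≤ unitMeasure := Measure.restrict_mono hsub le_rfl
  have hfm : AEStronglyMeasurable f unitMeasure := aestronglyMeasurable_weightMeasure_iff.1 hf.1
  let u : ℝ → ℝ := fun t => weight (a / 2) (b / 2) t * |f t|
  let v : ℝ → ℝ := weight (-a / 2) (-b / 2)
  have hu2 : ∀ t ∈ Ioo (0 : ℝ) 1, u t ^ 2 = weight a b t * f t ^ 2 := fun t ht => by
    have := weight_mul_weight (a / 2) (b / 2) (a / 2) (b / 2) ht
    simp only [add_halves] at this
    simp only [u]
    rw [mul_pow, sq_abs, sq, this]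
  have hv2 : ∀ t ∈ Ioo (0 : ℝ) 1, v t ^ 2 = weight (-a) (-b) t := fun t ht => by
    have := weight_mul_weight (-a / 2) (-b / 2) (-a / 2) (-b / 2) ht
    simp only [add_halves] at this
    simp only [v]
    rw [sq, this]
  have huv : ∀ t ∈ Ioo (0 : ℝ) 1, u t * v t = ‖f t‖ := fun t ht => by
    have := weight_mul_weight (a / 2) (b / 2) (-a / 2) (-b / 2) ht
    rw [show a / 2 + -a / 2 = 0 by ring, show b / 2 + -b / 2 = 0 by ring, weight_zero_zero] at this
    simp only [u, v]
    rw [mul_right_comm, this, one_mul, Real.norm_eq_abs]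
  have hfi : Integrable (fun t => weight a b t * f t ^ 2) unitMeasure :=
    integrable_weightMeasure_iff.1 hf.integrable_sq
  have hum : AEStronglyMeasurable u (volume.restrict S) := by
    have : AEStronglyMeasurable u unitMeasure :=
      (measurable_weight _ _).aestronglyMeasurable.mul (hfm.norm)
    exact this.mono_measure hle
  have hui : Integrable (fun t => u t ^ 2) (volume.restrict S) :=
    (hfi.mono_measure hle).congr (ae_restrict_of_forall_mem hSm fun t ht => (hu2 t (hsub ht)).symm)
  have hvi : Integrable (fun t => v t ^ 2) (volume.restrict S) := by
    refine ((hq.mono_measure hle).const_mul c).mono'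
      ((measurable_weight _ _).pow_const 2).aestronglyMeasurable
      (ae_restrict_of_forall_mem hSm fun t ht => ?_)
    rw [Real.norm_of_nonneg (sq_nonneg _), hv2 t (hsub ht)]
    exact h t ht
  have hol := integral_mul_le_Lp_mul_Lq_of_nonneg (μ := volume.restrict S) (f := u) (g := v)
    Real.HolderConjugate.two_two
    (ae_restrict_of_forall_mem hSm fun t ht => mul_nonneg (weight_pos _ _ (hsub ht)).le (abs_nonneg _))
    (ae_restrict_of_forall_mem hSm fun t ht => (weight_pos _ _ (hsub ht)).le)
    (by simpa using (memLp_two_iff_integrable_sq hum).2 hui)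
    (by simpa using (memLp_two_iff_integrable_sq
      (measurable_weight _ _).aestronglyMeasurable).2 hvi)
  simp only [Real.rpow_two, ← Real.sqrt_eq_rpow] at hol
  have e1 : |∫ t in (1 / 2)..x, f t| ≤ ∫ t in S, u t * v t := by
    have h1 := intervalIntegral.norm_integral_le_integral_norm_uIoc (a := 1 / 2) (b := x) (f := f)
      (μ := volume)
    rw [Real.norm_eq_abs] at h1
    refine h1.trans (le_of_eq ?_)
    exact setIntegral_congr_fun hSm fun t ht => (huv t (hsub ht)).symm
  have e2 : ∫ t in S, u t ^ 2 ≤ (weightNorm a b f).toReal ^ 2 := by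
    have h1 : ∫ t in S, u t ^ 2 = ∫ t in S, weight a b t * f t ^ 2 :=
      setIntegral_congr_fun hSm fun t ht => hu2 t (hsub ht)
    have hnn : 0 ≤ ∫ t in Ioo (0 : ℝ) 1, weight a b t * f t ^ 2 :=
      setIntegral_nonneg measurableSet_Ioo fun t ht =>
        mul_nonneg (weight_pos _ _ ht).le (sq_nonneg _)
    rw [h1, ← ENNReal.toReal_pow, ← ofReal_integral_sq hf, ENNReal.toReal_ofReal hnn]
    exact setIntegral_mono_set hfi (ae_unit_of_forall fun t ht =>
        mul_nonneg (weight_pos _ _ ht).le (sq_nonneg _)) (Filter.Eventually.of_forall hsub)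
  have e3 : ∫ t in S, v t ^ 2 ≤ c * ∫ t in Ioo (0 : ℝ) 1, q t := by
    rw [← integral_const_mul]
    refine (setIntegral_mono_on hvi ((hq.mono_measure hle).const_mul c) hSm fun t ht => ?_).trans
      (setIntegral_mono_set (hq.const_mul c) (ae_unit_of_forall fun t ht =>
        mul_nonneg hc (hq0 t ht)) (Filter.Eventually.of_forall hsub))
    rw [hv2 t (hsub ht)]
    exact h t ht
  refine e1.trans (hol.trans ?_)
  rw [mul_comm]
  refine mul_le_mul (Real.sqrt_le_sqrt e3) ?_ (Real.sqrt_nonneg _) (Real.sqrt_nonneg _)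
  rw [← Real.sqrt_sq (ENNReal.toReal_nonneg (a := weightNorm a b f))]
  exact Real.sqrt_le_sqrt e2

/-- Between `1/2` and `x` the weight of the dual norm is controlled by an integrable one. -/
lemma weight_neg_le {a b δ : ℝ} (ha : a ≤ 0) (hb : b ≤ 0) (hδ : 0 ≤ δ) {x t : ℝ}
    (hx : x ∈ Ioo (0 : ℝ) 1) (ht : t ∈ uIoc (1 / 2) x) :
    weight (-(a + 1)) (-(b + 1)) t ≤ weight (-δ) (-δ) x * weight (δ - 1) (δ - 1) t := by
  have htI : t ∈ Ioo (0 : ℝ) 1 := uIoc_subset_uIcc.trans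
    (ordConnected_Ioo.uIcc_subset (by norm_num) hx) ht
  -- A point between 1/2 and x is no closer to the end points than x, in the sense of t(1-t).
  have h1 : x * (1 - x) ≤ t * (1 - t) := by
    rcases le_total x (1 / 2) with h | h
    · rw [uIoc_of_ge h] at ht
      nlinarith [ht.1, ht.2]
    · rw [uIoc_of_le h] at ht
      nlinarith [ht.1, ht.2]
  have hw : ∀ {y : ℝ}, y ∈ Ioo (0 : ℝ) 1 → weight (-δ) (-δ) y = (y * (1 - y)) ^ (-δ) := fun {y} hy => by
    rw [weight, Real.mul_rpow hy.1.le (by linarith [hy.2]), mul_comm]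
  have h2 : weight (-δ) (-δ) t ≤ weight (-δ) (-δ) x := by
    rw [hw hx, hw htI]
    exact Real.rpow_le_rpow_of_nonpos (mul_pos hx.1 (by linarith [hx.2])) h1 (by linarith)
  calc weight (-(a + 1)) (-(b + 1)) t ≤ weight (-1) (-1) t :=
        weight_le_weight (by linarith) (by linarith) htI
    _ = weight (-δ) (-δ) t * weight (δ - 1) (δ - 1) t := by
        rw [weight_mul_weight _ _ _ _ htI]; congr 1 <;> ring
    _ ≤ _ := mul_le_mul_of_nonneg_right h2 (weight_pos _ _ htI).le

/-- The mean condition says that A is the average of Φ with respect to ω^{(a,b)} V, and τ bounds the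
corresponding average of the allowed growth. For δ = 0 that growth is 1 and τ = 1 works for every V.
-/
lemma abs_sub_le_of_mean_zero {a b δ : ℝ} (hδ : 0 ≤ δ) (ha : -1 < a - δ) (hb : -1 < b - δ)
    {V Φ : ℝ → ℝ} {A M τ Vm VM : ℝ} (hVmeas : AEStronglyMeasurable V unitMeasure)
    (hVm : 0 < Vm) (hV : ∀ x ∈ Ioo (0 : ℝ) 1, Vm ≤ V x ∧ V x ≤ VM)
    (hΦm : AEStronglyMeasurable Φ unitMeasure) (hM : 0 ≤ M)
    (hΦ : ∀ x ∈ Ioo (0 : ℝ) 1, |Φ x| ≤ M * weight (-(δ / 2)) (-(δ / 2)) x)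
    (h0 : ∫ x in Ioo (0 : ℝ) 1, weight a b x * (V x * (Φ x - A)) = 0)
    (hτ : ∫ x in Ioo (0 : ℝ) 1, weight a b x * (V x * weight (-(δ / 2)) (-(δ / 2)) x) ≤
      τ * ∫ x in Ioo (0 : ℝ) 1, weight a b x * V x) (hτ0 : 0 ≤ τ) {x : ℝ} (hx : x ∈ Ioo (0 : ℝ) 1) :
    |Φ x - A| ≤ M * (1 + τ) * weight (-(δ / 2)) (-(δ / 2)) x := by
  have hw := integrable_weight (a := a) (b := b) (by linarith) (by linarith)
  have hVb : ∀ᵐ x ∂unitMeasure, ‖V x‖ ≤ VM := ae_unit_of_forall fun x hx => by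
    rw [Real.norm_of_nonneg (hVm.le.trans (hV x hx).1)]; exact (hV x hx).2
  have hi1 : Integrable (fun x => weight a b x * V x) unitMeasure := hw.mul_bdd (c := VM) hVmeas hVb
  have hg : Integrable (fun x => weight a b x * weight (-(δ / 2)) (-(δ / 2)) x) unitMeasure :=
    (integrable_weight (a := a + -(δ / 2)) (b := b + -(δ / 2)) (by linarith) (by linarith)).congr
      (ae_unit_of_forall fun x hx => (weight_mul_weight _ _ _ _ hx).symm)
  have hi2 : Integrable (fun x => weight a b x * (V x * weight (-(δ / 2)) (-(δ / 2)) x))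
      unitMeasure := (hg.mul_bdd (c := VM) hVmeas hVb).congr
        (Filter.Eventually.of_forall fun x => by simp only; ring)
  have hbd : ∀ x ∈ Ioo (0 : ℝ) 1, ‖weight a b x * (V x * Φ x)‖ ≤
      M * (weight a b x * (V x * weight (-(δ / 2)) (-(δ / 2)) x)) := fun x hx => by
    have h1 := (weight_pos a b hx).le
    have h2 := hVm.le.trans (hV x hx).1
    rw [norm_mul, norm_mul, Real.norm_of_nonneg h1, Real.norm_of_nonneg h2, Real.norm_eq_abs]
    have := mul_le_mul_of_nonneg_left (hΦ x hx) (mul_nonneg h1 h2)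
    linarith
  have hi3 : Integrable (fun x => weight a b x * (V x * Φ x)) unitMeasure :=
    (hi2.const_mul M).mono' ((measurable_weight _ _).aestronglyMeasurable.mul (hVmeas.mul hΦm))
      (ae_unit_of_forall hbd)
  have e1 : ∫ x in Ioo (0 : ℝ) 1, weight a b x * (V x * Φ x) =
      A * ∫ x in Ioo (0 : ℝ) 1, weight a b x * V x := by
    rw [← integral_const_mul, ← sub_eq_zero, ← integral_sub hi3 (hi1.const_mul A), ← h0]
    exact integral_congr_ae (Filter.Eventually.of_forall fun x => by simp only; ring)
  have hpos : 0 < ∫ x in Ioo (0 : ℝ) 1, weight a b x * V x := by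
    have h1 : 0 < ∫ x in Ioo (0 : ℝ) 1, weight a b x * Vm := by
      rw [integral_mul_const, integral_weight (by linarith) (by linarith)]
      have := Real.Gamma_pos_of_pos (show 0 < a + 1 by linarith)
      have := Real.Gamma_pos_of_pos (show 0 < b + 1 by linarith)
      have := Real.Gamma_pos_of_pos (show 0 < a + b + 2 by linarith)
      positivity
    refine h1.trans_le (setIntegral_mono_on (hw.mul_const Vm) hi1 measurableSet_Ioo fun x hx => ?_)
    exact mul_le_mul_of_nonneg_left (hV x hx).1 (weight_pos _ _ hx).le
  have hA : |A| ≤ M * τ := by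
    refine le_of_mul_le_mul_right ?_ hpos
    have h1 := norm_integral_le_of_norm_le (hi2.const_mul M) (ae_unit_of_forall hbd)
    rw [e1, Real.norm_eq_abs, abs_mul, abs_of_pos hpos, integral_const_mul] at h1
    exact h1.trans (by rw [mul_assoc]; exact mul_le_mul_of_nonneg_left hτ hM)
  have h1 : 1 ≤ weight (-(δ / 2)) (-(δ / 2)) x := by
    rw [← weight_zero_zero x]; exact weight_le_weight (by linarith) (by linarith) hx
  have h2 := hΦ x hx
  have h3 : M * τ ≤ M * τ * weight (-(δ / 2)) (-(δ / 2)) x :=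
    le_mul_of_one_le_right (by positivity) h1
  calc |Φ x - A| ≤ |Φ x| + |A| := abs_sub _ _
    _ ≤ M * weight (-(δ / 2)) (-(δ / 2)) x + M * τ * weight (-(δ / 2)) (-(δ / 2)) x := by linarith
    _ = _ := by ring

lemma weightNorm_le_of_abs_le {a b δ M : ℝ} (ha : -1 < a - δ) (hb : -1 < b - δ) (hM : 0 ≤ M)
    {H : ℝ → ℝ} (h : ∀ x ∈ Ioo (0 : ℝ) 1, |H x| ≤ M * weight (-(δ / 2)) (-(δ / 2)) x) :
    weightNorm a b H ≤
      ENNReal.ofReal (M * Real.sqrt (∫ x in Ioo (0 : ℝ) 1, weight (a - δ) (b - δ) x)) := by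
  refine (ENNReal.pow_right_strictMono two_ne_zero).le_iff_le.1 ?_
  have hw := integrable_weight ha hb
  have hnn : 0 ≤ ∫ x in Ioo (0 : ℝ) 1, weight (a - δ) (b - δ) x :=
    setIntegral_nonneg measurableSet_Ioo fun t ht => (weight_pos _ _ ht).le
  have e : ENNReal.ofReal (M * Real.sqrt (∫ x in Ioo (0 : ℝ) 1, weight (a - δ) (b - δ) x)) ^ 2 =
      ∫⁻ x, ENNReal.ofReal (M ^ 2 * weight (a - δ) (b - δ) x) ∂unitMeasure := by
    rw [← ENNReal.ofReal_pow (by positivity), mul_pow, Real.sq_sqrt hnn, ← integral_const_mul]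
    exact ofReal_integral_eq_lintegral_ofReal (hw.const_mul _)
      (ae_unit_of_forall fun x hx => mul_nonneg (sq_nonneg _) (weight_pos _ _ hx).le)
  rw [e, weightNorm_sq]
  refine lintegral_mono_ae (ae_unit_of_forall fun x hx => ENNReal.ofReal_le_ofReal ?_)
  have h1 := weight_mul_weight (-(δ / 2)) (-(δ / 2)) (-(δ / 2)) (-(δ / 2)) hx
  have h2 := weight_mul_weight a b (-δ) (-δ) hx
  rw [show -(δ / 2) + -(δ / 2) = -δ by ring, ← sq] at h1
  rw [sub_eq_add_neg, sub_eq_add_neg, ← h2, ← h1, ← sq_abs (H x)]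
  have h3 := pow_le_pow_left₀ (abs_nonneg _) (h x hx) 2
  have h4 := mul_le_mul_of_nonneg_left h3 (weight_pos a b hx).le
  rw [mul_pow] at h4
  linarith

lemma integral_weight_pos {a b : ℝ} (ha : -1 < a) (hb : -1 < b) :
    0 < ∫ x in Ioo (0 : ℝ) 1, weight a b x := by
  rw [integral_weight ha hb]
  have := Real.Gamma_pos_of_pos (show 0 < a + 1 by linarith)
  have := Real.Gamma_pos_of_pos (show 0 < b + 1 by linarith)
  have := Real.Gamma_pos_of_pos (show 0 < a + b + 2 by linarith)
  positivity

/-- Common core of the next two results: δ measures how fast the primitive may blow up at the end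
points, and V enters the bound only through τ. -/
lemma weightNorm_primitive_le_aux {a b δ τ Vm VM A : ℝ} {f V H q : ℝ → ℝ}
    (hδ : 0 ≤ δ) (ha : -1 < a - δ) (hb : -1 < b - δ)
    (hf : MemLp f 2 (weightMeasure (a + 1) (b + 1)))
    (hfl : LocallyIntegrableOn f (Ioo (0 : ℝ) 1))
    (hq : Integrable q unitMeasure) (hq0 : ∀ t ∈ Ioo (0 : ℝ) 1, 0 ≤ q t)
    (hqw : ∀ x ∈ Ioo (0 : ℝ) 1, ∀ t ∈ uIoc (1 / 2) x,
      weight (-(a + 1)) (-(b + 1)) t ≤ weight (-δ) (-δ) x * q t)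
    (hVmeas : AEStronglyMeasurable V unitMeasure)
    (hVm : 0 < Vm) (hV : ∀ x ∈ Ioo (0 : ℝ) 1, Vm ≤ V x ∧ V x ≤ VM)
    (hH : ∀ x ∈ Ioo (0 : ℝ) 1, H x = (∫ t in (1 / 2)..x, f t) - A)
    (h0 : ∫ x in Ioo (0 : ℝ) 1, weight a b x * (V x * H x) = 0)
    (hτ : ∫ x in Ioo (0 : ℝ) 1, weight a b x * (V x * weight (-(δ / 2)) (-(δ / 2)) x) ≤
      τ * ∫ x in Ioo (0 : ℝ) 1, weight a b x * V x) (hτ0 : 0 ≤ τ) :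
    weightNorm a b H ≤ ENNReal.ofReal (Real.sqrt (∫ t in Ioo (0 : ℝ) 1, q t) * (1 + τ) *
      Real.sqrt (∫ x in Ioo (0 : ℝ) 1, weight (a - δ) (b - δ) x)) *
        weightNorm (a + 1) (b + 1) f := by
  set N := (weightNorm (a + 1) (b + 1) f).toReal with hN
  have hΦ : ∀ x ∈ Ioo (0 : ℝ) 1, |∫ t in (1 / 2)..x, f t| ≤
      Real.sqrt (∫ t in Ioo (0 : ℝ) 1, q t) * N * weight (-(δ / 2)) (-(δ / 2)) x := by
    intro x hx
    refine (abs_integral_le_weightNorm hf hq hq0 hx (weight_pos _ _ hx).le (hqw x hx)).trans ?_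
    have h1 := weight_mul_weight (-(δ / 2)) (-(δ / 2)) (-(δ / 2)) (-(δ / 2)) hx
    rw [show -(δ / 2) + -(δ / 2) = -δ by ring, ← sq] at h1
    rw [← h1, Real.sqrt_mul (sq_nonneg _), Real.sqrt_sq (weight_pos _ _ hx).le]
    exact le_of_eq (by ring)
  have hc : (1 / 2 : ℝ) ∈ Ioo (0 : ℝ) 1 := by norm_num
  have hΦm : AEStronglyMeasurable (fun x => ∫ t in (1 / 2)..x, f t) unitMeasure := by
    have := (isPrimitive_integral hfl hc 0).continuousOn.aestronglyMeasurable
      (μ := volume) measurableSet_Ioo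
    simpa using this
  have h0' : ∫ x in Ioo (0 : ℝ) 1, weight a b x * (V x * ((∫ t in (1 / 2)..x, f t) - A)) = 0 := by
    refine (setIntegral_congr_fun measurableSet_Ioo fun x hx => ?_).trans h0
    rw [hH x hx]
  have hb' := fun x hx => abs_sub_le_of_mean_zero hδ ha hb hVmeas hVm hV hΦm (by positivity) hΦ
    h0' hτ hτ0 (x := x) hx
  refine (weightNorm_le_of_abs_le ha hb (M := Real.sqrt (∫ t in Ioo (0 : ℝ) 1, q t) * N * (1 + τ))
    (by positivity) fun x hx => by rw [hH x hx]; exact hb' x hx).trans (le_of_eq ?_)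
  have hfin : weightNorm (a + 1) (b + 1) f = ENNReal.ofReal N :=
    (ENNReal.ofReal_toReal hf.2.ne).symm
  rw [hfin, ← ENNReal.ofReal_mul (by positivity)]
  congr 1
  ring

/-- The primitive with vanishing weighted mean, for weights with negative exponents. -/
lemma weightNorm_primitive_le_of_neg {a b : ℝ} (ha : -1 < a) (hb : -1 < b) (ha0 : a < 0)
    (hb0 : b < 0) : ∃ D : ℝ, 0 < D ∧ ∀ {Vm VM A : ℝ} {f V H : ℝ → ℝ},
      MemLp f 2 (weightMeasure (a + 1) (b + 1)) → LocallyIntegrableOn f (Ioo (0 : ℝ) 1) →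
      AEStronglyMeasurable V unitMeasure → 0 < Vm →
      (∀ x ∈ Ioo (0 : ℝ) 1, Vm ≤ V x ∧ V x ≤ VM) →
      (∀ x ∈ Ioo (0 : ℝ) 1, H x = (∫ t in (1 / 2)..x, f t) - A) →
      ∫ x in Ioo (0 : ℝ) 1, weight a b x * (V x * H x) = 0 →
      weightNorm a b H ≤ ENNReal.ofReal D * weightNorm (a + 1) (b + 1) f := by
  have h1 := integral_weight_pos ha hb
  have h2 := integral_weight_pos (a := -(a + 1)) (b := -(b + 1)) (by linarith) (by linarith)
  -- For negative exponents the dual weight ω^{(-(a+1),-(b+1))} is integrable, so it can serve as q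
  -- with δ = 0 and τ = 1; neither `Vm` nor `VM` enters.
  refine ⟨_, ?_, fun {Vm VM A f V H} hf hfl hVmeas hVm hV hH h0 => weightNorm_primitive_le_aux
    (δ := 0) (τ := 1) le_rfl (by linarith) (by linarith) hf hfl
    (integrable_weight (a := -(a + 1)) (b := -(b + 1)) (by linarith) (by linarith))
    (fun t ht => (weight_pos _ _ ht).le) (fun x _ t _ => ?_) hVmeas hVm hV hH h0 ?_ zero_le_one⟩
  · rw [sub_zero, sub_zero]; positivity
  · rw [neg_zero, weight_zero_zero, one_mul]
  · simp [weight_zero_zero]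

/-- The primitive with vanishing weighted mean. -/
lemma weightNorm_primitive_le {a b : ℝ} (ha : -1 < a) (hb : -1 < b) (ha0 : a ≤ 0)
    (hb0 : b ≤ 0) (hab : 0 < a + b + 1) : ∃ D : ℝ, 0 < D ∧ ∀ {Vm VM A : ℝ} {f V H : ℝ → ℝ},
      MemLp f 2 (weightMeasure (a + 1) (b + 1)) → LocallyIntegrableOn f (Ioo (0 : ℝ) 1) →
      AEStronglyMeasurable V unitMeasure → 0 < Vm →
      (∀ x ∈ Ioo (0 : ℝ) 1, Vm ≤ V x ∧ V x ≤ VM) →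
      (∀ x ∈ Ioo (0 : ℝ) 1, H x = (∫ t in (1 / 2)..x, f t) - A) →
      ∫ x in Ioo (0 : ℝ) 1, weight a b x * (V x * H x) = 0 →
      weightNorm a b H ≤ ENNReal.ofReal (D * (1 + |VM / Vm|)) * weightNorm (a + 1) (b + 1) f := by
  -- Positive, so that ω^{(δ-1,δ-1)} is integrable, and small enough that a - δ and b - δ stay above
  -- -1: for instance a - δ = (a - b - 1)/2 with a > -1 and b ≤ 0.
  set δ := (a + b + 1) / 2 with hδ
  have ha' : -1 < a - δ := by linarith
  have hb' : -1 < b - δ := by linarith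
  have h1 := integral_weight_pos ha' hb'
  have h2 := integral_weight_pos (a := δ - 1) (b := δ - 1) (by linarith) (by linarith)
  have h3 := integral_weight_pos ha hb
  have hh := integrable_weight (a := a + -(δ / 2)) (b := b + -(δ / 2)) (by linarith) (by linarith)
  have h4 := integral_weight_pos (a := a + -(δ / 2)) (b := b + -(δ / 2)) (by linarith) (by linarith)
  set W := ∫ x in Ioo (0 : ℝ) 1, weight a b x with hW
  set W' := ∫ x in Ioo (0 : ℝ) 1, weight (a + -(δ / 2)) (b + -(δ / 2)) x with hW'
  set Q := ∫ x in Ioo (0 : ℝ) 1, weight (δ - 1) (δ - 1) x with hQ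
  set R := ∫ x in Ioo (0 : ℝ) 1, weight (a - δ) (b - δ) x with hR
  refine ⟨Real.sqrt Q * Real.sqrt R * (1 + W' / W), by positivity,
    fun {Vm VM A f V H} hf hfl hVmeas hVm hV hH h0 => ?_⟩
  have hVM : 0 < VM := hVm.trans_le ((hV (1 / 2) (by norm_num)).1.trans
    (hV (1 / 2) (by norm_num)).2)
  have h5 := weightNorm_primitive_le_aux
    (δ := δ) (τ := VM / Vm * (W' / W)) (by linarith) ha' hb' hf hfl
    (integrable_weight (a := δ - 1) (b := δ - 1) (by linarith) (by linarith))
    (fun t ht => (weight_pos _ _ ht).le)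
    (fun x hx t ht => weight_neg_le ha0 hb0 (by linarith) hx ht) hVmeas hVm hV hH h0 ?_
    (by positivity)
  · refine h5.trans (mul_le_mul_left (ENNReal.ofReal_le_ofReal ?_) _)
    rw [abs_of_pos (by positivity)]
    have h6 : 1 + VM / Vm * (W' / W) ≤ (1 + W' / W) * (1 + VM / Vm) := by
      have : 0 < VM / Vm := by positivity
      have : 0 < W' / W := by positivity
      nlinarith
    calc _ = Real.sqrt Q * Real.sqrt R * (1 + VM / Vm * (W' / W)) := by ring
      _ ≤ Real.sqrt Q * Real.sqrt R * ((1 + W' / W) * (1 + VM / Vm)) :=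
        mul_le_mul_of_nonneg_left h6 (by positivity)
      _ = _ := by ring
  · have hw := integrable_weight ha hb
    have hVb : ∀ᵐ x ∂unitMeasure, ‖V x‖ ≤ VM := ae_unit_of_forall fun x hx => by
      rw [Real.norm_of_nonneg (hVm.le.trans (hV x hx).1)]; exact (hV x hx).2
    have i1 : Integrable (fun x => weight a b x * V x) unitMeasure :=
      hw.mul_bdd (c := VM) hVmeas hVb
    have e1 : ∫ x in Ioo (0 : ℝ) 1, weight a b x * (V x * weight (-(δ / 2)) (-(δ / 2)) x) ≤
        VM * W' := by
      rw [hW', ← integral_const_mul]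
      refine integral_mono_of_nonneg (ae_unit_of_forall fun x hx => ?_) (hh.const_mul VM)
        (ae_unit_of_forall fun x hx => ?_)
      · have := hVm.le.trans (hV x hx).1
        have := (weight_pos a b hx).le
        have := (weight_pos (-(δ / 2)) (-(δ / 2)) hx).le
        simp only [Pi.zero_apply]
        positivity
      · beta_reduce
        rw [← weight_mul_weight _ _ _ _ hx]
        have := (mul_pos (weight_pos a b hx) (weight_pos (-(δ / 2)) (-(δ / 2)) hx)).le
        have := mul_le_mul_of_nonneg_right (hV x hx).2 this
        linarith
    have e2 : Vm * W ≤ ∫ x in Ioo (0 : ℝ) 1, weight a b x * V x := by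
      rw [hW, ← integral_const_mul]
      refine setIntegral_mono_on (hw.const_mul Vm) i1 measurableSet_Ioo fun x hx => ?_
      have := mul_le_mul_of_nonneg_left (hV x hx).1 (weight_pos a b hx).le
      linarith
    refine e1.trans (le_trans (le_of_eq ?_) (mul_le_mul_of_nonneg_left e2 (by positivity)))
    field_simp

/-! ### Parameters and eigenvalues of the boundary value problem -/

lemma sin_pi_mul_nonneg {x : ℝ} (h0 : 0 ≤ x) (h1 : x ≤ 1) : 0 ≤ Real.sin (Real.pi * x) :=
  Real.sin_nonneg_of_nonneg_of_le_pi (by have := Real.pi_pos; positivity)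
    (mul_le_of_le_one_right Real.pi_pos.le h1)

lemma sin_pi_mul_pos {x : ℝ} (h0 : 0 < x) (h1 : x < 1) : 0 < Real.sin (Real.pi * x) :=
  Real.sin_pos_of_pos_of_lt_pi (by have := Real.pi_pos; positivity)
    (mul_lt_of_lt_one_right Real.pi_pos h1)

lemma sin_pi_mul_sub_one (x : ℝ) : Real.sin (Real.pi * (x - 1)) = -Real.sin (Real.pi * x) := by
  rw [mul_sub, mul_one, Real.sin_sub_pi]

lemma sin_add_sin_pos {α β : ℝ} (hα : 1 < α ∧ α < 2) (hβ : α - 1 ≤ β ∧ β ≤ 1) :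
    0 < Real.sin (Real.pi * (α - β)) + Real.sin (Real.pi * β) := by
  have h1 := sin_pi_mul_nonneg (x := α - β) (by linarith) (by linarith)
  have h2 := sin_pi_mul_nonneg (x := β) (by linarith) (by linarith)
  rcases lt_or_eq_of_le hβ.2 with h | h
  · have := sin_pi_mul_pos (x := β) (by linarith) h
    linarith
  · have := sin_pi_mul_pos (x := α - β) (by linarith) (by linarith)
    linarith

lemma fracParams_of {α r β : ℝ} (hα : 1 < α ∧ α < 2) (hβ : α - 1 ≤ β ∧ β ≤ 1)
    (hrβ : r = Real.sin (Real.pi * β) /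
      (Real.sin (Real.pi * (α - β)) + Real.sin (Real.pi * β))) :
    FracParams r (β - 1) (α - β - 1) (2 - α) where
  ha := by linarith
  ha0 := by linarith
  hb := by linarith
  hb0 := by linarith
  sum := by ring
  pos := by linarith
  lt_one := by linarith
  sin_ne := by
    have := sin_add_sin_pos hα hβ
    rw [sin_pi_mul_sub_one, sin_pi_mul_sub_one]
    linarith
  hr := by
    rw [hrβ, sin_pi_mul_sub_one, sin_pi_mul_sub_one, ← neg_add, neg_div_neg_eq, add_comm]

/-- The reflection formula at α - 1 exchanges π/Γ(2-α) for Γ(α-1) times a sine, and Γ(i+α) is a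
rising factorial of length i + 1 times Γ(α-1). -/
lemma eigenval_eq {α β : ℝ} (hα : 1 < α ∧ α < 2) (hβ : α - 1 ≤ β ∧ β ≤ 1) (i : ℕ) :
    eigenval α β i = -(i + 1) * fracEigen (β - 1) (α - β - 1) (2 - α) (i + 1) := by
  have hS := (sin_add_sin_pos hα hβ).ne'
  have h1 := Real.Gamma_mul_Gamma_one_sub (α - 1)
  rw [sin_pi_mul_sub_one, show 1 - (α - 1) = 2 - α by ring] at h1
  have h2 := Real.Gamma_pos_of_pos (show 0 < 2 - α by linarith)
  have hs : Real.sin (Real.pi * α) ≠ 0 := by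
    have := sin_pi_mul_pos (x := α - 1) (by linarith) (by linarith)
    rw [sin_pi_mul_sub_one] at this
    linarith
  have h3 := Gamma_add_nat (show 0 < α - 1 by linarith) (i + 1)
  rw [show α - 1 + ((i + 1 : ℕ) : ℝ) = i + α by push_cast; ring] at h3
  have h4 : Real.Gamma (α - 1) = Real.pi / (-Real.sin (Real.pi * α)) / Real.Gamma (2 - α) := by
    rw [eq_div_iff h2.ne', h1]
  rw [eigenval, fracEigen, sin_pi_mul_sub_one, sin_pi_mul_sub_one, h3, h4,
    show 1 - (2 - α) = α - 1 by ring, Nat.factorial_succ]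
  have hf : (i ! : ℝ) ≠ 0 := by positivity
  have hi : (i + 1 : ℝ) ≠ 0 := by positivity
  have hS' : -Real.sin (Real.pi * β) + -Real.sin (Real.pi * (α - β)) ≠ 0 := by
    rw [← neg_add, neg_ne_zero, add_comm]; exact hS
  rw [show -Real.sin (Real.pi * β) + -Real.sin (Real.pi * (α - β)) =
    -(Real.sin (Real.pi * (α - β)) + Real.sin (Real.pi * β)) by ring]
  push_cast
  field_simp

/-- Log-convexity of Γ at i + 2 = (α-1)(i+α) + (2-α)(i+α+1) gives (i+1)! ≤ (i+α)^{2-α} Γ(i+α). The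
1/2 comes from i + α ≤ 2(i + 1). -/
lemma Gamma_div_factorial_ge {α : ℝ} (hα : 1 < α ∧ α < 2) (i : ℕ) :
    1 / 2 * ((i : ℝ) + 1) ^ (α - 1) ≤ Real.Gamma (i + α) / i ! := by
  have hi := i.cast_nonneg (α := ℝ)
  have hs : 0 < (i : ℝ) + α := by linarith
  have h1 := Real.Gamma_mul_add_mul_le_rpow_Gamma_mul_rpow_Gamma hs (show 0 < (i : ℝ) + α + 1 by linarith)
    (show 0 < α - 1 by linarith) (show 0 < 2 - α by linarith) (by ring)
  have hG := Real.Gamma_pos_of_pos hs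
  rw [show (α - 1) * ((i : ℝ) + α) + (2 - α) * (i + α + 1) = ((i + 1 : ℕ) : ℝ) + 1 by push_cast; ring,
    Real.Gamma_nat_eq_factorial, Real.Gamma_add_one hs.ne', Real.mul_rpow hs.le hG.le,
    mul_left_comm, ← Real.rpow_add hG, show α - 1 + (2 - α) = 1 by ring, Real.rpow_one] at h1
  have hf : (0 : ℝ) < i ! := by positivity
  rw [le_div_iff₀ hf]
  have hi1 : (0 : ℝ) < i + 1 := by positivity
  have h2 : ((i : ℝ) + α) ^ (2 - α) ≤ 2 * ((i : ℝ) + 1) ^ (2 - α) := by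
    calc ((i : ℝ) + α) ^ (2 - α) ≤ (2 * ((i : ℝ) + 1)) ^ (2 - α) :=
          Real.rpow_le_rpow hs.le (by linarith) (by linarith)
      _ = 2 ^ (2 - α) * ((i : ℝ) + 1) ^ (2 - α) := Real.mul_rpow (by norm_num) hi1.le
      _ ≤ 2 * ((i : ℝ) + 1) ^ (2 - α) := by
          refine mul_le_mul_of_nonneg_right ?_ (by positivity)
          calc (2 : ℝ) ^ (2 - α) ≤ 2 ^ (1 : ℝ) :=
                Real.rpow_le_rpow_of_exponent_le (by norm_num) (by linarith)
            _ = 2 := Real.rpow_one 2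
  have h3 : ((i : ℝ) + 1) ^ (α - 1) * ((i : ℝ) + 1) ^ (2 - α) = i + 1 := by
    rw [← Real.rpow_add hi1, show α - 1 + (2 - α) = 1 by ring, Real.rpow_one]
  rw [Nat.factorial_succ] at h1
  push_cast at h1
  have hp : 0 < ((i : ℝ) + 1) ^ (2 - α) := by positivity
  refine le_of_mul_le_mul_left ?_ hp
  calc ((i : ℝ) + 1) ^ (2 - α) * (1 / 2 * ((i : ℝ) + 1) ^ (α - 1) * i !)
      = 1 / 2 * ((((i : ℝ) + 1) ^ (α - 1) * ((i : ℝ) + 1) ^ (2 - α)) * i !) := by ring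
    _ = 1 / 2 * ((i + 1) * i !) := by rw [h3]
    _ ≤ 1 / 2 * (((i : ℝ) + α) ^ (2 - α) * Real.Gamma (i + α)) :=
        mul_le_mul_of_nonneg_left h1 (by norm_num)
    _ ≤ 1 / 2 * (2 * ((i : ℝ) + 1) ^ (2 - α) * Real.Gamma (i + α)) := by gcongr
    _ = ((i : ℝ) + 1) ^ (2 - α) * Real.Gamma (i + α) := by ring

lemma exists_eigenval_lower {α β : ℝ} (hα : 1 < α ∧ α < 2) (hβ : α - 1 ≤ β ∧ β ≤ 1) :
    ∃ κ : ℝ, 0 < κ ∧ ∀ i : ℕ, κ * ((i : ℝ) + 1) ^ (α - 1) ≤ |eigenval α β i| := by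
  have hS := sin_add_sin_pos hα hβ
  have hs := sin_pi_mul_pos (x := α - 1) (by linarith) (by linarith)
  rw [sin_pi_mul_sub_one] at hs
  have hs' : 0 < |Real.sin (Real.pi * α)| := abs_pos.2 (by linarith)
  refine ⟨|Real.sin (Real.pi * α)| / (Real.sin (Real.pi * (α - β)) + Real.sin (Real.pi * β)) *
    (1 / 2), by positivity, fun i => ?_⟩
  have h1 := Gamma_div_factorial_ge hα i
  have h2 : 0 ≤ Real.Gamma (i + α) / i ! := le_trans (by positivity) h1
  rw [eigenval, abs_mul, abs_div, abs_of_pos hS, abs_of_nonneg h2, mul_assoc]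
  exact mul_le_mul_of_nonneg_left h1 (by positivity)

/-! ### The coefficients of the solution -/

/-- Adjointness moves the operator onto ω^{(a,b)} G_n, where the eigenvalue relation applies. -/
lemma FracParams.weightInner_source {r a b σ : ℝ} (h : FracParams r a b σ) {w F : ℝ → ℝ}
    (hw : Integrable w unitMeasure) (hF : ∀ᵐ x ∂unitMeasure, -fracOp r σ w x = F x) (n : ℕ) :
    weightInner a b F (jacobiG n a b) =
      -(fracEigen a b σ n * ∫ x in Ioo (0 : ℝ) 1, w x * jacobiG n b a x) := by
  obtain ⟨-, -, h3⟩ := h.adjoint hw (continuous_jacobiG n a b).continuousOn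
  have e1 : ∫ x in Ioo (0 : ℝ) 1, w x * fracOp (1 - r) σ (fun t => weight a b t * jacobiG n a b t) x =
      fracEigen a b σ n * ∫ x in Ioo (0 : ℝ) 1, w x * jacobiG n b a x := by
    rw [← integral_const_mul]
    refine integral_congr_ae ?_
    filter_upwards [h.fracOp_jacobi n] with x hx
    rw [hx]; ring
  rw [← e1, ← h3, weightInner, ← integral_neg]
  refine integral_congr_ae ?_
  filter_upwards [hF] with x hx
  rw [← hx]; ring

lemma integral_jacobi_by_parts {a b : ℝ} {w u : ℝ → ℝ} (hw : Integrable w unitMeasure)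
    (hu : ∀ x ∈ Icc (0 : ℝ) 1, u x = ∫ t in Ioo (0 : ℝ) x, w t) (hu1 : u 1 = 0) (i : ℕ) :
    ∫ x in Ioo (0 : ℝ) 1, w x * jacobiG (i + 1) b a x =
      -((i + a + b + 2) * ∫ x in Ioo (0 : ℝ) 1, u x * jacobiG i (b + 1) (a + 1) x) := by
  have hu' : ∀ x ∈ uIcc (0 : ℝ) 1, u x = u 0 + ∫ t in (0)..x, w t := fun x hx => by
    rw [uIcc_of_le zero_le_one] at hx
    rw [hu x hx, hu 0 (by simp), intervalIntegral.integral_of_le hx.1, integral_Ioc_eq_integral_Ioo]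
    simp
  have hu0 : u 0 = 0 := by rw [hu 0 (by simp)]; simp
  have hwi : IntervalIntegrable w volume 0 1 := by
    rw [intervalIntegrable_iff_integrableOn_Ioo_of_le zero_le_one]; exact hw
  set p := jacobiPoly (i + 1) b a with hp
  have hpi := p.derivative.continuous.intervalIntegrable (μ := volume) 0 1
  have h := integral_by_parts_primitive (g := fun x => p.eval x) (g' := fun x => p.derivative.eval x)
    hwi hpi hu' fun x _ => by
      rw [intervalIntegral.integral_eq_sub_of_hasDerivAt (fun t _ => p.hasDerivAt t)
        (p.derivative.continuous.intervalIntegrable 0 x)]; ring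
  have huc : ContinuousOn u (uIcc 0 1) := by
    refine ContinuousOn.congr ?_ hu'
    exact continuousOn_const.add (intervalIntegral.continuousOn_primitive_interval' hwi
      left_mem_uIcc)
  have hui : IntervalIntegrable (fun x => u x * p.derivative.eval x) volume 0 1 :=
    (huc.mul p.derivative.continuous.continuousOn).intervalIntegrable
  rw [hu1, hu0, intervalIntegral.integral_add (hwi.mul_continuousOn p.continuous.continuousOn)
    hui] at h
  rw [intervalIntegral.integral_of_le zero_le_one, intervalIntegral.integral_of_le zero_le_one,
    integral_Ioc_eq_integral_Ioo, integral_Ioc_eq_integral_Ioo] at h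
  rw [hp, derivative_jacobiPoly_succ] at h
  simp only [eval_jacobiPoly, Polynomial.eval_mul, Polynomial.eval_C] at h
  rw [← integral_const_mul]
  have e : ∀ x, u x * ((i + b + a + 2) * jacobiG i (b + 1) (a + 1) x) =
      (i + a + b + 2) * (u x * jacobiG i (b + 1) (a + 1) x) := fun x => by ring
  simp only [e] at h
  linarith

lemma FracParams.fracEigen_ne_zero {r a b σ : ℝ} (h : FracParams r a b σ) (n : ℕ) :
    fracEigen a b σ n ≠ 0 := by
  have h1 := h.sin_ne
  have h2 := (Real.Gamma_pos_of_pos h.pos).ne'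
  have h3 := (poch_pos (show 0 < 1 - σ by linarith [h.lt_one]) n).ne'
  have h4 : (n ! : ℝ) ≠ 0 := by positivity
  have h5 := Real.pi_ne_zero
  rw [fracEigen]
  exact mul_ne_zero (div_ne_zero (neg_ne_zero.2 h5) (mul_ne_zero h1 h2)) (div_ne_zero h3 h4)

/-- The case n = 0 of the previous relation, with ∫ w = u(1) = 0. This is the condition that fixes
the flux constant. -/
lemma FracParams.mean_zero {r a b σ : ℝ} (h : FracParams r a b σ) {w u F : ℝ → ℝ}
    (hw : Integrable w unitMeasure) (hF : ∀ᵐ x ∂unitMeasure, -fracOp r σ w x = F x)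
    (hu : ∀ x ∈ Icc (0 : ℝ) 1, u x = ∫ t in Ioo (0 : ℝ) x, w t) (hu1 : u 1 = 0) :
    ∫ x in Ioo (0 : ℝ) 1, weight a b x * F x = 0 := by
  have h1 := h.weightInner_source hw hF 0
  have e : ∀ a b : ℝ, jacobiG 0 a b = fun _ => 1 := fun a b => by
    rw [jacobiG_eq_eval, jacobiPoly_zero]; simp
  rw [e, e] at h1
  simp only [weightInner, mul_one, ← hu 1 (by simp), hu1] at h1
  simpa using h1

/-- The Jacobi coefficients of the solution. -/
lemma FracParams.integral_solution_jacobi {r a b σ : ℝ} (h : FracParams r a b σ) {w u F : ℝ → ℝ}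
    (hw : Integrable w unitMeasure) (hF : ∀ᵐ x ∂unitMeasure, -fracOp r σ w x = F x)
    (hu : ∀ x ∈ Icc (0 : ℝ) 1, u x = ∫ t in Ioo (0 : ℝ) x, w t) (hu1 : u 1 = 0) (i : ℕ) :
    ∫ x in Ioo (0 : ℝ) 1, u x * jacobiG i (b + 1) (a + 1) x =
      -(weightInner a b F (jacobiG (i + 1) a b) / jacobiNormSq (i + 1) a b /
        (-(i + 1) * fracEigen a b σ (i + 1))) * jacobiNormSq i (b + 1) (a + 1) := by
  have h1 := h.weightInner_source hw hF (i + 1)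
  rw [integral_jacobi_by_parts hw hu hu1] at h1
  have h2 := jacobiNormSq_succ h.ha h.hb i
  rw [jacobiNormSq_swap i (a + 1) (b + 1), h1]
  have h3 := h.fracEigen_ne_zero (i + 1)
  have h4 := (jacobiNormSq_pos (i + 1) h.ha h.hb).ne'
  have h5 : (i + 1 : ℝ) ≠ 0 := by positivity
  set μ := fracEigen a b σ (i + 1)
  set I := ∫ x in Ioo (0 : ℝ) 1, u x * jacobiG i (b + 1) (a + 1) x
  set k := jacobiNormSq (i + 1) a b
  field_simp
  linear_combination I * h2

/-! ### The spectral error -/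

/-- For a + b > -2 the leading coefficients are positive, so the Jacobi polynomials span: leading
terms can be removed one degree at a time. -/
lemma polynomial_induction_jacobi {a b : ℝ} (hab : -2 < a + b) (L : Polynomial ℝ →ₗ[ℝ] ℝ)
    (h : ∀ n, L (jacobiPoly n a b) = 0) (p : Polynomial ℝ) : L p = 0 := by
  have key : ∀ n, ∀ p : Polynomial ℝ, p.natDegree < n → L p = 0 := by
    intro n
    induction n with
    | zero => intro p hp; omega
    | succ n ih =>
      intro p hp
      have hc := coeff_jacobiPoly_pos n a b hab
      set t := p.coeff n / (jacobiPoly n a b).coeff n with ht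
      set q := p - Polynomial.C t * jacobiPoly n a b with hq
      have hq0 : L q = 0 := by
        rcases Nat.eq_zero_or_pos n with rfl | hn
        · have : q = 0 := by
            rw [hq, jacobiPoly_zero, ht, jacobiPoly_zero]
            rw [Polynomial.eq_C_of_natDegree_le_zero (show p.natDegree ≤ 0 by omega)]
            simp
          rw [this, map_zero]
        · refine ih q ?_
          have h1 : q.natDegree ≤ n := (Polynomial.natDegree_sub_le _ _).trans (max_le (by omega)
            ((Polynomial.natDegree_C_mul_le _ _).trans (natDegree_jacobiPoly_le n a b)))
          refine lt_of_le_of_ne h1 fun h2 => ?_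
          have h3 : q.coeff n = 0 := by
            rw [hq, Polynomial.coeff_sub, Polynomial.coeff_C_mul, ht, div_mul_cancel₀ _ hc.ne',
              sub_self]
          rw [← h2] at h3
          have h4 := Polynomial.leadingCoeff_eq_zero.1 h3
          rw [h4] at h2
          simp at h2
          omega
      have e : p = q + t • jacobiPoly n a b := by
        rw [hq, Polynomial.smul_eq_C_mul]; ring
      rw [e, map_add, map_smul, hq0, h n]; simp
  exact key _ p (Nat.lt_succ_self _)

lemma ae_eq_zero_of_jacobi {a b : ℝ} (hab : -2 < a + b) {g : ℝ → ℝ} (hg : Integrable g unitMeasure)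
    (h : ∀ n, ∫ x in Ioo (0 : ℝ) 1, g x * jacobiG n a b x = 0) :
    ∀ᵐ x ∂unitMeasure, g x = 0 := by
  have hi : ∀ p : Polynomial ℝ, Integrable (fun x => g x * p.eval x) unitMeasure := fun p =>
    integrable_mul_continuousOn hg p.continuous.continuousOn
  let L : Polynomial ℝ →ₗ[ℝ] ℝ :=
    { toFun := fun p => ∫ x in Ioo (0 : ℝ) 1, g x * p.eval x
      map_add' := fun p q => by
        simp only [Polynomial.eval_add, mul_add]
        exact integral_add (hi p) (hi q)
      map_smul' := fun c p => by
        simp only [Polynomial.eval_smul, smul_eq_mul, RingHom.id_apply, mul_left_comm _ c]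
        exact integral_const_mul _ _ }
  refine ae_eq_zero_of_moments hg fun p => ?_
  exact polynomial_induction_jacobi hab L (fun n => by
    change ∫ x in Ioo (0 : ℝ) 1, g x * (jacobiPoly n a b).eval x = 0
    simpa only [eval_jacobiPoly] using h n) p

/-- Because ω^{-1}(ωz)² = ωz², the error norm of the theorem is an ordinary weighted L² norm of u/ω
minus its partial sum. -/
lemma weightNorm_weight_mul (a b : ℝ) (z : ℝ → ℝ) :
    weightNorm (-a) (-b) (fun x => weight a b x * z x) = weightNorm a b z := by
  refine (ENNReal.pow_right_strictMono two_ne_zero).injective ?_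
  rw [weightNorm_sq, weightNorm_sq]
  refine lintegral_congr_ae (ae_unit_of_forall fun x hx => ?_)
  beta_reduce
  have h := weight_mul_weight (-a) (-b) a b hx
  rw [neg_add_cancel, neg_add_cancel, weight_zero_zero] at h
  congr 1
  linear_combination (weight a b x * z x ^ 2) * h

lemma le_ofReal_mul_of_toReal_le {x y : ℝ≥0∞} {D : ℝ} (hx : x ≠ ⊤) (hy : y ≠ ⊤) (hD : 0 ≤ D)
    (h : x.toReal ≤ D * y.toReal) : x ≤ ENNReal.ofReal D * y := by
  rw [← ENNReal.ofReal_toReal hx, ← ENNReal.ofReal_toReal hy, ← ENNReal.ofReal_mul hD]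
  exact ENNReal.ofReal_le_ofReal h

/-- The truncation error of the spectral approximation, in terms of the `m`-th derivative of the
source. -/
lemma FracParams.spectral_error {r a b σ : ℝ} (h : FracParams r a b σ) {w u : ℝ → ℝ}
    {F : ℕ → ℝ → ℝ} (hw : Integrable w unitMeasure)
    (hF0 : ∀ᵐ x ∂unitMeasure, -fracOp r σ w x = F 0 x)
    (hu : ∀ x ∈ Icc (0 : ℝ) 1, u x = ∫ t in Ioo (0 : ℝ) x, w t) (hu1 : u 1 = 0)
    {m N : ℕ} (hF : ∀ k < m, IsWeakDeriv 1 (F k) (F (k + 1)))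
    (hm : ∀ k ≤ m, MemLp (F k) 2 (weightMeasure (a + k) (b + k))) {κ p : ℝ} (hκ : 0 < κ)
    (hp : 0 ≤ p) {lam c : ℕ → ℝ} (hlam : ∀ i, lam i = -(i + 1) * fracEigen a b σ (i + 1))
    (hc : ∀ i, c i =
      -(weightInner a b (F 0) (jacobiG (i + 1) a b) / jacobiNormSq (i + 1) a b / lam i))
    (hlow : ∀ i : ℕ, κ * ((i : ℝ) + 1) ^ p ≤ |lam i|) (hN : m ≤ N + 2) :
    weightNorm (-(b + 1)) (-(a + 1)) (fun x => u x - weight (b + 1) (a + 1) x *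
        ∑ i ∈ Finset.range (N + 1), c i * jacobiG i (b + 1) (a + 1) x) ≤
      ENNReal.ofReal ((m + 1) ^ m / (κ * ((N : ℝ) + 1) ^ p * (N + 1) ^ m)) *
        weightNorm (a + m) (b + m) (F m) := by
  have ha := h.ha
  have hb := h.hb
  have hab : 0 ≤ a + b + 1 := by linarith [h.sum, h.lt_one]
  have hlow' : ∀ N i : ℕ, N + 1 ≤ i → κ * ((N : ℝ) + 1) ^ p ≤ |lam i| := fun N i hi => by
    refine le_trans (mul_le_mul_of_nonneg_left (Real.rpow_le_rpow (by positivity) ?_ hp) hκ.le)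
      (hlow i)
    have : (N : ℝ) + 1 ≤ i := by exact_mod_cast hi
    linarith
  have hint : ∀ k ≤ m, Integrable (fun x => weight (a + k) (b + k) x * F k x) unitMeasure :=
    fun k hk => by
      have hk0 := k.cast_nonneg (α := ℝ)
      have := isFiniteMeasure_weightMeasure (show -1 < a + k by linarith)
        (show -1 < b + k by linarith)
      exact integrable_weightMeasure_iff.1 ((hm k hk).integrable (by norm_num))
  have hterm : ∀ i, c i ^ 2 * jacobiNormSq i (b + 1) (a + 1) =
      (weightInner a b (F 0) (jacobiG (i + 1) a b) / jacobiNormSq (i + 1) a b / lam i) ^ 2 *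
        jacobiNormSq i (a + 1) (b + 1) := fun i => by
    rw [hc, neg_sq, jacobiNormSq_swap i (a + 1) (b + 1)]
  -- Square summability needs only the case without derivatives. The tail estimate starts at index
  -- 1, so index 0 is split off.
  obtain ⟨B, hB⟩ : ∃ B, ∀ s : Finset ℕ, ∑ n ∈ s, c n ^ 2 * jacobiNormSq n (b + 1) (a + 1) ≤ B := by
    have hT := fun (s : Finset ℕ) (hs : ∀ i ∈ s, 0 + 1 ≤ i) =>
      jacobi_tail_le ha hb hab (F := F) (m := 0) (fun k hk => by omega)
        (fun k hk => by obtain rfl : k = 0 := by omega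
                        exact hint 0 (Nat.zero_le _)) (hm 0 (Nat.zero_le _)) (N := 0)
        (by positivity) (hlow' 0) (by omega) s hs
    simp only [← hterm] at hT
    have h1 : ∀ s : Finset ℕ, ∑ n ∈ s, c n ^ 2 * jacobiNormSq n (b + 1) (a + 1) ≤
        c 0 ^ 2 * jacobiNormSq 0 (b + 1) (a + 1) +
          ∑ n ∈ (insert 0 s).erase 0, c n ^ 2 * jacobiNormSq n (b + 1) (a + 1) := fun s => by
      rw [Finset.add_sum_erase _ (fun n => c n ^ 2 * jacobiNormSq n (b + 1) (a + 1))
        (Finset.mem_insert_self 0 s)]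
      exact Finset.sum_le_sum_of_subset_of_nonneg (Finset.subset_insert _ _) fun i _ _ =>
        mul_nonneg (sq_nonneg _) (jacobiNormSq_pos i (by linarith) (by linarith)).le
    exact ⟨_, fun s => (h1 s).trans (add_le_add le_rfl (hT _ fun i hi => by
      have := Finset.ne_of_mem_erase hi; omega))⟩
  obtain ⟨v, hv, hvc, hvt⟩ := exists_jacobi_expansion (a := b + 1) (b := a + 1) (by linarith)
    (by linarith) c hB
  have hfin := isFiniteMeasure_weightMeasure (show -1 < b + 1 by linarith)
    (show -1 < a + 1 by linarith)
  have hvi : Integrable (fun x => weight (b + 1) (a + 1) x * v x) unitMeasure :=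
    integrable_weightMeasure_iff.1 (hv.integrable (by norm_num))
  have hui : Integrable u unitMeasure := by
    have hwi : IntervalIntegrable w volume 0 1 := by
      rw [intervalIntegrable_iff_integrableOn_Ioo_of_le zero_le_one]; exact hw
    have huc : ContinuousOn u (Icc 0 1) := by
      refine ContinuousOn.congr (f := fun x => ∫ t in (0)..x, w t) ?_ fun x hx => ?_
      · rw [← uIcc_of_le (zero_le_one' ℝ)]
        exact intervalIntegral.continuousOn_primitive_interval' hwi left_mem_uIcc
      · beta_reduce
        rw [hu x hx, intervalIntegral.integral_of_le hx.1, integral_Ioc_eq_integral_Ioo]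
    exact huc.integrableOn_Icc.mono_set Ioo_subset_Icc_self
  -- Both functions are integrable and have the same moments against every G_n^{(b+1,a+1)}, so u is
  -- ω times the sum of the series.
  have huv : ∀ᵐ x ∂unitMeasure, u x - weight (b + 1) (a + 1) x * v x = 0 := by
    refine ae_eq_zero_of_jacobi (a := b + 1) (b := a + 1) (by linarith) (hui.sub hvi) fun n => ?_
    have hcj := (continuous_jacobiG n (b + 1) (a + 1)).continuousOn (s := Icc 0 1)
    have e1 := h.integral_solution_jacobi hw hF0 hu hu1 n
    rw [← hlam, ← hc, ← hvc n, weightInner] at e1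
    simp only [sub_mul]
    rw [integral_sub (integrable_mul_continuousOn hui hcj) (integrable_mul_continuousOn hvi hcj),
      e1, sub_self]
  set z : ℝ → ℝ := fun x => v x - ∑ i ∈ Finset.range (N + 1), c i * jacobiG i (b + 1) (a + 1) x
    with hz
  have hcont : ContinuousOn (fun x => ∑ i ∈ Finset.range (N + 1),
      c i * jacobiG i (b + 1) (a + 1) x) (Icc 0 1) := by
    have := fun n => continuous_jacobiG n (b + 1) (a + 1)
    fun_prop
  have hzm : MemLp z 2 (weightMeasure (b + 1) (a + 1)) :=
    hv.sub (memLp_weightMeasure_continuousOn (by linarith) (by linarith) hcont)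
  have e2 : weightNorm (-(b + 1)) (-(a + 1)) (fun x => u x - weight (b + 1) (a + 1) x *
        ∑ i ∈ Finset.range (N + 1), c i * jacobiG i (b + 1) (a + 1) x) =
      weightNorm (b + 1) (a + 1) z := by
    refine Eq.trans ?_ (weightNorm_weight_mul (b + 1) (a + 1) z)
    refine eLpNorm_congr_ae (ae_weightMeasure_iff.2 ?_)
    filter_upwards [huv] with x hx
    rw [sub_eq_zero.1 hx, hz]
    exact (mul_sub _ _ _).symm
  set D : ℝ := (m + 1) ^ m / (κ * ((N : ℝ) + 1) ^ p * (N + 1) ^ m) with hD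
  have hD0 : 0 ≤ D := by positivity
  have e3 := hvt (N + 1) ((D * (weightNorm (a + m) (b + m) (F m)).toReal) ^ 2) fun s hs => by
    simp only [hterm]
    exact jacobi_tail_le ha hb hab hF hint (hm m le_rfl) (N := N) (by positivity) (hlow' N) hN s hs
  have e4 : (weightNorm (b + 1) (a + 1) z).toReal ≤ D * (weightNorm (a + m) (b + m) (F m)).toReal :=
    (sq_le_sq₀ ENNReal.toReal_nonneg (mul_nonneg hD0 ENNReal.toReal_nonneg)).1 e3
  have f1 : weightNorm (b + 1) (a + 1) z ≠ ⊤ := hzm.2.ne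
  have f2 : weightNorm (a + m) (b + m) (F m) ≠ ⊤ := (hm m le_rfl).2.ne
  exact e2.trans_le (le_ofReal_mul_of_toReal_le f1 f2 hD0 e4)

/-! ### The source of the integrated equation -/

/-- The constant is a function of the bounds on K, taken to be a constant function when 0 < r < 1.
For r equal to 0 or 1 one of the exponents is zero, and the ratio of the bounds for 1/K enters. -/
lemma exists_primitive_bound {α r β : ℝ} (hα : 1 < α ∧ α < 2) (hβ : α - 1 ≤ β ∧ β ≤ 1)
    (hrβ : r = Real.sin (Real.pi * β) /
      (Real.sin (Real.pi * (α - β)) + Real.sin (Real.pi * β))) :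
    ∃ D : ℝ → ℝ → ℝ, (∀ Km KM, 0 < D Km KM) ∧
      (0 < r → r < 1 → ∀ Km KM Km' KM' : ℝ, D Km KM = D Km' KM') ∧
      ∀ {Km KM A : ℝ} {K f H : ℝ → ℝ}, 0 < Km →
        (∀ x ∈ Ioo (0 : ℝ) 1, Km ≤ K x ∧ K x ≤ KM) →
        AEStronglyMeasurable (f₂ K) unitMeasure →
        MemLp f 2 (weightMeasure β (α - β)) → LocallyIntegrableOn f (Ioo (0 : ℝ) 1) →
        (∀ x ∈ Ioo (0 : ℝ) 1, H x = (∫ t in (1 / 2)..x, f t) - A) →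
        ∫ x in Ioo (0 : ℝ) 1, weight (β - 1) (α - β - 1) x * (f₂ K x * H x) = 0 →
        weightNorm (β - 1) (α - β - 1) H ≤
          ENNReal.ofReal (D Km KM) * weightNorm β (α - β) f := by
  have h := fracParams_of hα hβ hrβ
  have hbd : ∀ {Km KM : ℝ} {K : ℝ → ℝ}, 0 < Km → (∀ x ∈ Ioo (0 : ℝ) 1, Km ≤ K x ∧ K x ≤ KM) →
      0 < 1 / KM ∧ ∀ x ∈ Ioo (0 : ℝ) 1, 1 / KM ≤ f₂ K x ∧ f₂ K x ≤ 1 / Km := by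
    intro Km KM K hKm hK
    have h2 := hK (1 / 2) (by norm_num)
    refine ⟨one_div_pos.2 (hKm.trans_le (h2.1.trans h2.2)), fun x hx => ⟨?_, ?_⟩⟩
    · exact one_div_le_one_div_of_le (hKm.trans_le (hK x hx).1) (hK x hx).2
    · exact one_div_le_one_div_of_le hKm (hK x hx).1
  by_cases hr : 0 < r ∧ r < 1
  · obtain ⟨D, hD, hD'⟩ := weightNorm_primitive_le_of_neg h.ha h.hb (h.neg_of_ne_zero hr.1.ne')
      (h.swap.neg_of_ne_zero (by linarith [hr.2]))
    rw [sub_add_cancel, sub_add_cancel] at hD'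
    exact ⟨fun _ _ => D, fun _ _ => hD, fun _ _ _ _ _ _ => rfl,
      fun hKm hK hm hf hfl hH h0 => hD' hf hfl hm (hbd hKm hK).1 (hbd hKm hK).2 hH h0⟩
  · obtain ⟨D, hD, hD'⟩ := weightNorm_primitive_le h.ha h.hb h.ha0 h.hb0 (by linarith)
    rw [sub_add_cancel, sub_add_cancel] at hD'
    exact ⟨fun Km KM => D * (1 + |1 / Km / (1 / KM)|), fun _ _ => by positivity,
      fun h0 h1 => absurd ⟨h0, h1⟩ hr,
      fun hKm hK hm hf hfl hH h0 => hD' hf hfl hm (hbd hKm hK).1 (hbd hKm hK).2 hH h0⟩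

lemma integral_Ioo_eq_add {f : ℝ → ℝ} (hf : ∀ x ∈ Ioo (0 : ℝ) 1, IntegrableOn f (Ioo 0 x))
    {x : ℝ} (hx : x ∈ Ioo (0 : ℝ) 1) :
    ∫ y in Ioo (0 : ℝ) x, f y = (∫ t in (1 / 2)..x, f t) + ∫ y in Ioo (0 : ℝ) (1 / 2), f y := by
  have hi : ∀ y ∈ Ioo (0 : ℝ) 1, IntervalIntegrable f volume 0 y := fun y hy => by
    rw [intervalIntegrable_iff_integrableOn_Ioo_of_le hy.1.le]; exact hf y hy
  have hc : (1 / 2 : ℝ) ∈ Ioo (0 : ℝ) 1 := by norm_num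
  have h1 := intervalIntegral.integral_add_adjacent_intervals (hi _ hc) ((hi _ hc).symm.trans (hi x hx))
  rw [intervalIntegral.integral_of_le hx.1.le, intervalIntegral.integral_of_le hc.1.le,
    integral_Ioc_eq_integral_Ioo, integral_Ioc_eq_integral_Ioo] at h1
  linarith

/-- The solution's flux constant and spectral coefficients, from the source with vanishing mean. -/
lemma spectralCoeff_eq {α β A Vm VM : ℝ} {K f F : ℝ → ℝ} (ha : 0 < β) (hb : β < α)
    (hVmeas : AEStronglyMeasurable (f₂ K) unitMeasure) (hVm : 0 < Vm)
    (hV : ∀ x ∈ Ioo (0 : ℝ) 1, Vm ≤ f₂ K x ∧ f₂ K x ≤ VM)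
    (hF : ∀ x, F x = f₁ K f x - A * f₂ K x)
    (hFi : Integrable (fun x => weight (β - 1) (α - β - 1) x * F x) unitMeasure)
    (h0 : ∫ x in Ioo (0 : ℝ) 1, weight (β - 1) (α - β - 1) x * F x = 0) (i : ℕ) :
    spectralCoeff α β K f i =
      -(weightInner (β - 1) (α - β - 1) F (jacobiG (i + 1) (β - 1) (α - β - 1)) /
        jacobiNormSq (i + 1) (β - 1) (α - β - 1) / eigenval α β i) := by
  have hw := integrable_weight (a := β - 1) (b := α - β - 1) (by linarith) (by linarith)
  have hVi : Integrable (fun x => weight (β - 1) (α - β - 1) x * f₂ K x) unitMeasure :=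
    hw.mul_bdd (c := VM) hVmeas (ae_unit_of_forall fun x hx => by
      rw [Real.norm_of_nonneg (hVm.le.trans (hV x hx).1)]; exact (hV x hx).2)
  have key : ∀ q : ℝ → ℝ, Continuous q →
      weightInner (β - 1) (α - β - 1) (f₁ K f) q =
        weightInner (β - 1) (α - β - 1) F q + A * weightInner (β - 1) (α - β - 1) (f₂ K) q := by
    intro q hq
    rw [weightInner, weightInner, weightInner, ← integral_const_mul,
      ← integral_add (integrable_mul_continuousOn hFi hq.continuousOn)
        ((integrable_mul_continuousOn hVi hq.continuousOn).const_mul A)]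
    refine integral_congr_ae (Filter.Eventually.of_forall fun x => ?_)
    simp only [hF]
    ring
  have hpos : 0 < weightInner (β - 1) (α - β - 1) (f₂ K) (fun _ => 1) := by
    have h1 := integral_weight_pos (a := β - 1) (b := α - β - 1) (by linarith) (by linarith)
    simp only [weightInner, mul_one]
    refine (mul_pos h1 hVm).trans_le ?_
    rw [← integral_mul_const]
    exact setIntegral_mono_on (hw.mul_const Vm) hVi measurableSet_Ioo fun x hx =>
      mul_le_mul_of_nonneg_left (hV x hx).1 (weight_pos _ _ hx).le
  -- Pairing f₁ = F + A f₂ with 1 and using that F has mean zero shows that A is the quotient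
  -- defining A_*.
  have hA : constA α β K f = A := by
    have h1 : weightInner (β - 1) (α - β - 1) F (fun _ => 1) = 0 := by
      simpa only [weightInner, mul_one] using h0
    rw [constA, key _ continuous_const, h1, zero_add, mul_div_cancel_right₀ _ hpos.ne']
  rw [spectralCoeff, hA, jacobiCoeff, jacobiCoeff, key _ (continuous_jacobiG _ _ _)]
  rw [← jacobiNormSq]
  ring

/-- The derivatives of the source `(∫ f - A) / K`, with their weighted norms. -/
lemma exists_source_chain {s : ℕ} {a b A : ℝ} {V f H : ℝ → ℝ} {D : ℝ} (hD : 0 < D)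
    (hV : sobolevInftyNorm (s + 1) V < ⊤) (hf : weightSobolevNorm s (a + 1) (b + 1) f < ⊤)
    (hH : ∀ x ∈ Ioo (0 : ℝ) 1, H x = (∫ t in (1 / 2)..x, f t) - A)
    (hHn : weightNorm a b H ≤ ENNReal.ofReal D * weightNorm (a + 1) (b + 1) f) :
    ∃ F : ℕ → ℝ → ℝ, (F 0 = fun x => V x * H x) ∧
      (∀ k < s + 1, IsWeakDeriv 1 (F k) (F (k + 1))) ∧
      (∀ k ≤ s + 1, MemLp (F k) 2 (weightMeasure (a + k) (b + k))) ∧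
      ∀ k ≤ s + 1, weightNorm (a + k) (b + k) (F k) ≤ 2 ^ (s + 1) *
        (sobolevInftyNorm (s + 1) V *
          (ENNReal.ofReal (D + 1) * weightSobolevNorm s (a + 1) (b + 1) f)) := by
  obtain ⟨G, hG0, hGd, hGn⟩ := exists_chain_of_weightSobolevNorm hf
  obtain ⟨W, hW0, hWd, hWn⟩ := exists_chain_of_sobolevInftyNorm hV
  have hfl : LocallyIntegrableOn f (Ioo (0 : ℝ) 1) := (hGd 0 (Nat.zero_le _)).1
  have hc : (1 / 2 : ℝ) ∈ Ioo (0 : ℝ) 1 := by norm_num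
  have hHp : IsPrimitive H f := ⟨hfl, fun x hx y hy => by
    rw [hH x hx, hH y hy]
    simpa using (isPrimitive_integral hfl hc (-A)).2 x hx y hy⟩
  -- The derivatives of H are H, f, f', …; the index shift by one matches the weights, since (a + 1)
  -- + j = a + (j + 1).
  let Hs : ℕ → ℝ → ℝ := fun k => Nat.rec H (fun j _ => G j) k
  have hHs : ∀ k < s + 1, IsWeakDeriv 1 (Hs k) (Hs (k + 1)) := fun k hk => by
    cases k with
    | zero =>
      change IsWeakDeriv 1 H (G 0)
      rw [hG0]; exact hHp.isWeakDeriv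
    | succ j => exact (hGd j (by omega)).succ (hGd (j + 1) (by omega))
  have hWs : ∀ k < s + 1, IsWeakDeriv 1 (W k) (W (k + 1)) := fun k hk =>
    (hWd k (by omega)).succ (hWd (k + 1) (by omega))
  have hmeas : ∀ {g : ℕ → ℝ → ℝ}, (∀ k < s + 1, IsWeakDeriv 1 (g k) (g (k + 1))) →
      ∀ k ≤ s + 1, AEStronglyMeasurable (g k) unitMeasure := fun {g} hg k hk => by
    rcases Nat.lt_or_ge k (s + 1) with h | h
    · exact (hg k h).1.aestronglyMeasurable
    · obtain rfl : k = s + 1 := by omega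
      exact (hg s (by omega)).2.1.aestronglyMeasurable
  -- D + 1 serves both cases: it exceeds D, needed for H, and 1, needed for the derivatives of f.
  have hHsn : ∀ k ≤ s + 1, weightNorm (a + k) (b + k) (Hs k) ≤
      ENNReal.ofReal (D + 1) * weightSobolevNorm s (a + 1) (b + 1) f := fun k hk => by
    cases k with
    | zero =>
      have h1 := hGn 0 (Nat.zero_le _)
      rw [hG0] at h1
      simp only [Nat.cast_zero, add_zero] at h1 ⊢
      exact hHn.trans (mul_le_mul' (ENNReal.ofReal_le_ofReal (by linarith)) h1)
    | succ j =>
      have h1 := hGn j (by omega)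
      rw [add_right_comm a, add_right_comm b, add_assoc a, add_assoc b] at h1
      push_cast
      refine h1.trans (le_mul_of_one_le_left' ?_)
      rw [ENNReal.one_le_ofReal]
      linarith
  have hF := fun k hk => isWeakDeriv_leibniz hWs hHs (k := k) hk
  have hn : ∀ k ≤ s + 1, weightNorm (a + k) (b + k) (leibniz W Hs k) ≤ 2 ^ (s + 1) *
        (sobolevInftyNorm (s + 1) V *
          (ENNReal.ofReal (D + 1) * weightSobolevNorm s (a + 1) (b + 1) f)) := fun k hk =>
    (weightNorm_leibniz_le (fun i hi => hmeas hWs i (hi.trans hk))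
      (fun i hi => hmeas hHs i (hi.trans hk)) (fun i hi => hWn i (hi.trans hk))
      (fun i hi => hHsn i (hi.trans hk))).trans
      (mul_le_mul_left (pow_le_pow_right₀ (by norm_num) hk) _)
  refine ⟨leibniz W Hs, ?_, hF, fun k hk => ⟨aestronglyMeasurable_weightMeasure_iff.2
    (hmeas hF k hk), (hn k hk).trans_lt ?_⟩, hn⟩
  · funext x
    simp [leibniz, hW0, Hs]
  · exact ENNReal.mul_lt_top (by finiteness)
      (ENNReal.mul_lt_top hV (ENNReal.mul_lt_top ENNReal.ofReal_lt_top hf))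

/-- For m = s + 1 the exponents add up to (α - 1) + (s + 1) = α + s. The alternative m = 0 concerns
small N, where N + 1 ≤ s + 2 lets the constant absorb the missing powers. -/
lemma rate_le {κ α : ℝ} (hκ : 0 < κ) (s N m : ℕ) (hm : m = s + 1 ∨ m = 0 ∧ N ≤ s) :
    ((m : ℝ) + 1) ^ m / (κ * ((N : ℝ) + 1) ^ (α - 1) * ((N : ℝ) + 1) ^ m) ≤
      ((s : ℝ) + 2) ^ (s + 1) / κ / ((N : ℝ) + 1) ^ (α + s) := by
  have hN : (0 : ℝ) < N + 1 := by positivity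
  have e : ((N : ℝ) + 1) ^ (α + s) = ((N : ℝ) + 1) ^ (α - 1) * ((N : ℝ) + 1) ^ (s + 1) := by
    rw [← Real.rpow_natCast, ← Real.rpow_add hN]
    congr 1
    push_cast
    ring
  have hp : 0 < ((N : ℝ) + 1) ^ (α - 1) := Real.rpow_pos_of_pos hN _
  rw [e, div_div, ← mul_assoc]
  rcases hm with rfl | ⟨rfl, hNs⟩
  · push_cast
    rw [add_assoc, one_add_one_eq_two]
  · rw [pow_zero, pow_zero, mul_one, div_le_div_iff₀ (by positivity) (by positivity), one_mul,
      mul_comm (κ * _)]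
    refine mul_le_mul_of_nonneg_right (pow_le_pow_left₀ hN.le ?_ _) (by positivity)
    have : (N : ℝ) ≤ s := by exact_mod_cast hNs
    linarith

end FracDiff

end

/-! ### The error estimate -/

theorem mainTheorem5 (α r β : ℝ) (hα : 1 < α ∧ α < 2) (hr : 0 ≤ r ∧ r ≤ 1)
    (hβ : α - 1 ≤ β ∧ β ≤ 1)
    (hrβ : r = Real.sin (Real.pi * β) /
      (Real.sin (Real.pi * (α - β)) + Real.sin (Real.pi * β)))
    (s : ℕ) :
    ∃ C : ℝ → ℝ → ℝ, (∀ Km KM : ℝ, 0 < C Km KM) ∧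
      (0 < r → r < 1 → ∀ Km KM Km' KM' : ℝ, C Km KM = C Km' KM') ∧
      ∀ (Km KM : ℝ) (K f u : ℝ → ℝ), 0 < Km →
        (∀ x ∈ Set.Ioo (0 : ℝ) 1, Km ≤ K x ∧ K x ≤ KM) →
        FracDiff.sobolevInftyNorm (s + 1) (fun x => 1 / K x) < ⊤ →
        FracDiff.weightSobolevNorm s β (α - β) f < ⊤ →
        FracDiff.IsSolution α r K f u →
        ∀ N : ℕ,
          FracDiff.weightNorm (-(α - β)) (-β)
              (fun x => u x - FracDiff.spectralApprox α β K f N x) ≤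
            ENNReal.ofReal (C Km KM) * FracDiff.sobolevInftyNorm (s + 1) (fun x => 1 / K x) /
                ((N : ENNReal) + 1) ^ (α + (s : ℝ)) *
              (FracDiff.weightSobolevNorm s β (α - β) f + 1) := by
  open FracDiff in
  have h := fracParams_of hα hβ hrβ
  obtain ⟨κ, hκ, hlow⟩ := exists_eigenval_lower hα hβ
  obtain ⟨D, hD0, hDc, hDb⟩ := exists_primitive_bound hα hβ hrβ
  set E : ℝ := ((s : ℝ) + 2) ^ (s + 1) / κ with hE
  have hE0 : 0 < E := by positivity
  refine ⟨fun Km KM => E * (2 ^ (s + 1) * (D Km KM + 1)), fun Km KM => ?_,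
    fun h0 h1 Km KM Km' KM' => by beta_reduce; rw [hDc h0 h1 Km KM Km' KM'], ?_⟩
  · have := hD0 Km KM
    positivity
  intro Km KM K f u hKm hK hKn hfn hsol N
  obtain ⟨hfi, w, hw, hu, -, hu1, A, hA⟩ := hsol
  set V : ℝ → ℝ := f₂ K with hV
  set H : ℝ → ℝ := fun x => (∫ y in Ioo (0 : ℝ) x, f y) - A with hHdef
  -- The primitive is rebased at 1/2, an interior point, and ∫_0^{1/2} f is absorbed into the
  -- constant.
  set A' := A - ∫ y in Ioo (0 : ℝ) (1 / 2), f y with hA'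
  have hH : ∀ x ∈ Ioo (0 : ℝ) 1, H x = (∫ t in (1 / 2)..x, f t) - A' := fun x hx => by
    rw [hHdef, hA']
    simp only
    rw [integral_Ioo_eq_add hfi hx]; ring
  have hFeq : ∀ x, V x * H x = f₁ K f x - A * f₂ K x := fun x => by
    simp only [hV, hHdef, f₁, f₂]; ring
  have hF0 : ∀ᵐ x ∂unitMeasure, -fracOp r (2 - α) w x = V x * H x := by
    filter_upwards [hA] with x hx
    rw [hFeq]; exact hx
  have hmean := h.mean_zero hw hF0 hu hu1
  obtain ⟨W, hW0, hWd, -⟩ := exists_chain_of_sobolevInftyNorm hKn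
  have hVm : AEStronglyMeasurable V unitMeasure := (hWd 0 (Nat.zero_le _)).1.aestronglyMeasurable
  obtain ⟨G, hG0, hGd, hGn⟩ := exists_chain_of_weightSobolevNorm hfn
  have hfl := (hGd 0 (Nat.zero_le _)).1
  have hf2 : MemLp f 2 (weightMeasure β (α - β)) := by
    refine ⟨aestronglyMeasurable_weightMeasure_iff.2 hfl.aestronglyMeasurable, ?_⟩
    have h1 := (hGn 0 (Nat.zero_le _)).trans_lt hfn
    rw [hG0] at h1
    simpa [weightNorm] using h1
  have hHn := hDb hKm hK hVm hf2 hfl hH hmean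
  have ea : β - 1 + 1 = β := by ring
  have eb : α - β - 1 + 1 = α - β := by ring
  obtain ⟨F, hF00, hFd, hFm, hFn⟩ := exists_source_chain (s := s) (a := β - 1) (b := α - β - 1)
    (V := V) (f := f) (H := H) (A := A') (hD0 Km KM) hKn (by rwa [ea, eb]) hH (by rwa [ea, eb])
  rw [ea, eb] at hFn
  -- All s + 1 derivatives are used when the tail estimate permits, that is m ≤ N + 2; otherwise N
  -- is small compared with s and no derivative is needed.
  obtain ⟨m, hms, hmN, hm⟩ : ∃ m, m ≤ s + 1 ∧ m ≤ N + 2 ∧ (m = s + 1 ∨ m = 0 ∧ N ≤ s) := by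
    by_cases hc : s + 1 ≤ N + 2
    · exact ⟨s + 1, le_rfl, hc, Or.inl rfl⟩
    · exact ⟨0, by omega, by omega, Or.inr ⟨rfl, by omega⟩⟩
  have hK2 := hK (1 / 2) (by norm_num)
  have hF0i : MemLp (F 0) 2 (weightMeasure (β - 1) (α - β - 1)) := by
    simpa using hFm 0 (Nat.zero_le _)
  have hfin := isFiniteMeasure_weightMeasure h.ha h.hb
  have hFi := integrable_weightMeasure_iff.1 (hF0i.integrable (by norm_num))
  have hF0' : ∀ x, F 0 x = V x * H x := fun x => by rw [hF00]
  have hc := spectralCoeff_eq (α := α) (β := β) (A := A) (K := K) (f := f) (F := F 0)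
    (Vm := 1 / KM) (VM := 1 / Km) (by linarith) (by linarith) hVm
    (one_div_pos.2 (hKm.trans_le (hK2.1.trans hK2.2)))
    (fun x hx => ⟨one_div_le_one_div_of_le (hKm.trans_le (hK x hx).1) (hK x hx).2,
      one_div_le_one_div_of_le hKm (hK x hx).1⟩)
    (fun x => by rw [hF0', hFeq]) hFi (by simpa only [hF0'] using hmean)
  have herr := h.spectral_error hw (F := F) (by simpa only [hF0'] using hF0) hu hu1
    (m := m) (N := N) (fun k hk => hFd k (by omega)) (fun k hk => hFm k (by omega)) hκ
    (p := α - 1) (by linarith) (eigenval_eq hα hβ) hc hlow hmN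
  rw [ea, eb] at herr
  refine (show weightNorm (-(α - β)) (-β) (fun x => u x - spectralApprox α β K f N x) ≤ _ from
    herr).trans ?_
  refine (mul_le_mul' (ENNReal.ofReal_le_ofReal (rate_le (α := α) hκ s N m hm))
    (hFn m hms)).trans ?_
  have hN : (0 : ℝ) < (N : ℝ) + 1 := by positivity
  have e1 : ((N : ℝ≥0∞) + 1) ^ (α + (s : ℝ)) = ENNReal.ofReal (((N : ℝ) + 1) ^ (α + (s : ℝ))) := by
    rw [← ENNReal.ofReal_rpow_of_pos hN, ENNReal.ofReal_add (by positivity) zero_le_one,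
      ENNReal.ofReal_natCast, ENNReal.ofReal_one]
  have e2 : ENNReal.ofReal ((2 : ℝ) ^ (s + 1)) = 2 ^ (s + 1) := by
    rw [ENNReal.ofReal_pow (by norm_num), ENNReal.ofReal_ofNat]
  rw [e1, ← hE, ENNReal.ofReal_div_of_pos (Real.rpow_pos_of_pos hN _), ENNReal.ofReal_mul hE0.le,
    ENNReal.ofReal_mul (by positivity), e2, div_eq_mul_inv, div_eq_mul_inv]
  -- The estimate already holds with ‖f‖ in place of ‖f‖ + 1.
  refine le_trans (le_of_eq ?_) (mul_le_mul_right (le_add_of_nonneg_right zero_le_one) _)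
  change _ = _ * sobolevInftyNorm (s + 1) V * _ * _
  ring
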